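/- \textbf{Syntax.} All syntax is taken up to renaming of bound variables. \emph{VS types}: $U ::= \mathsf{vty} \mid U^{a}\times U^{a} \mid t \mid \mathsf{corec}\,t.\,U$, where each availability $a$ is either "available" (not written) or "unavailable" (written $\bot$). \emph{Vertex structures} (VSs): $u ::= \mathsf{u} \mid s \mid (u,u) \mid \mathsf{fst}\,u \mid \mathsf{snd}\,u$ with VS variables $\mathsf u$ and generators $s$. A \emph{vertex path} $p$ is a generator to which finitely many projections are applied. \emph{Graph types}: $G ::= \gamma \mid \bullet \mid G\oplus G \mid G\vee G \mid \mu\gamma.G \mid G/_u \mid {\uparrow}u \mid \Pi\mathsf u_f{:}U_f.\Pi\mathsf u_t{:}U_t.\,G \mid G[u;u] \mid \nu\mathsf u{:}U.\,G$. Here $G/_u$ is a future with end vertex $u$ and ${\uparrow}u$ a touch of $u$. Graph types are identified along the congruence generated by $\bullet\oplus\bullet=\bullet$. Graph kinds: $K ::= * \mid \Pi U_f.\Pi U_t.K$. \emph{Type constructors}: $c,\tau ::= \mathsf{unit} \mid \Pi\mathsf u_f{:}U_f.\Pi\mathsf u_t{:}U_t.\,\tau\xrightarrow{G}\tau \mid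 \tau\times\tau \mid \tau+\tau \mid \tau\ \mathsf{fut}@u \mid \alpha \mid (\mathsf{rec}\,\alpha(\mathsf u{:}U).\tau)\,u \mid \Lambda\mathsf u{:}U.\,c \mid c\,u$, with kinds $\mathsf{Ty}$ and $U\to\mathsf{Ty}$. \emph{Expressions}: $e ::= x \mid \langle\rangle \mid \mathsf{fun}\,\mathsf u_f\,\mathsf u_t\,f\,x.\,e \mid e_1[u_f;u_t]\,e_2 \mid (e,e) \mid \mathsf{fst}\,e \mid \mathsf{snd}\,e \mid \mathsf{inl}\,e \mid \mathsf{inr}\,e \mid \mathsf{case}\,e\,\{x.e_1; y.e_2\} \mid \mathsf{roll}\,e \mid \mathsf{unroll}\,e \mid \mathsf{future}_u\,e \mid \mathsf{force}\,e \mid \mathsf{new}\,\mathsf u{:}U.\,e \mid \mathsf{handle}_p\,v$. \emph{Values} are $\langle\rangle$, functions, and pairs, injections, $\mathsf{roll}$s and handles $\mathsf{handle}_p v$ of values ($p$ a vertex path). \textbf{VS contexts.} $\Omega$ (affine) and $\Psi$ (unrestricted) are finite or infinite partial maps from VS variables and generators to VS types. \emph{Subtyping} $<:$ is the least reflexive transitive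 relation with $U_1^{a_1}\times U_2^{a_2}<:U_3^\bot\times U_2^{a_2}$, $U_1^{a_1}\times U_2^{a_2}<:U_1^{a_1}\times U_3^\bot$, componentwise subtyping of products with equal availabilities, and $\mathsf{corec}\,t.U <: U[\mathsf{corec}\,t.U/t] <: \mathsf{corec}\,t.U$. \emph{Splitting} $U\rightsquigarrow U',U''$ is the least relation, symmetric in $U',U''$, such that: $U_1\times U_2\rightsquigarrow U_1\times U_2^\bot,\ U_1^\bot\times U_2$; if $U_1\rightsquigarrow U_1',U_1''$ and $U_2\rightsquigarrow U_2',U_2''$ then $U_1\times U_2\rightsquigarrow U_1'\times U_2',\ U_1''\times U_2''$; if $U_1\rightsquigarrow U_1',U_1''$ then $U_1\times U_2^a\rightsquigarrow U_1'\times U_2^a,\ U_1''\times U_2^\bot$; if $U_2\rightsquigarrow U_2',U_2''$ then $U_1^a\times U_2\rightsquigarrow U_1^a\times U_2',\ U_1^\bot\times U_2''$; if $U[\mathsf{corec}\,t.U/t]\rightsquigarrow U',U''$ then $\mathsf{corec}\,t.U\rightsquigarrow U',U''$; and if $U\rightsquigarrow U',U''$ and $U'<:V$ then $U\rightsquigarrow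 V,U''$. A context splits, $\Omega\rightsquigarrow\Omega_1,\Omega_2$, entry by entry: each entry goes wholly to $\Omega_1$, or wholly to $\Omega_2$, or its VS type is split between them. \emph{VS typing} $\Omega;\Psi\vdash u:U$. Variables and generators have the VS types given by $\Omega$ or by $\Psi$. If $\Omega\rightsquigarrow\Omega_1,\Omega_2$ and $\Omega_i;\Psi\vdash u_i:U_i$ then $\Omega;\Psi\vdash(u_1,u_2):U_1\times U_2$. If $\Omega;\Psi\vdash u_1:U_1$ and $\cdot;\Psi'\vdash u_2:U_2$ for some $\Psi'$ then $\Omega;\Psi\vdash(u_1,u_2):U_1\times U_2^\bot$; symmetrically for $U_1^\bot\times U_2$. $\mathsf{fst}$ and $\mathsf{snd}$ project available components. Subsumption along $<:$ holds. \emph{VS equivalence} $\Psi\vdash u=u':U$ is the least relation that is reflexive on VSs with $\cdot;\Psi\vdash u:U$, symmetric, transitive, compatible with pairs (of VS type $U_1\times U_2$, and of VS types $U_1\times U_2^\bot$ and $U_1^\bot\times U_2$, where the unavailable components are equivalent under an arbitrary $\Psi'$), with projections of available components and with subsumption, and such that $\Psi\vdash u=(u_1,u_2):U_1\times U_2^a$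 gives $\Psi\vdash\mathsf{fst}\,u=u_1:U_1$, and likewise for $\mathsf{snd}$. \emph{VS normalization} $u\Downarrow u'$ normalizes subterms and reduces $\mathsf{fst}(u_1,u_2)$ to $u_1$ and $\mathsf{snd}(u_1,u_2)$ to $u_2$. \textbf{Graph kinding} $\Delta;\Omega;\Psi\vdash G:K$. $\bullet:*$, and $\gamma:K$ if $\gamma{:}K\in\Delta$. $G_1\oplus G_2:*$ if $\Omega\rightsquigarrow\Omega_1,\Omega_2$ and $\Delta;\Omega_i;\Psi\vdash G_i:*$. $G_1\vee G_2:*$ if both are of kind $*$ under $\Omega$. $G/_u:*$ if $\Omega\rightsquigarrow\Omega_1,\Omega_2$, $\Delta;\Omega_1;\Psi\vdash G:*$ and $\Omega_2;\cdot\vdash u:\mathsf{vty}$. ${\uparrow}u:*$ if $\cdot;\Psi\vdash u:\mathsf{vty}$. $\nu\mathsf u{:}U.G:*$ if $\Delta;\Omega,\mathsf u{:}U;\Psi,\mathsf u{:}U\vdash G:*$. $\Pi\mathsf u_f{:}U_f.\Pi\mathsf u_t{:}U_t.G:\Pi U_f.\Pi U_t.*$ if $\Delta;\Omega,\mathsf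 u_f{:}U_f;\Psi,\mathsf u_f{:}U_f,\mathsf u_t{:}U_t\vdash G:*$. $\mu\gamma.\Pi\mathsf u_f{:}U_f.\Pi\mathsf u_t{:}U_t.G:\Pi U_f.\Pi U_t.*$ if $\Delta,\gamma{:}\Pi U_f.\Pi U_t.*;\mathsf u_f{:}U_f;\Psi,\mathsf u_f{:}U_f,\mathsf u_t{:}U_t\vdash G:*$. $G[u_f;u_t]:*$ if $\Omega\rightsquigarrow\Omega_1,\Omega_2$, $\Delta;\Omega_1;\Psi\vdash G:\Pi U_f.\Pi U_t.*$, $\Omega_2;\cdot\vdash u_f:U_f$, $\cdot;\Psi\vdash u_f:U_f$ and $\cdot;\Psi\vdash u_t:U_t$. \textbf{Kinding} $\Delta;\Psi;\Sigma\vdash c:\kappa$, with $\Sigma$ assigning kinds to constructor variables. $\mathsf{unit}:\mathsf{Ty}$; variables as in $\Sigma$; products and sums of types are types. $\Pi\mathsf u_f{:}U_f.\Pi\mathsf u_t{:}U_t.\,\tau_1\xrightarrow{G[\mathsf u_f;\mathsf u_t]}\tau_2:\mathsf{Ty}$ if $\tau_1,\tau_2:\mathsf{Ty}$ under $\Psi,\mathsf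 u_f{:}U_f,\mathsf u_t{:}U_t$ and $\Delta;\cdot;\Psi\vdash G:\Pi U_f.\Pi U_t.*$. $\tau\ \mathsf{fut}@u:\mathsf{Ty}$ if $\tau:\mathsf{Ty}$ and $\cdot;\Psi\vdash u:\mathsf{vty}$. $(\mathsf{rec}\,\alpha(\mathsf u{:}U).\tau)\,u:\mathsf{Ty}$ if $\Delta;\Psi,\mathsf u{:}U;\Sigma,\alpha{:}U\to\mathsf{Ty}\vdash\tau:\mathsf{Ty}$ and $\cdot;\Psi\vdash u:U$. $\Lambda\mathsf u{:}U.c:U\to\mathsf{Ty}$ if $c:\mathsf{Ty}$ under $\Psi,\mathsf u{:}U$. $c\,u:\mathsf{Ty}$ if $c:U\to\mathsf{Ty}$ and $\cdot;\Psi\vdash u:U$. \emph{Type equivalence} $\Delta;\Psi;\Sigma\vdash c=c':\kappa$ is the least relation on such constructors that is an equivalence relation (reflexive on well-kinded constructors), contains $(\Lambda\mathsf u{:}U.c)\,u=c[u/\mathsf u]$, and is compatible with all constructor formers, where VSs may be replaced by VSs equivalent under the $\Psi$ in scope and the graph type of a function type is kept. \textbf{Typing} $\Delta;\Omega;\Psi;\Gamma\vdash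 e:\tau;G$ (type $\tau$, graph type $G$). Variables $x{:}\tau\in\Gamma$ have type $\tau$ and $\langle\rangle$ has type $\mathsf{unit}$, both with graph type $\bullet$. If $\Delta,\gamma{:}\Pi U_f.\Pi U_t.*;\ \mathsf u_f{:}U_f;\ \Psi,\mathsf u_f{:}U_f,\mathsf u_t{:}U_t;\ \Gamma,f{:}\Pi\mathsf u_f{:}U_f.\Pi\mathsf u_t{:}U_t.\tau_1\xrightarrow{\gamma[\mathsf u_f;\mathsf u_t]}\tau_2,x{:}\tau_1\vdash e:\tau_2;G$ with $\gamma$ not in $\tau_1,\tau_2$, and $\Delta;\Psi,\mathsf u_f{:}U_f,\mathsf u_t{:}U_t;\cdot\vdash\tau_i:\mathsf{Ty}$, then $\mathsf{fun}\,\mathsf u_f\,\mathsf u_t\,f\,x.e$ has type $\Pi\mathsf u_f{:}U_f.\Pi\mathsf u_t{:}U_t.\tau_1\xrightarrow{G'[\mathsf u_f;\mathsf u_t]}\tau_2$ with $G'=\mu\gamma.\Pi\mathsf u_f{:}U_f.\Pi\mathsf u_t{:}U_t.G$, and graph type $\bullet$. If $\Omega\rightsquigarrow\Omega_1,\Omega'$,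 $\Omega'\rightsquigarrow\Omega_2,\Omega_3$, under $\Omega_1$ $e_1:\Pi\mathsf u_f{:}U_f.\Pi\mathsf u_t{:}U_t.\tau_1\xrightarrow{G_3[\mathsf u_f;\mathsf u_t]}\tau_2;G_1$ ($\mathsf u_f,\mathsf u_t$ not in $G_3$), under $\Omega_2$ $e_2:\tau_1[u_f/\mathsf u_f,u_t/\mathsf u_t];G_2$, $\Omega_3;\cdot\vdash u_f:U_f$, $\cdot;\Psi\vdash u_f:U_f$ and $\cdot;\Psi\vdash u_t:U_t$, then $e_1[u_f;u_t]e_2:\tau_2[u_f/\mathsf u_f,u_t/\mathsf u_t];(G_1\oplus G_2)\oplus G_3[u_f;u_t]$. If $\Omega\rightsquigarrow\Omega_1,\Omega_2$: $(e_1,e_2):\tau_1\times\tau_2;G_1\oplus G_2$ if $e_i:\tau_i;G_i$ under $\Omega_i$; $\mathsf{case}\,e\{x.e_1;y.e_2\}:\tau;G_1\oplus(G_2\vee G_3)$ if $e:\tau_1+\tau_2;G_1$ under $\Omega_1$ and $e_1:\tau;G_2$ and $e_2:\tau;G_3$ under $\Omega_2$ with $x{:}\tau_1$, resp. $y{:}\tau_2$;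 $\mathsf{future}_u e:\tau\ \mathsf{fut}@u;G/_u$ if $e:\tau;G$ under $\Omega_1$, $\Omega_2;\cdot\vdash u:\mathsf{vty}$ and $\cdot;\Psi\vdash u:\mathsf{vty}$. Projections and injections have the usual types (the other summand being well-kinded) and the graph type of the subexpression. With $\tau'=\tau[u/\mathsf u][\Lambda\mathsf w{:}U.(\mathsf{rec}\,\alpha(\mathsf u{:}U).\tau)\,\mathsf w/\alpha]$: if $e:\tau';G$ and $(\mathsf{rec}\,\alpha(\mathsf u{:}U).\tau)\,u$ is a well-kinded type then $\mathsf{roll}\,e:(\mathsf{rec}\,\alpha(\mathsf u{:}U).\tau)\,u;G$, and if $e:(\mathsf{rec}\,\alpha(\mathsf u{:}U).\tau)\,u;G$ then $\mathsf{unroll}\,e:\tau';G$. If $e:\tau\ \mathsf{fut}@u;G$ then $\mathsf{force}\,e:\tau;G\oplus{\uparrow}u$. If $e:\tau;G$ under $\Omega,\mathsf u{:}U;\Psi,\mathsf u{:}U$ and $\tau$ is well-kinded without $\mathsf u$, then $\mathsf{new}\,\mathsf u{:}U.e:\tau;\nu\mathsf u{:}U.G$. If $v:\tau;\bullet$ under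 the empty affine context and $\cdot;\Psi\vdash p:\mathsf{vty}$, then $\mathsf{handle}_pv:\tau\ \mathsf{fut}@p;\bullet$. Types may be replaced by equivalent types. \textbf{Computation graphs} are quadruples $(V,E,\text{start},\text{end})$ whose vertices are VSs or anonymous vertices. With a fresh anonymous vertex $w$: $\bullet=(\{w\},\emptyset,w,w)$; ${\uparrow}p=(\{w\},\{(p,w)\},w,w)$; and for $g=(V,E,a,b)$ with $w,p\notin V$, $g/_p=(V\cup\{p,w\},E\cup\{(w,a),(b,p)\},w,w)$. For disjoint vertex sets $V_1,V_2$, $(V_1,E_1,a_1,b_1)\oplus(V_2,E_2,a_2,b_2)=(V_1\cup V_2,E_1\cup E_2\cup\{(b_1,a_2)\},a_1,b_2)$. \textbf{Cost semantics} $e\Downarrow v;g$, call by value. A value evaluates to itself with $\bullet$. If $e_1\Downarrow F;g_1$ with $F=\mathsf{fun}\,\mathsf u_f\,\mathsf u_t\,f\,x.e$, $e_2\Downarrow v';g_2$ and $e[u_f/\mathsf u_f,u_t/\mathsf u_t][F/f,v'/x]\Downarrow v;g_3$, then $e_1[u_f;u_t]e_2\Downarrow v;g_1\oplus g_2\oplus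 g_3$. If $e_i\Downarrow v_i;g_i$ then $(e_1,e_2)\Downarrow(v_1,v_2);g_1\oplus g_2$. Projections, injections, $\mathsf{roll}$ and $\mathsf{unroll}$ act on the value of their argument and keep its graph. If $e\Downarrow\mathsf{inl}\,v;g_1$ and $e_1[v/x]\Downarrow v';g_2$ then $\mathsf{case}\,e\{x.e_1;y.e_2\}\Downarrow v';g_1\oplus g_2$, and likewise for $\mathsf{inr}$. If $e\Downarrow v;g$ and $u\Downarrow p$ then $\mathsf{future}_ue\Downarrow\mathsf{handle}_pv;g/_p$. If $e\Downarrow\mathsf{handle}_pv;g$ then $\mathsf{force}\,e\Downarrow v;g\oplus{\uparrow}p$. If $e[s/\mathsf u]\Downarrow v;g$ for a fresh generator $s$ then $\mathsf{new}\,\mathsf u{:}U.e\Downarrow v;g$. A generator is fresh if it is neither in a given finite set $S$ of generators in use nor was chosen before in the evaluation. \textbf{Unrolling and normalization.} $G\to^*G'$ is the reflexive transitive closure of: replace one subterm $\mu\gamma.G_0$ that is not itself under a $\mu$ by $G_0[\mu\gamma.G_0/\gamma]$ (up to the identification $\bullet\oplus\bullet=\bullet$). The \emph{New-$\beta$ normal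 form} is defined up to the choice of fresh generators (with respect to $S$, and pairwise distinct): $\bullet$, $\mu\gamma.G$ and $\Pi\mathsf u_f{:}U_f.\Pi\mathsf u_t{:}U_t.G$ are normal; $\oplus$ and $\vee$ are normalized componentwise; $G/_u$ becomes $H/_{u'}$ with $H$ a normal form of $G$ and $u\Downarrow u'$; ${\uparrow}u$ becomes ${\uparrow}u'$; $\nu\mathsf u{:}U.G$ becomes a normal form of $G[s/\mathsf u]$ for a fresh generator $s$; and $G[u_f;u_t]$ becomes a normal form of $G'[u_f/\mathsf u_f,u_t/\mathsf u_t]$ if $G$ has the normal form $\Pi\mathsf u_f{:}U_f.\Pi\mathsf u_t{:}U_t.G'$, and stays $G[u_f;u_t]$ if $G$ has a normal form of another shape. The \emph{expansion} $\mathcal G(H)$ of a normal form is a set of computation graphs: $\mathcal G(\bullet)$ consists of the graphs $\bullet$; $\mathcal G(G_1\oplus G_2)=\{g_1\oplus g_2: g_i\in\mathcal G(G_i)\}$; $\mathcal G(G_1\vee G_2)=\mathcal G(G_1)\cup\mathcal G(G_2)$; $\mathcal G(G/_u)=\{g/_u: g\in\mathcal G(G)\}$; $\mathcal G({\uparrow}u)$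 consists of the graphs ${\uparrow}u$; and $\mathcal G(H)=\emptyset$ for all other forms. All choices of fresh anonymous vertices are included. \textbf{Theorem.} Let $\Omega,\Psi$ be VS contexts and let $S$ be a finite set of generators that contains all generators in the domains of $\Omega$ and $\Psi$. Suppose $\cdot;\Omega;\Psi;\cdot\vdash e:\tau;G$ and that $e\Downarrow v;g$, with generators fresh with respect to $S$. Then (1) there is a finite context $\Psi_0$ of pairwise distinct generators, each chosen fresh (outside $S$) in this evaluation, such that $\cdot;\cdot;\Psi,\Psi_0;\cdot\vdash v:\tau;\bullet$; and (2) there is a graph type $G'$ with $G\to^*G'$ and a New-$\beta$ normal form $H$ of $G'$ (with generators fresh with respect to $S$) such that $g\in\mathcal G(H)$. -/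

import Mathlib

namespace GraphTypes

/-! Binding is represented by de Bruijn indices throughout. There are separate index spaces for
vertex structure (VS) variables, VS type variables, graph type variables, type constructor
variables and expression variables. Generators are named by natural numbers. -/

/-- Shift of a renaming under one binder. -/
def upr (ρ : ℕ → ℕ) : ℕ → ℕ
  | 0 => 0
  | n + 1 => ρ n + 1

/-! ## Vertex structure types and vertex structures -/

/-- Availability of a component of a product VS type. -/
inductive Avail where
  | av
  | unav

/-- VS types; `corec` binds one VS type variable. -/
inductive VSTy where
  | vty
  | prod (U₁ : VSTy) (a₁ : Avail) (U₂ : VSTy) (a₂ : Avail)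
  | tvar (n : ℕ)
  | corec (U : VSTy)

namespace VSTy

def rename (ρ : ℕ → ℕ) : VSTy → VSTy
  | vty => vty
  | prod U₁ a₁ U₂ a₂ => prod (U₁.rename ρ) a₁ (U₂.rename ρ) a₂
  | tvar n => tvar (ρ n)
  | corec U => corec (U.rename (upr ρ))

def up (σ : ℕ → VSTy) : ℕ → VSTy
  | 0 => tvar 0
  | n + 1 => (σ n).rename Nat.succ

def subst (σ : ℕ → VSTy) : VSTy → VSTy
  | vty => vty
  | prod U₁ a₁ U₂ a₂ => prod (U₁.subst σ) a₁ (U₂.subst σ) a₂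
  | tvar n => σ n
  | corec U => corec (U.subst (up σ))

/-- The unfolding `U[corec U / t]` of `corec t. U`. -/
def unfold (U : VSTy) : VSTy :=
  U.subst fun
    | 0 => corec U
    | n + 1 => tvar n

end VSTy

/-- Vertex structures, with generators as closed roots. -/
inductive VS where
  | var (n : ℕ)
  | gen (s : ℕ)
  | pair (u₁ u₂ : VS)
  | fst (u : VS)
  | snd (u : VS)

namespace VS

def subst (σ : ℕ → VS) : VS → VS
  | var n => σ n
  | gen s => gen s
  | pair u₁ u₂ => pair (u₁.subst σ) (u₂.subst σ)
  | fst u => fst (u.subst σ)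
  | snd u => snd (u.subst σ)

end VS

/-- Weakening of VS variables by one. -/
def vshift : ℕ → VS := fun n => VS.var (n + 1)

/-- Weakening of VS variables by two. -/
def vshift₂ : ℕ → VS := fun n => VS.var (n + 2)

/-- A substitution for VS variables, taken under one binder. -/
def upV (σ : ℕ → VS) : ℕ → VS
  | 0 => VS.var 0
  | n + 1 => (σ n).subst vshift

/-- Replace the innermost VS variable by `u`. -/
def instV (u : VS) : ℕ → VS
  | 0 => u
  | n + 1 => VS.var n

/-- Replace the two innermost VS variables. In a pair of binders `u_f`, `u_t` the variable `u_t`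
has index `0` and `u_f` has index `1`. -/
def instV₂ (uf ut : VS) : ℕ → VS
  | 0 => ut
  | 1 => uf
  | n + 2 => VS.var n

/-- Vertex paths: projections of generators. -/
inductive IsPath : VS → Prop
  | gen (s : ℕ) : IsPath (.gen s)
  | fst {p : VS} : IsPath p → IsPath (.fst p)
  | snd {p : VS} : IsPath p → IsPath (.snd p)

/-! ## Graph types, graph kinds -/

/-- Graph types. `mu` binds one graph type variable, `new` binds one VS variable and `pi` binds
two VS variables. `spawn G u` is the future `G /_u`, and `touch u` is a touch of `u`. -/
inductive GTy where
  | gvar (n : ℕ)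
  | emp
  | seq (G₁ G₂ : GTy)
  | or (G₁ G₂ : GTy)
  | mu (G : GTy)
  | spawn (G : GTy) (u : VS)
  | touch (u : VS)
  | pi (Uf Ut : VSTy) (G : GTy)
  | app (G : GTy) (uf ut : VS)
  | new (U : VSTy) (G : GTy)

/-- Graph kinds; kinds mention no VS variable, so the binders of `pi` leave no trace in the body. -/
inductive GKind where
  | graph
  | pi (Uf Ut : VSTy) (K : GKind)

namespace GTy

/-- Substitution of vertex structures for VS variables. -/
def vsubst (σ : ℕ → VS) : GTy → GTy
  | gvar n => gvar n
  | emp => emp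
  | seq G₁ G₂ => seq (G₁.vsubst σ) (G₂.vsubst σ)
  | or G₁ G₂ => or (G₁.vsubst σ) (G₂.vsubst σ)
  | mu G => mu (G.vsubst σ)
  | spawn G u => spawn (G.vsubst σ) (u.subst σ)
  | touch u => touch (u.subst σ)
  | pi Uf Ut G => pi Uf Ut (G.vsubst (upV (upV σ)))
  | app G uf ut => app (G.vsubst σ) (uf.subst σ) (ut.subst σ)
  | new U G => new U (G.vsubst (upV σ))

/-- Renaming of graph type variables. -/
def grename (ρ : ℕ → ℕ) : GTy → GTy
  | gvar n => gvar (ρ n)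
  | emp => emp
  | seq G₁ G₂ => seq (G₁.grename ρ) (G₂.grename ρ)
  | or G₁ G₂ => or (G₁.grename ρ) (G₂.grename ρ)
  | mu G => mu (G.grename (upr ρ))
  | spawn G u => spawn (G.grename ρ) u
  | touch u => touch u
  | pi Uf Ut G => pi Uf Ut (G.grename ρ)
  | app G uf ut => app (G.grename ρ) uf ut
  | new U G => new U (G.grename ρ)

def upG (ξ : ℕ → GTy) : ℕ → GTy
  | 0 => gvar 0
  | n + 1 => (ξ n).grename Nat.succ

/-- Capture-avoiding substitution of graph types for graph type variables. -/
def gsubst (ξ : ℕ → GTy) : GTy → GTy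
  | gvar n => ξ n
  | emp => emp
  | seq G₁ G₂ => seq (G₁.gsubst ξ) (G₂.gsubst ξ)
  | or G₁ G₂ => or (G₁.gsubst ξ) (G₂.gsubst ξ)
  | mu G => mu (G.gsubst (upG ξ))
  | spawn G u => spawn (G.gsubst ξ) u
  | touch u => touch u
  | pi Uf Ut G => pi Uf Ut (G.gsubst fun n => (ξ n).vsubst vshift₂)
  | app G uf ut => app (G.gsubst ξ) uf ut
  | new U G => new U (G.gsubst fun n => (ξ n).vsubst vshift)

/-- Replace the innermost graph type variable by `G`. -/
def instG (G : GTy) : ℕ → GTy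
  | 0 => G
  | n + 1 => gvar n

end GTy

/-- Graph types are identified along the congruence generated by `• ⊕ • = •`. -/
inductive GEq : GTy → GTy → Prop
  | unit : GEq (.seq .emp .emp) .emp
  | refl (G : GTy) : GEq G G
  | symm {G G' : GTy} : GEq G G' → GEq G' G
  | trans {G G' G'' : GTy} : GEq G G' → GEq G' G'' → GEq G G''
  | seq {G₁ G₁' G₂ G₂' : GTy} : GEq G₁ G₁' → GEq G₂ G₂' → GEq (.seq G₁ G₂) (.seq G₁' G₂')
  | or {G₁ G₁' G₂ G₂' : GTy} : GEq G₁ G₁' → GEq G₂ G₂' → GEq (.or G₁ G₂) (.or G₁' G₂')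
  | mu {G G' : GTy} : GEq G G' → GEq (.mu G) (.mu G')
  | spawn {G G' : GTy} (u : VS) : GEq G G' → GEq (.spawn G u) (.spawn G' u)
  | pi {G G' : GTy} (Uf Ut : VSTy) : GEq G G' → GEq (.pi Uf Ut G) (.pi Uf Ut G')
  | app {G G' : GTy} (uf ut : VS) : GEq G G' → GEq (.app G uf ut) (.app G' uf ut)
  | new {G G' : GTy} (U : VSTy) : GEq G G' → GEq (.new U G) (.new U G')

/-! ## Type constructors -/

inductive Kind where
  | ty
  | arr (U : VSTy)

/-- Type constructors. `fn Uf Ut c₁ c₂ G` is `Π u_f:U_f. Π u_t:U_t. c₁ →^G c₂` and binds two VS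
variables in `c₁`, `c₂` and `G`. `recty U c u` is the parameterized recursive type
`(rec α (x:U). c) u`; it binds a constructor variable and a VS variable in `c`.
`lam U c` is the type-level function `Λ x:U. c`. -/
inductive Con where
  | unit
  | fn (Uf Ut : VSTy) (c₁ c₂ : Con) (G : GTy)
  | prod (c₁ c₂ : Con)
  | sum (c₁ c₂ : Con)
  | fut (c : Con) (u : VS)
  | cvar (n : ℕ)
  | recty (U : VSTy) (c : Con) (u : VS)
  | lam (U : VSTy) (c : Con)
  | app (c : Con) (u : VS)

namespace Con

def vsubst (σ : ℕ → VS) : Con → Con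
  | unit => unit
  | fn Uf Ut c₁ c₂ G =>
      fn Uf Ut (c₁.vsubst (upV (upV σ))) (c₂.vsubst (upV (upV σ))) (G.vsubst (upV (upV σ)))
  | prod c₁ c₂ => prod (c₁.vsubst σ) (c₂.vsubst σ)
  | sum c₁ c₂ => sum (c₁.vsubst σ) (c₂.vsubst σ)
  | fut c u => fut (c.vsubst σ) (u.subst σ)
  | cvar n => cvar n
  | recty U c u => recty U (c.vsubst (upV σ)) (u.subst σ)
  | lam U c => lam U (c.vsubst (upV σ))
  | app c u => app (c.vsubst σ) (u.subst σ)

/-- Renaming of graph type variables. -/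
def grename (ρ : ℕ → ℕ) : Con → Con
  | unit => unit
  | fn Uf Ut c₁ c₂ G => fn Uf Ut (c₁.grename ρ) (c₂.grename ρ) (G.grename ρ)
  | prod c₁ c₂ => prod (c₁.grename ρ) (c₂.grename ρ)
  | sum c₁ c₂ => sum (c₁.grename ρ) (c₂.grename ρ)
  | fut c u => fut (c.grename ρ) u
  | cvar n => cvar n
  | recty U c u => recty U (c.grename ρ) u
  | lam U c => lam U (c.grename ρ)
  | app c u => app (c.grename ρ) u

/-- Renaming of type constructor variables. -/
def crename (ρ : ℕ → ℕ) : Con → Con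
  | unit => unit
  | fn Uf Ut c₁ c₂ G => fn Uf Ut (c₁.crename ρ) (c₂.crename ρ) G
  | prod c₁ c₂ => prod (c₁.crename ρ) (c₂.crename ρ)
  | sum c₁ c₂ => sum (c₁.crename ρ) (c₂.crename ρ)
  | fut c u => fut (c.crename ρ) u
  | cvar n => cvar (ρ n)
  | recty U c u => recty U (c.crename (upr ρ)) u
  | lam U c => lam U (c.crename ρ)
  | app c u => app (c.crename ρ) u

def upC (χ : ℕ → Con) : ℕ → Con
  | 0 => cvar 0
  | n + 1 => (χ n).crename Nat.succ

/-- Capture-avoiding substitution of type constructors for type constructor variables. -/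
def csubst (χ : ℕ → Con) : Con → Con
  | unit => unit
  | fn Uf Ut c₁ c₂ G =>
      fn Uf Ut (c₁.csubst fun n => (χ n).vsubst vshift₂)
        (c₂.csubst fun n => (χ n).vsubst vshift₂) G
  | prod c₁ c₂ => prod (c₁.csubst χ) (c₂.csubst χ)
  | sum c₁ c₂ => sum (c₁.csubst χ) (c₂.csubst χ)
  | fut c u => fut (c.csubst χ) u
  | cvar n => χ n
  | recty U c u => recty U (c.csubst (upC fun n => (χ n).vsubst vshift)) u
  | lam U c => lam U (c.csubst fun n => (χ n).vsubst vshift)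
  | app c u => app (c.csubst χ) u

def instC (c : Con) : ℕ → Con
  | 0 => c
  | n + 1 => cvar n

/-- The unrolling `c[u/x][Λ y:U. (rec α (x:U). c) y / α]` of `(rec α (x:U). c) u`. -/
def unroll (U : VSTy) (c : Con) (u : VS) : Con :=
  (c.vsubst (instV u)).csubst
    (instC (lam U (recty U (c.vsubst (upV vshift)) (.var 0))))

end Con

/-! ## Expressions -/

/-- Expressions. `fn e` is `fun u_f u_t f x => e`: it binds two VS variables (`u_t` of index `0`,
`u_f` of index `1`) and two expression variables (`x` of index `0`, `f` of index `1`).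
Each branch of `case` binds one expression variable, and `new U e` binds one VS variable.
`handle p e` is the runtime handle of a future. -/
inductive Exp where
  | var (n : ℕ)
  | triv
  | fn (e : Exp)
  | app (e₁ : Exp) (uf ut : VS) (e₂ : Exp)
  | pair (e₁ e₂ : Exp)
  | fst (e : Exp)
  | snd (e : Exp)
  | inl (e : Exp)
  | inr (e : Exp)
  | case (e e₁ e₂ : Exp)
  | roll (e : Exp)
  | unroll (e : Exp)
  | future (u : VS) (e : Exp)
  | force (e : Exp)
  | new (U : VSTy) (e : Exp)
  | handle (p : VS) (e : Exp)

namespace Exp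

def vsubst (σ : ℕ → VS) : Exp → Exp
  | var n => var n
  | triv => triv
  | fn e => fn (e.vsubst (upV (upV σ)))
  | app e₁ uf ut e₂ => app (e₁.vsubst σ) (uf.subst σ) (ut.subst σ) (e₂.vsubst σ)
  | pair e₁ e₂ => pair (e₁.vsubst σ) (e₂.vsubst σ)
  | fst e => fst (e.vsubst σ)
  | snd e => snd (e.vsubst σ)
  | inl e => inl (e.vsubst σ)
  | inr e => inr (e.vsubst σ)
  | case e e₁ e₂ => case (e.vsubst σ) (e₁.vsubst σ) (e₂.vsubst σ)
  | roll e => roll (e.vsubst σ)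
  | unroll e => unroll (e.vsubst σ)
  | future u e => future (u.subst σ) (e.vsubst σ)
  | force e => force (e.vsubst σ)
  | new U e => new U (e.vsubst (upV σ))
  | handle p e => handle (p.subst σ) (e.vsubst σ)

/-- Renaming of expression variables. -/
def erename (ρ : ℕ → ℕ) : Exp → Exp
  | var n => var (ρ n)
  | triv => triv
  | fn e => fn (e.erename (upr (upr ρ)))
  | app e₁ uf ut e₂ => app (e₁.erename ρ) uf ut (e₂.erename ρ)
  | pair e₁ e₂ => pair (e₁.erename ρ) (e₂.erename ρ)
  | fst e => fst (e.erename ρ)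
  | snd e => snd (e.erename ρ)
  | inl e => inl (e.erename ρ)
  | inr e => inr (e.erename ρ)
  | case e e₁ e₂ => case (e.erename ρ) (e₁.erename (upr ρ)) (e₂.erename (upr ρ))
  | roll e => roll (e.erename ρ)
  | unroll e => unroll (e.erename ρ)
  | future u e => future u (e.erename ρ)
  | force e => force (e.erename ρ)
  | new U e => new U (e.erename ρ)
  | handle p e => handle p (e.erename ρ)

def upE (ε : ℕ → Exp) : ℕ → Exp
  | 0 => var 0
  | n + 1 => (ε n).erename Nat.succ

/-- Capture-avoiding substitution of expressions for expression variables. -/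
def esubst (ε : ℕ → Exp) : Exp → Exp
  | var n => ε n
  | triv => triv
  | fn e => fn (e.esubst (upE (upE fun n => (ε n).vsubst vshift₂)))
  | app e₁ uf ut e₂ => app (e₁.esubst ε) uf ut (e₂.esubst ε)
  | pair e₁ e₂ => pair (e₁.esubst ε) (e₂.esubst ε)
  | fst e => fst (e.esubst ε)
  | snd e => snd (e.esubst ε)
  | inl e => inl (e.esubst ε)
  | inr e => inr (e.esubst ε)
  | case e e₁ e₂ => case (e.esubst ε) (e₁.esubst (upE ε)) (e₂.esubst (upE ε))
  | roll e => roll (e.esubst ε)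
  | unroll e => unroll (e.esubst ε)
  | future u e => future u (e.esubst ε)
  | force e => force (e.esubst ε)
  | new U e => new U (e.esubst fun n => (ε n).vsubst vshift)
  | handle p e => handle p (e.esubst ε)

def instE (e : Exp) : ℕ → Exp
  | 0 => e
  | n + 1 => var n

/-- Replace `f` (index `1`) by `F` and `x` (index `0`) by `v`. -/
def instE₂ (F v : Exp) : ℕ → Exp
  | 0 => v
  | 1 => F
  | n + 2 => var n

end Exp

/-- Values. -/
inductive Value : Exp → Prop
  | triv : Value .triv
  | fn (e : Exp) : Value (.fn e)
  | pair {v₁ v₂ : Exp} : Value v₁ → Value v₂ → Value (.pair v₁ v₂)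
  | inl {v : Exp} : Value v → Value (.inl v)
  | inr {v : Exp} : Value v → Value (.inr v)
  | roll {v : Exp} : Value v → Value (.roll v)
  | handle {p : VS} {v : Exp} : IsPath p → Value v → Value (.handle p v)

/-! ## VS contexts and their splitting -/

/-- The roots that VS contexts assign VS types to: VS variables and generators. -/
inductive VRoot where
  | var (n : ℕ)
  | gen (s : ℕ)

/-- A VS context (affine `Ω` or unrestricted `Ψ`): at most one VS type for each root. -/
abbrev VCtx := VRoot → Option VSTy

namespace VCtx

def empty : VCtx := fun _ => none

/-- Enter the scope of a VS binder; the new variable gets the type `o`, or is absent. -/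
def push (o : Option VSTy) (C : VCtx) : VCtx
  | .var 0 => o
  | .var (n + 1) => C (.var n)
  | .gen s => C (.gen s)

/-- Extend a context by a list of typed generators. -/
def addGens (C : VCtx) (L : List (ℕ × VSTy)) : VCtx
  | .var n => C (.var n)
  | .gen s => (L.lookup s).or (C (.gen s))

end VCtx

/-- VS subtyping `U <: U'`. -/
inductive VSub : VSTy → VSTy → Prop
  | prodLeft (U₁ U₂ U₃ : VSTy) (a₁ a₂ : Avail) :
      VSub (.prod U₁ a₁ U₂ a₂) (.prod U₃ .unav U₂ a₂)
  | prodRight (U₁ U₂ U₃ : VSTy) (a₁ a₂ : Avail) :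
      VSub (.prod U₁ a₁ U₂ a₂) (.prod U₁ a₁ U₃ .unav)
  | prod {U₁ U₂ U₁' U₂' : VSTy} (a₁ a₂ : Avail) : VSub U₁ U₁' → VSub U₂ U₂' →
      VSub (.prod U₁ a₁ U₂ a₂) (.prod U₁' a₁ U₂' a₂)
  | corec1 (U : VSTy) : VSub (.corec U) U.unfold
  | corec2 (U : VSTy) : VSub U.unfold (.corec U)
  | refl (U : VSTy) : VSub U U
  | trans {U U' U'' : VSTy} : VSub U U'' → VSub U'' U' → VSub U U'

/-- VS type splitting: `U` splits into `U₁` and `U₂`. -/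
inductive VSplit : VSTy → VSTy → VSTy → Prop
  | prod (U₁ U₂ : VSTy) :
      VSplit (.prod U₁ .av U₂ .av) (.prod U₁ .av U₂ .unav) (.prod U₁ .unav U₂ .av)
  | both {U₁ U₁' U₁'' U₂ U₂' U₂'' : VSTy} : VSplit U₁ U₁' U₁'' → VSplit U₂ U₂' U₂'' →
      VSplit (.prod U₁ .av U₂ .av) (.prod U₁' .av U₂' .av) (.prod U₁'' .av U₂'' .av)
  | left {U₁ U₁' U₁'' : VSTy} (U₂ : VSTy) (a : Avail) : VSplit U₁ U₁' U₁'' →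
      VSplit (.prod U₁ .av U₂ a) (.prod U₁' .av U₂ a) (.prod U₁'' .av U₂ .unav)
  | right {U₂ U₂' U₂'' : VSTy} (U₁ : VSTy) (a : Avail) : VSplit U₂ U₂' U₂'' →
      VSplit (.prod U₁ a U₂ .av) (.prod U₁ a U₂' .av) (.prod U₁ .unav U₂'' .av)
  | corec {U U₁ U₂ : VSTy} : VSplit U.unfold U₁ U₂ → VSplit (.corec U) U₁ U₂
  | sub {U U₁ U₁' U₂ : VSTy} : VSplit U U₁' U₂ → VSub U₁' U₁ → VSplit U U₁ U₂
  | comm {U U₁ U₂ : VSTy} : VSplit U U₂ U₁ → VSplit U U₁ U₂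

/-- Splitting of the entry of one root: it goes to one side, or its VS type is split. -/
inductive SplitEntry : Option VSTy → Option VSTy → Option VSTy → Prop
  | none : SplitEntry none none none
  | left (U : VSTy) : SplitEntry (some U) (some U) Option.none
  | right (U : VSTy) : SplitEntry (some U) Option.none (some U)
  | both {U U₁ U₂ : VSTy} : VSplit U U₁ U₂ → SplitEntry (some U) (some U₁) (some U₂)

/-- Splitting of affine contexts, entry by entry. -/
def CSplit (Ω Ω₁ Ω₂ : VCtx) : Prop := ∀ r, SplitEntry (Ω r) (Ω₁ r) (Ω₂ r)

/-! ## Typing, equivalence and normalization of vertex structures -/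

/-- `HasVS Ω Ψ u U`: under `Ω; Ψ` the VS `u` has VS type `U`. -/
inductive HasVS : VCtx → VCtx → VS → VSTy → Prop
  | omegaVar {Ω Ψ : VCtx} {n : ℕ} {U : VSTy} : Ω (.var n) = some U → HasVS Ω Ψ (.var n) U
  | psiVar {Ω Ψ : VCtx} {n : ℕ} {U : VSTy} : Ψ (.var n) = some U → HasVS Ω Ψ (.var n) U
  | omegaGen {Ω Ψ : VCtx} {s : ℕ} {U : VSTy} : Ω (.gen s) = some U → HasVS Ω Ψ (.gen s) U
  | psiGen {Ω Ψ : VCtx} {s : ℕ} {U : VSTy} : Ψ (.gen s) = some U → HasVS Ω Ψ (.gen s) U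
  | pair {Ω Ω₁ Ω₂ Ψ : VCtx} {u₁ u₂ : VS} {U₁ U₂ : VSTy} : CSplit Ω Ω₁ Ω₂ →
      HasVS Ω₁ Ψ u₁ U₁ → HasVS Ω₂ Ψ u₂ U₂ → HasVS Ω Ψ (.pair u₁ u₂) (.prod U₁ .av U₂ .av)
  | onlyLeft {Ω Ψ Ψ' : VCtx} {u₁ u₂ : VS} {U₁ U₂ : VSTy} :
      HasVS Ω Ψ u₁ U₁ → HasVS .empty Ψ' u₂ U₂ → HasVS Ω Ψ (.pair u₁ u₂) (.prod U₁ .av U₂ .unav)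
  | onlyRight {Ω Ψ Ψ' : VCtx} {u₁ u₂ : VS} {U₁ U₂ : VSTy} :
      HasVS .empty Ψ' u₁ U₁ → HasVS Ω Ψ u₂ U₂ → HasVS Ω Ψ (.pair u₁ u₂) (.prod U₁ .unav U₂ .av)
  | fst {Ω Ψ : VCtx} {u : VS} {U₁ U₂ : VSTy} {a : Avail} :
      HasVS Ω Ψ u (.prod U₁ .av U₂ a) → HasVS Ω Ψ (.fst u) U₁
  | snd {Ω Ψ : VCtx} {u : VS} {U₁ U₂ : VSTy} {a : Avail} :
      HasVS Ω Ψ u (.prod U₁ a U₂ .av) → HasVS Ω Ψ (.snd u) U₂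
  | sub {Ω Ψ : VCtx} {u : VS} {U U' : VSTy} :
      HasVS Ω Ψ u U' → VSub U' U → HasVS Ω Ψ u U

/-- Typed VS equivalence `Ψ ⊢ u = u' : U`. -/
inductive VSEq : VCtx → VS → VS → VSTy → Prop
  | refl {Ψ : VCtx} {u : VS} {U : VSTy} : HasVS .empty Ψ u U → VSEq Ψ u u U
  | comm {Ψ : VCtx} {u u' : VS} {U : VSTy} : VSEq Ψ u' u U → VSEq Ψ u u' U
  | trans {Ψ : VCtx} {u u' u'' : VS} {U : VSTy} :
      VSEq Ψ u u'' U → VSEq Ψ u'' u' U → VSEq Ψ u u' U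
  | onlyLeft {Ψ Ψ' : VCtx} {u₁ u₁' u₂ u₂' : VS} {U₁ U₂ : VSTy} :
      VSEq Ψ u₁ u₁' U₁ → VSEq Ψ' u₂ u₂' U₂ →
      VSEq Ψ (.pair u₁ u₂) (.pair u₁' u₂') (.prod U₁ .av U₂ .unav)
  | onlyRight {Ψ Ψ' : VCtx} {u₁ u₁' u₂ u₂' : VS} {U₁ U₂ : VSTy} :
      VSEq Ψ' u₁ u₁' U₁ → VSEq Ψ u₂ u₂' U₂ →
      VSEq Ψ (.pair u₁ u₂) (.pair u₁' u₂') (.prod U₁ .unav U₂ .av)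
  | pair {Ψ : VCtx} {u₁ u₁' u₂ u₂' : VS} {U₁ U₂ : VSTy} :
      VSEq Ψ u₁ u₁' U₁ → VSEq Ψ u₂ u₂' U₂ →
      VSEq Ψ (.pair u₁ u₂) (.pair u₁' u₂') (.prod U₁ .av U₂ .av)
  | fst {Ψ : VCtx} {u u' : VS} {U₁ U₂ : VSTy} {a : Avail} :
      VSEq Ψ u u' (.prod U₁ .av U₂ a) → VSEq Ψ (.fst u) (.fst u') U₁
  | snd {Ψ : VCtx} {u u' : VS} {U₁ U₂ : VSTy} {a : Avail} :
      VSEq Ψ u u' (.prod U₁ a U₂ .av) → VSEq Ψ (.snd u) (.snd u') U₂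
  | fstPair {Ψ : VCtx} {u u₁ u₂ : VS} {U₁ U₂ : VSTy} {a : Avail} :
      VSEq Ψ u (.pair u₁ u₂) (.prod U₁ .av U₂ a) → VSEq Ψ (.fst u) u₁ U₁
  | sndPair {Ψ : VCtx} {u u₁ u₂ : VS} {U₁ U₂ : VSTy} {a : Avail} :
      VSEq Ψ u (.pair u₁ u₂) (.prod U₁ a U₂ .av) → VSEq Ψ (.snd u) u₂ U₂
  | sub {Ψ : VCtx} {u u' : VS} {U U' : VSTy} :
      VSEq Ψ u u' U' → VSub U' U → VSEq Ψ u u' U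

/-- VS normalization `u ⇓ u'`. -/
inductive VSEval : VS → VS → Prop
  | var (n : ℕ) : VSEval (.var n) (.var n)
  | gen (s : ℕ) : VSEval (.gen s) (.gen s)
  | pair {u₁ u₁' u₂ u₂' : VS} : VSEval u₁ u₁' → VSEval u₂ u₂' →
      VSEval (.pair u₁ u₂) (.pair u₁' u₂')
  | fstPair {u u₁ u₂ : VS} : VSEval u (.pair u₁ u₂) → VSEval (.fst u) u₁
  | fstNotPair {u u' : VS} : VSEval u u' → (∀ u₁ u₂, u' ≠ .pair u₁ u₂) →
      VSEval (.fst u) (.fst u')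
  | sndPair {u u₁ u₂ : VS} : VSEval u (.pair u₁ u₂) → VSEval (.snd u) u₂
  | sndNotPair {u u' : VS} : VSEval u u' → (∀ u₁ u₂, u' ≠ .pair u₁ u₂) →
      VSEval (.snd u) (.snd u')

/-! ## Graph type formation -/

/-- `DagWF Δ Ω Ψ G K`: under `Δ; Ω; Ψ` the graph type `G` has graph kind `K`. -/
inductive DagWF : List GKind → VCtx → VCtx → GTy → GKind → Prop
  | emp {Δ : List GKind} {Ω Ψ : VCtx} : DagWF Δ Ω Ψ .emp .graph
  | gvar {Δ : List GKind} {Ω Ψ : VCtx} {n : ℕ} {K : GKind} :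
      Δ[n]? = some K → DagWF Δ Ω Ψ (.gvar n) K
  | seq {Δ : List GKind} {Ω Ω₁ Ω₂ Ψ : VCtx} {G₁ G₂ : GTy} : CSplit Ω Ω₁ Ω₂ →
      DagWF Δ Ω₁ Ψ G₁ .graph → DagWF Δ Ω₂ Ψ G₂ .graph → DagWF Δ Ω Ψ (.seq G₁ G₂) .graph
  | or {Δ : List GKind} {Ω Ψ : VCtx} {G₁ G₂ : GTy} :
      DagWF Δ Ω Ψ G₁ .graph → DagWF Δ Ω Ψ G₂ .graph → DagWF Δ Ω Ψ (.or G₁ G₂) .graph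
  | spawn {Δ : List GKind} {Ω Ω₁ Ω₂ Ψ : VCtx} {G : GTy} {u : VS} : CSplit Ω Ω₁ Ω₂ →
      DagWF Δ Ω₁ Ψ G .graph → HasVS Ω₂ .empty u .vty → DagWF Δ Ω Ψ (.spawn G u) .graph
  | touch {Δ : List GKind} {Ω Ψ : VCtx} {u : VS} :
      HasVS .empty Ψ u .vty → DagWF Δ Ω Ψ (.touch u) .graph
  | new {Δ : List GKind} {Ω Ψ : VCtx} {U : VSTy} {G : GTy} :
      DagWF Δ (Ω.push (some U)) (Ψ.push (some U)) G .graph → DagWF Δ Ω Ψ (.new U G) .graph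
  | pi {Δ : List GKind} {Ω Ψ : VCtx} {Uf Ut : VSTy} {G : GTy} :
      DagWF Δ ((Ω.push (some Uf)).push none) ((Ψ.push (some Uf)).push (some Ut)) G .graph →
      DagWF Δ Ω Ψ (.pi Uf Ut G) (.pi Uf Ut .graph)
  | recPi {Δ : List GKind} {Ω Ψ : VCtx} {Uf Ut : VSTy} {G : GTy} :
      DagWF (.pi Uf Ut .graph :: Δ) ((VCtx.empty.push (some Uf)).push none)
        ((Ψ.push (some Uf)).push (some Ut)) G .graph →
      DagWF Δ Ω Ψ (.mu (.pi Uf Ut G)) (.pi Uf Ut .graph)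
  | app {Δ : List GKind} {Ω Ω₁ Ω₂ Ψ : VCtx} {Uf Ut : VSTy} {G : GTy} {uf ut : VS} :
      CSplit Ω Ω₁ Ω₂ → DagWF Δ Ω₁ Ψ G (.pi Uf Ut .graph) →
      HasVS Ω₂ .empty uf Uf → HasVS .empty Ψ uf Uf → HasVS .empty Ψ ut Ut →
      DagWF Δ Ω Ψ (.app G uf ut) .graph

/-! ## Kinding and equivalence of type constructors -/

/-- The arrow annotation `G[u_f; u_t]`, in the scope of the binders of `u_f` and `u_t`, for a
graph type `G` given outside that scope. -/
def arrowAnn (G : GTy) : GTy := .app (G.vsubst vshift₂) (.var 1) (.var 0)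

/-- `HasKind Δ Ψ Σ c k`: under `Δ; Ψ; Σ` the type constructor `c` has kind `k`. -/
inductive HasKind : List GKind → VCtx → List Kind → Con → Kind → Prop
  | unit {Δ : List GKind} {Ψ : VCtx} {Θ : List Kind} : HasKind Δ Ψ Θ .unit .ty
  | cvar {Δ : List GKind} {Ψ : VCtx} {Θ : List Kind} {n : ℕ} {k : Kind} :
      Θ[n]? = some k → HasKind Δ Ψ Θ (.cvar n) k
  | fn {Δ : List GKind} {Ψ : VCtx} {Θ : List Kind} {Uf Ut : VSTy} {c₁ c₂ : Con} {G : GTy} :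
      HasKind Δ ((Ψ.push (some Uf)).push (some Ut)) Θ c₁ .ty →
      HasKind Δ ((Ψ.push (some Uf)).push (some Ut)) Θ c₂ .ty →
      DagWF Δ .empty Ψ G (.pi Uf Ut .graph) →
      HasKind Δ Ψ Θ (.fn Uf Ut c₁ c₂ (arrowAnn G)) .ty
  | sum {Δ : List GKind} {Ψ : VCtx} {Θ : List Kind} {c₁ c₂ : Con} :
      HasKind Δ Ψ Θ c₁ .ty → HasKind Δ Ψ Θ c₂ .ty → HasKind Δ Ψ Θ (.sum c₁ c₂) .ty
  | prod {Δ : List GKind} {Ψ : VCtx} {Θ : List Kind} {c₁ c₂ : Con} :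
      HasKind Δ Ψ Θ c₁ .ty → HasKind Δ Ψ Θ c₂ .ty → HasKind Δ Ψ Θ (.prod c₁ c₂) .ty
  | fut {Δ : List GKind} {Ψ : VCtx} {Θ : List Kind} {c : Con} {u : VS} :
      HasKind Δ Ψ Θ c .ty → HasVS .empty Ψ u .vty → HasKind Δ Ψ Θ (.fut c u) .ty
  | recty {Δ : List GKind} {Ψ : VCtx} {Θ : List Kind} {U : VSTy} {c : Con} {u : VS} :
      HasKind Δ (Ψ.push (some U)) (.arr U :: Θ) c .ty → HasVS .empty Ψ u U →
      HasKind Δ Ψ Θ (.recty U c u) .ty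
  | lam {Δ : List GKind} {Ψ : VCtx} {Θ : List Kind} {U : VSTy} {c : Con} :
      HasKind Δ (Ψ.push (some U)) Θ c .ty → HasKind Δ Ψ Θ (.lam U c) (.arr U)
  | app {Δ : List GKind} {Ψ : VCtx} {Θ : List Kind} {U : VSTy} {c : Con} {u : VS} :
      HasKind Δ Ψ Θ c (.arr U) → HasVS .empty Ψ u U → HasKind Δ Ψ Θ (.app c u) .ty

/-- Type constructor equivalence. It is a congruence (the rule `fn` is the congruence rule for
function types) that contains beta reduction of type-level functions and VS equivalence. -/
inductive ConEq : List GKind → VCtx → List Kind → Con → Con → Kind → Prop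
  | refl {Δ : List GKind} {Ψ : VCtx} {Θ : List Kind} {c : Con} {k : Kind} :
      HasKind Δ Ψ Θ c k → ConEq Δ Ψ Θ c c k
  | comm {Δ : List GKind} {Ψ : VCtx} {Θ : List Kind} {c c' : Con} {k : Kind} :
      ConEq Δ Ψ Θ c' c k → ConEq Δ Ψ Θ c c' k
  | trans {Δ : List GKind} {Ψ : VCtx} {Θ : List Kind} {c c' c'' : Con} {k : Kind} :
      ConEq Δ Ψ Θ c c'' k → ConEq Δ Ψ Θ c'' c' k → ConEq Δ Ψ Θ c c' k
  | prod {Δ : List GKind} {Ψ : VCtx} {Θ : List Kind} {c₁ c₁' c₂ c₂' : Con} :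
      ConEq Δ Ψ Θ c₁ c₁' .ty → ConEq Δ Ψ Θ c₂ c₂' .ty →
      ConEq Δ Ψ Θ (.prod c₁ c₂) (.prod c₁' c₂') .ty
  | sum {Δ : List GKind} {Ψ : VCtx} {Θ : List Kind} {c₁ c₁' c₂ c₂' : Con} :
      ConEq Δ Ψ Θ c₁ c₁' .ty → ConEq Δ Ψ Θ c₂ c₂' .ty →
      ConEq Δ Ψ Θ (.sum c₁ c₂) (.sum c₁' c₂') .ty
  | fut {Δ : List GKind} {Ψ : VCtx} {Θ : List Kind} {c c' : Con} {u u' : VS} :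
      ConEq Δ Ψ Θ c c' .ty → VSEq Ψ u u' .vty → ConEq Δ Ψ Θ (.fut c u) (.fut c' u') .ty
  | lam {Δ : List GKind} {Ψ : VCtx} {Θ : List Kind} {U : VSTy} {c c' : Con} :
      ConEq Δ (Ψ.push (some U)) Θ c c' .ty → ConEq Δ Ψ Θ (.lam U c) (.lam U c') (.arr U)
  | app {Δ : List GKind} {Ψ : VCtx} {Θ : List Kind} {U : VSTy} {c c' : Con} {u u' : VS} :
      ConEq Δ Ψ Θ c c' (.arr U) → VSEq Ψ u u' U → ConEq Δ Ψ Θ (.app c u) (.app c' u') .ty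
  | beta {Δ : List GKind} {Ψ : VCtx} {Θ : List Kind} {U : VSTy} {c : Con} {u : VS} :
      HasKind Δ (Ψ.push (some U)) Θ c .ty → HasVS .empty Ψ u U →
      ConEq Δ Ψ Θ (.app (.lam U c) u) (c.vsubst (instV u)) .ty
  | recty {Δ : List GKind} {Ψ : VCtx} {Θ : List Kind} {U : VSTy} {c c' : Con} {u u' : VS} :
      ConEq Δ (Ψ.push (some U)) (.arr U :: Θ) c c' .ty → VSEq Ψ u u' U →
      ConEq Δ Ψ Θ (.recty U c u) (.recty U c' u') .ty
  | fn {Δ : List GKind} {Ψ : VCtx} {Θ : List Kind} {Uf Ut : VSTy} {c₁ c₁' c₂ c₂' : Con}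
      {G G' : GTy} :
      ConEq Δ ((Ψ.push (some Uf)).push (some Ut)) Θ c₁ c₁' .ty →
      ConEq Δ ((Ψ.push (some Uf)).push (some Ut)) Θ c₂ c₂' .ty →
      DagWF Δ .empty Ψ G (.pi Uf Ut .graph) → GEq G G' →
      ConEq Δ Ψ Θ (.fn Uf Ut c₁ c₂ (arrowAnn G)) (.fn Uf Ut c₁' c₂' (arrowAnn G')) .ty

/-! ## The graph type system -/

/-- `HasTy Δ Ω Ψ Γ e τ G`: under `Δ; Ω; Ψ; Γ` the expression `e` has type `τ` and graph type `G`. -/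
inductive HasTy : List GKind → VCtx → VCtx → List Con → Exp → Con → GTy → Prop
  | var {Δ : List GKind} {Ω Ψ : VCtx} {Γ : List Con} {n : ℕ} {τ : Con} :
      Γ[n]? = some τ → HasTy Δ Ω Ψ Γ (.var n) τ .emp
  | triv {Δ : List GKind} {Ω Ψ : VCtx} {Γ : List Con} : HasTy Δ Ω Ψ Γ .triv .unit .emp
  | fn {Δ : List GKind} {Ω Ψ : VCtx} {Γ : List Con} {Uf Ut : VSTy} {e : Exp} {τ₁ τ₂ : Con}
      {G : GTy} :
      HasTy (.pi Uf Ut .graph :: Δ) ((VCtx.empty.push (some Uf)).push none)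
        ((Ψ.push (some Uf)).push (some Ut))
        (τ₁.grename Nat.succ ::
          (Con.fn Uf Ut (τ₁.grename Nat.succ) (τ₂.grename Nat.succ)
            (arrowAnn (.gvar 0))).vsubst vshift₂ ::
          Γ.map fun c => (c.grename Nat.succ).vsubst vshift₂)
        e (τ₂.grename Nat.succ) G →
      HasKind Δ ((Ψ.push (some Uf)).push (some Ut)) [] τ₁ .ty →
      HasKind Δ ((Ψ.push (some Uf)).push (some Ut)) [] τ₂ .ty →
      HasTy Δ Ω Ψ Γ (.fn e) (.fn Uf Ut τ₁ τ₂ (arrowAnn (.mu (.pi Uf Ut G)))) .emp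
  | app {Δ : List GKind} {Ω Ω₁ Ω' Ω₂ Ω₃ Ψ : VCtx} {Γ : List Con} {Uf Ut : VSTy} {e₁ e₂ : Exp}
      {uf ut : VS} {τ₁ τ₂ : Con} {G₁ G₂ G₃ : GTy} :
      CSplit Ω Ω₁ Ω' → CSplit Ω' Ω₂ Ω₃ →
      HasTy Δ Ω₁ Ψ Γ e₁ (.fn Uf Ut τ₁ τ₂ (arrowAnn G₃)) G₁ →
      HasTy Δ Ω₂ Ψ Γ e₂ (τ₁.vsubst (instV₂ uf ut)) G₂ →
      HasVS Ω₃ .empty uf Uf → HasVS .empty Ψ uf Uf → HasVS .empty Ψ ut Ut →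
      HasTy Δ Ω Ψ Γ (.app e₁ uf ut e₂) (τ₂.vsubst (instV₂ uf ut))
        (.seq (.seq G₁ G₂) (.app G₃ uf ut))
  | pair {Δ : List GKind} {Ω Ω₁ Ω₂ Ψ : VCtx} {Γ : List Con} {e₁ e₂ : Exp} {τ₁ τ₂ : Con}
      {G₁ G₂ : GTy} : CSplit Ω Ω₁ Ω₂ →
      HasTy Δ Ω₁ Ψ Γ e₁ τ₁ G₁ → HasTy Δ Ω₂ Ψ Γ e₂ τ₂ G₂ →
      HasTy Δ Ω Ψ Γ (.pair e₁ e₂) (.prod τ₁ τ₂) (.seq G₁ G₂)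
  | fst {Δ : List GKind} {Ω Ψ : VCtx} {Γ : List Con} {e : Exp} {τ₁ τ₂ : Con} {G : GTy} :
      HasTy Δ Ω Ψ Γ e (.prod τ₁ τ₂) G → HasTy Δ Ω Ψ Γ (.fst e) τ₁ G
  | snd {Δ : List GKind} {Ω Ψ : VCtx} {Γ : List Con} {e : Exp} {τ₁ τ₂ : Con} {G : GTy} :
      HasTy Δ Ω Ψ Γ e (.prod τ₁ τ₂) G → HasTy Δ Ω Ψ Γ (.snd e) τ₂ G
  | inl {Δ : List GKind} {Ω Ψ : VCtx} {Γ : List Con} {e : Exp} {τ₁ τ₂ : Con} {G : GTy} :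
      HasTy Δ Ω Ψ Γ e τ₁ G → HasKind Δ Ψ [] τ₂ .ty → HasTy Δ Ω Ψ Γ (.inl e) (.sum τ₁ τ₂) G
  | inr {Δ : List GKind} {Ω Ψ : VCtx} {Γ : List Con} {e : Exp} {τ₁ τ₂ : Con} {G : GTy} :
      HasTy Δ Ω Ψ Γ e τ₂ G → HasKind Δ Ψ [] τ₁ .ty → HasTy Δ Ω Ψ Γ (.inr e) (.sum τ₁ τ₂) G
  | case {Δ : List GKind} {Ω Ω₁ Ω₂ Ψ : VCtx} {Γ : List Con} {e e₁ e₂ : Exp} {τ₁ τ₂ τ : Con}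
      {G₁ G₂ G₃ : GTy} : CSplit Ω Ω₁ Ω₂ →
      HasTy Δ Ω₁ Ψ Γ e (.sum τ₁ τ₂) G₁ → HasTy Δ Ω₂ Ψ (τ₁ :: Γ) e₁ τ G₂ →
      HasTy Δ Ω₂ Ψ (τ₂ :: Γ) e₂ τ G₃ →
      HasTy Δ Ω Ψ Γ (.case e e₁ e₂) τ (.seq G₁ (.or G₂ G₃))
  | roll {Δ : List GKind} {Ω Ψ : VCtx} {Γ : List Con} {e : Exp} {U : VSTy} {τ : Con} {u : VS}
      {G : GTy} :
      HasTy Δ Ω Ψ Γ e (Con.unroll U τ u) G → HasKind Δ Ψ [] (.recty U τ u) .ty →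
      HasTy Δ Ω Ψ Γ (.roll e) (.recty U τ u) G
  | unroll {Δ : List GKind} {Ω Ψ : VCtx} {Γ : List Con} {e : Exp} {U : VSTy} {τ : Con} {u : VS}
      {G : GTy} :
      HasTy Δ Ω Ψ Γ e (.recty U τ u) G → HasTy Δ Ω Ψ Γ (.unroll e) (Con.unroll U τ u) G
  | future {Δ : List GKind} {Ω Ω₁ Ω₂ Ψ : VCtx} {Γ : List Con} {e : Exp} {τ : Con} {u : VS}
      {G : GTy} : CSplit Ω Ω₁ Ω₂ →
      HasTy Δ Ω₁ Ψ Γ e τ G → HasVS Ω₂ .empty u .vty → HasVS .empty Ψ u .vty →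
      HasTy Δ Ω Ψ Γ (.future u e) (.fut τ u) (.spawn G u)
  | force {Δ : List GKind} {Ω Ψ : VCtx} {Γ : List Con} {e : Exp} {τ : Con} {u : VS} {G : GTy} :
      HasTy Δ Ω Ψ Γ e (.fut τ u) G → HasTy Δ Ω Ψ Γ (.force e) τ (.seq G (.touch u))
  | new {Δ : List GKind} {Ω Ψ : VCtx} {Γ : List Con} {U : VSTy} {e : Exp} {τ : Con} {G : GTy} :
      HasTy Δ (Ω.push (some U)) (Ψ.push (some U)) (Γ.map fun c => c.vsubst vshift) e
        (τ.vsubst vshift) G →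
      HasKind Δ Ψ [] τ .ty → HasTy Δ Ω Ψ Γ (.new U e) τ (.new U G)
  | typeEq {Δ : List GKind} {Ω Ψ : VCtx} {Γ : List Con} {e : Exp} {τ₁ τ₂ : Con} {G : GTy} :
      ConEq Δ Ψ [] τ₁ τ₂ .ty → HasTy Δ Ω Ψ Γ e τ₁ G → HasTy Δ Ω Ψ Γ e τ₂ G
  | handle {Δ : List GKind} {Ω Ψ : VCtx} {Γ : List Con} {p : VS} {v : Exp} {τ : Con} :
      IsPath p → Value v →
      HasTy Δ .empty Ψ Γ v τ .emp → HasVS .empty Ψ p .vty →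
      HasTy Δ Ω Ψ Γ (.handle p v) (.fut τ p) .emp
  | graphEq {Δ : List GKind} {Ω Ψ : VCtx} {Γ : List Con} {e : Exp} {τ : Con} {G G' : GTy} :
      GEq G G' → HasTy Δ Ω Ψ Γ e τ G → HasTy Δ Ω Ψ Γ e τ G'

/-! ## Computation graphs -/

/-- Vertices are named by vertex structures (the sinks of futures) or are anonymous. -/
inductive Vertex where
  | named (u : VS)
  | anon (n : ℕ)

/-- Computation graphs: vertices, edges, start vertex and end vertex. -/
structure CGraph where
  verts : Set Vertex
  edges : Set (Vertex × Vertex)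
  start : Vertex
  sink : Vertex

namespace CGraph

/-- `g` is the graph `•` with some choice of its fresh vertex. -/
def IsEmp (g : CGraph) : Prop :=
  ∃ n, g = ⟨{.anon n}, ∅, .anon n, .anon n⟩

/-- `g` is the sequential composition `g₁ ⊕ g₂`, defined for disjoint vertex sets. -/
def IsSeq (g₁ g₂ g : CGraph) : Prop :=
  Disjoint g₁.verts g₂.verts ∧
    g = ⟨g₁.verts ∪ g₂.verts, g₁.edges ∪ g₂.edges ∪ {(g₁.sink, g₂.start)}, g₁.start, g₂.sink⟩

/-- `g'` is the left composition `g /_u`, with some choice of its fresh vertex. -/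
def IsSpawn (g : CGraph) (u : VS) (g' : CGraph) : Prop :=
  ∃ n, Vertex.anon n ∉ g.verts ∧ Vertex.named u ∉ g.verts ∧
    g' = ⟨g.verts ∪ {.named u, .anon n},
      g.edges ∪ {(.anon n, g.start), (g.sink, .named u)}, .anon n, .anon n⟩

/-- `g` is a touch of `u`, with some choice of its fresh vertex. -/
def IsTouch (u : VS) (g : CGraph) : Prop :=
  ∃ n, g = ⟨{.anon n}, {(.named u, .anon n)}, .anon n, .anon n⟩

end CGraph

/-! ## Normalization of graph types -/

/-- One step of graph type unrolling. -/
inductive Unr : GTy → GTy → Prop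
  | seq1 {G₁ G₁' : GTy} (G₂ : GTy) : Unr G₁ G₁' → Unr (.seq G₁ G₂) (.seq G₁' G₂)
  | seq2 {G₂ G₂' : GTy} (G₁ : GTy) : Unr G₂ G₂' → Unr (.seq G₁ G₂) (.seq G₁ G₂')
  | or1 {G₁ G₁' : GTy} (G₂ : GTy) : Unr G₁ G₁' → Unr (.or G₁ G₂) (.or G₁' G₂)
  | or2 {G₂ G₂' : GTy} (G₁ : GTy) : Unr G₂ G₂' → Unr (.or G₁ G₂) (.or G₁ G₂')
  | future {G G' : GTy} (u : VS) : Unr G G' → Unr (.spawn G u) (.spawn G' u)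
  | mu (G : GTy) : Unr (.mu G) (G.gsubst (GTy.instG (.mu G)))
  | pi {G G' : GTy} (Uf Ut : VSTy) : Unr G G' → Unr (.pi Uf Ut G) (.pi Uf Ut G')
  | app {G G' : GTy} (uf ut : VS) : Unr G G' → Unr (.app G uf ut) (.app G' uf ut)
  | new {G G' : GTy} (U : VSTy) : Unr G G' → Unr (.new U G) (.new U G')

/-- Unrolling in any number of steps, of graph types up to the identification `GEq`. -/
def UnrStar : GTy → GTy → Prop :=
  Relation.ReflTransGen fun G G' => Unr G G' ∨ GEq G G'

/-- `NBNF S G H S'`: when the generators in `S` are in use, `H` is a New-beta normal form of `G`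
for some choice of the fresh generators, and `S'` consists of `S` and the generators chosen. -/
inductive NBNF : Finset ℕ → GTy → GTy → Finset ℕ → Prop
  | emp (S : Finset ℕ) : NBNF S .emp .emp S
  | seq {S S₁ S₂ : Finset ℕ} {G₁ G₂ H₁ H₂ : GTy} :
      NBNF S G₁ H₁ S₁ → NBNF S₁ G₂ H₂ S₂ → NBNF S (.seq G₁ G₂) (.seq H₁ H₂) S₂
  | or {S S₁ S₂ : Finset ℕ} {G₁ G₂ H₁ H₂ : GTy} :
      NBNF S G₁ H₁ S₁ → NBNF S₁ G₂ H₂ S₂ → NBNF S (.or G₁ G₂) (.or H₁ H₂) S₂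
  | mu (S : Finset ℕ) (G : GTy) : NBNF S (.mu G) (.mu G) S
  | spawn {S S' : Finset ℕ} {G H : GTy} {u u' : VS} :
      NBNF S G H S' → VSEval u u' → NBNF S (.spawn G u) (.spawn H u') S'
  | touch (S : Finset ℕ) {u u' : VS} : VSEval u u' → NBNF S (.touch u) (.touch u') S
  | new {S S' : Finset ℕ} {s : ℕ} {G H : GTy} (U : VSTy) : s ∉ S →
      NBNF (insert s S) (G.vsubst (instV (.gen s))) H S' → NBNF S (.new U G) H S'
  | pi (S : Finset ℕ) (Uf Ut : VSTy) (G : GTy) : NBNF S (.pi Uf Ut G) (.pi Uf Ut G) S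
  | appPi {S S₁ S₂ : Finset ℕ} {G G' H : GTy} {Uf Ut : VSTy} {uf ut : VS} :
      NBNF S G (.pi Uf Ut G') S₁ → NBNF S₁ (G'.vsubst (instV₂ uf ut)) H S₂ →
      NBNF S (.app G uf ut) H S₂
  | appOther {S S₁ : Finset ℕ} {G H : GTy} {uf ut : VS} :
      NBNF S G H S₁ → (∀ Uf Ut G', H ≠ .pi Uf Ut G') → NBNF S (.app G uf ut) (.app G uf ut) S₁

/-- Expansion of a graph type in New-beta normal form into the set of its graphs, for all choices
of fresh vertices. Forms to which expansion does not apply have no graphs. -/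
def GTy.expand : GTy → Set CGraph
  | .emp => {g | g.IsEmp}
  | .seq G₁ G₂ => {g | ∃ g₁ ∈ G₁.expand, ∃ g₂ ∈ G₂.expand, CGraph.IsSeq g₁ g₂ g}
  | .or G₁ G₂ => G₁.expand ∪ G₂.expand
  | .mu _ => ∅
  | .app _ _ _ => ∅
  | .spawn G u => {g | ∃ g' ∈ G.expand, CGraph.IsSpawn g' u g}
  | .touch u => {g | CGraph.IsTouch u g}
  | .gvar _ => ∅
  | .pi _ _ _ => ∅
  | .new _ _ => ∅

/-! ## Cost semantics -/

/-- `Eval S e v g S'`: when the generators in `S` are in use, `e` evaluates to `v` with computation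
graph `g`, and `S'` consists of `S` and the generators created by the evaluation. -/
inductive Eval : Finset ℕ → Exp → Exp → CGraph → Finset ℕ → Prop
  | value {S : Finset ℕ} {v : Exp} {g : CGraph} : Value v → g.IsEmp → Eval S v v g S
  | app {S S₁ S₂ S₃ : Finset ℕ} {e₁ e₂ e v' v : Exp} {uf ut : VS} {g₁ g₂ g₃ g₁₂ g : CGraph} :
      Eval S e₁ (.fn e) g₁ S₁ → Eval S₁ e₂ v' g₂ S₂ →
      Eval S₂ ((e.vsubst (instV₂ uf ut)).esubst (Exp.instE₂ (.fn e) v')) v g₃ S₃ →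
      CGraph.IsSeq g₁ g₂ g₁₂ → CGraph.IsSeq g₁₂ g₃ g →
      Eval S (.app e₁ uf ut e₂) v g S₃
  | pair {S S₁ S₂ : Finset ℕ} {e₁ e₂ v₁ v₂ : Exp} {g₁ g₂ g : CGraph} :
      Eval S e₁ v₁ g₁ S₁ → Eval S₁ e₂ v₂ g₂ S₂ → CGraph.IsSeq g₁ g₂ g →
      Eval S (.pair e₁ e₂) (.pair v₁ v₂) g S₂
  | fst {S S' : Finset ℕ} {e v₁ v₂ : Exp} {g : CGraph} :
      Eval S e (.pair v₁ v₂) g S' → Eval S (.fst e) v₁ g S'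
  | snd {S S' : Finset ℕ} {e v₁ v₂ : Exp} {g : CGraph} :
      Eval S e (.pair v₁ v₂) g S' → Eval S (.snd e) v₂ g S'
  | inl {S S' : Finset ℕ} {e v : Exp} {g : CGraph} :
      Eval S e v g S' → Eval S (.inl e) (.inl v) g S'
  | inr {S S' : Finset ℕ} {e v : Exp} {g : CGraph} :
      Eval S e v g S' → Eval S (.inr e) (.inr v) g S'
  | caseL {S S₁ S₂ : Finset ℕ} {e e₁ e₂ v v' : Exp} {g₁ g₂ g : CGraph} :
      Eval S e (.inl v) g₁ S₁ → Eval S₁ (e₁.esubst (Exp.instE v)) v' g₂ S₂ →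
      CGraph.IsSeq g₁ g₂ g → Eval S (.case e e₁ e₂) v' g S₂
  | caseR {S S₁ S₂ : Finset ℕ} {e e₁ e₂ v v' : Exp} {g₁ g₂ g : CGraph} :
      Eval S e (.inr v) g₁ S₁ → Eval S₁ (e₂.esubst (Exp.instE v)) v' g₂ S₂ →
      CGraph.IsSeq g₁ g₂ g → Eval S (.case e e₁ e₂) v' g S₂
  | roll {S S' : Finset ℕ} {e v : Exp} {g : CGraph} :
      Eval S e v g S' → Eval S (.roll e) (.roll v) g S'
  | unroll {S S' : Finset ℕ} {e v : Exp} {g : CGraph} :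
      Eval S e (.roll v) g S' → Eval S (.unroll e) v g S'
  | future {S S' : Finset ℕ} {e v : Exp} {u p : VS} {g g' : CGraph} :
      Eval S e v g S' → VSEval u p → IsPath p → CGraph.IsSpawn g p g' →
      Eval S (.future u e) (.handle p v) g' S'
  | force {S S' : Finset ℕ} {e v : Exp} {p : VS} {g g₁ g' : CGraph} :
      Eval S e (.handle p v) g S' → CGraph.IsTouch p g₁ → CGraph.IsSeq g g₁ g' →
      Eval S (.force e) v g' S'
  | new {S S' : Finset ℕ} {s : ℕ} {U : VSTy} {e v : Exp} {g : CGraph} : s ∉ S →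
      Eval (insert s S) (e.vsubst (instV (.gen s))) v g S' → Eval S (.new U e) v g S'

end GraphTypes

open GraphTypes

namespace GraphTypes

/-! ## Substitution algebra -/

/-! The proof is an induction on the evaluation (`Eval.sound`) which yields preservation of types
and membership of the computation graph together. The work lies in making each ingredient of the
typing judgement stable under the substitutions that an evaluation performs.

Affinity plays a small role. The disjointness of vertices that it is meant to guarantee is already a
premise of sequential composition of computation graphs. It cannot be dropped altogether, since the
kind of a function type demands that the graph type of the body be well formed in an affine context.
Hence `HasTyB`, which is lenient outside of functions and strict in their bodies. The affine context
of a body holds nothing but its own parameter, so substitutions from outside fix it; once the body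
is to be evaluated, it is relaxed and the parameter may be replaced. Strictness is exploited in the
regularity lemma `HasTyB.regular`, where the shape of the graph type of an application requires
splitting to be associative (`CSplit.assoc`).

Canonical forms need type formers to be injective up to type equivalence. Constructors of arrow kind
are only variables and abstractions, so head reduction is elementary, and `ConEq.headShape` shows
that equivalent types reduce to the same head with equivalent components. No logical relation is
needed: equivalence is closed under equivalent substitutions by a beta expansion (`ConEq.vsubst₂`).
Equivalent vertex structures are the well-typed ones with equal normal forms (`VSEq.inv`,
`VSEq.of_nf`). Beta reduction may place them inside arrow annotations, so the annotations of
equivalent function types agree only up to `GSim`.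

On the side of graphs, unrolling comes before normalization, whereas an evaluation of `new` or of an
application first instantiates variables and then proceeds. So an unrolling of an instance of a
graph type must be traced back to the graph type itself. This is possible because neither `Unr` nor
`GEq` inspects vertex structures: every step lifts (`UnrStar.lift`), and normal forms do not notice
the normalization of vertex structures (`NBNF.congr`). `Reach.new`, `Reach.app` and `Reach.sim` all
rest on this.

Finally, a normal form also spends fresh generators on the branches that were not evaluated, and
these must not collide with generators that the evaluation creates later. The invariant `Cost`
therefore leaves the initial set of generators free and allows the additional choices to avoid any
finite set. The branch not taken has a normal form because its graph type is closed
(`GTy.Closed.exists_nbnf`). -/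

theorem VS.subst_subst (σ τ : ℕ → VS) (u : VS) :
    (u.subst σ).subst τ = u.subst fun n => (σ n).subst τ := by
  induction u <;> simp_all [VS.subst]

@[simp] theorem VS.subst_var (u : VS) : u.subst VS.var = u := by
  induction u <;> simp_all [VS.subst]

@[simp] theorem upV_var : upV VS.var = VS.var := by
  funext n; cases n <;> rfl

theorem upV_comp (σ τ : ℕ → VS) :
    (fun n => (upV σ n).subst (upV τ)) = upV fun n => (σ n).subst τ := by
  funext n
  cases n with
  | zero => rfl
  | succ n => simp only [upV, VS.subst_subst]; rfl

theorem GTy.vsubst_vsubst (G : GTy) : ∀ σ τ : ℕ → VS,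
    (G.vsubst σ).vsubst τ = G.vsubst fun n => (σ n).subst τ := by
  induction G <;> intro σ τ <;> simp_all [GTy.vsubst, VS.subst_subst, upV_comp]

@[simp] theorem GTy.vsubst_var (G : GTy) : G.vsubst VS.var = G := by
  induction G <;> simp_all [GTy.vsubst]

theorem Con.vsubst_vsubst (c : Con) : ∀ σ τ : ℕ → VS,
    (c.vsubst σ).vsubst τ = c.vsubst fun n => (σ n).subst τ := by
  induction c <;> intro σ τ <;>
    simp_all [Con.vsubst, VS.subst_subst, upV_comp, GTy.vsubst_vsubst]

@[simp] theorem Con.vsubst_var (c : Con) : c.vsubst VS.var = c := by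
  induction c <;> simp_all [Con.vsubst]

@[simp] theorem Exp.vsubst_var (e : Exp) : e.vsubst VS.var = e := by
  induction e <;> simp_all [Exp.vsubst]

theorem vshift_upV (σ : ℕ → VS) :
    (fun n => (vshift n).subst (upV σ)) = fun n => (σ n).subst vshift := rfl

theorem vshift₂_upV (σ : ℕ → VS) :
    (fun n => (vshift₂ n).subst (upV (upV σ))) = fun n => (σ n).subst vshift₂ := by
  funext n
  simp only [vshift₂, VS.subst, upV, VS.subst_subst]
  rfl

theorem GTy.vshift_comm (G : GTy) (σ : ℕ → VS) :
    (G.vsubst vshift).vsubst (upV σ) = (G.vsubst σ).vsubst vshift := by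
  rw [GTy.vsubst_vsubst, GTy.vsubst_vsubst, vshift_upV]

theorem GTy.vshift₂_comm (G : GTy) (σ : ℕ → VS) :
    (G.vsubst vshift₂).vsubst (upV (upV σ)) = (G.vsubst σ).vsubst vshift₂ := by
  rw [GTy.vsubst_vsubst, GTy.vsubst_vsubst, vshift₂_upV]

theorem Con.vshift_comm (c : Con) (σ : ℕ → VS) :
    (c.vsubst vshift).vsubst (upV σ) = (c.vsubst σ).vsubst vshift := by
  rw [Con.vsubst_vsubst, Con.vsubst_vsubst, vshift_upV]

theorem Con.vshift₂_comm (c : Con) (σ : ℕ → VS) :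
    (c.vsubst vshift₂).vsubst (upV (upV σ)) = (c.vsubst σ).vsubst vshift₂ := by
  rw [Con.vsubst_vsubst, Con.vsubst_vsubst, vshift₂_upV]

theorem instV_comp (u : VS) (σ : ℕ → VS) :
    (fun n => (instV u n).subst σ) = fun n => (upV σ n).subst (instV (u.subst σ)) := by
  funext n
  cases n with
  | zero => rfl
  | succ n =>
    simp only [instV, upV, VS.subst, VS.subst_subst, vshift]
    exact (VS.subst_var _).symm

theorem instV₂_comp (u w : VS) (σ : ℕ → VS) :
    (fun n => (instV₂ u w n).subst σ) =
      fun n => (upV (upV σ) n).subst (instV₂ (u.subst σ) (w.subst σ)) := by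
  funext n
  match n with
  | 0 => rfl
  | 1 => rfl
  | n + 2 =>
    simp only [instV₂, upV, VS.subst, VS.subst_subst, vshift]
    exact (VS.subst_var _).symm

theorem vshift_instV (u : VS) : (fun n => (vshift n).subst (instV u)) = VS.var := rfl

theorem vshift₂_instV₂ (u w : VS) : (fun n => (vshift₂ n).subst (instV₂ u w)) = VS.var := rfl

@[simp] theorem VS.vshift_instV (w u : VS) : (w.subst vshift).subst (instV u) = w := by
  rw [VS.subst_subst, GraphTypes.vshift_instV, VS.subst_var]

@[simp] theorem GTy.vshift_instV (G : GTy) (u : VS) :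
    (G.vsubst vshift).vsubst (instV u) = G := by
  rw [GTy.vsubst_vsubst, GraphTypes.vshift_instV, GTy.vsubst_var]

@[simp] theorem GTy.vshift₂_instV₂ (G : GTy) (u w : VS) :
    (G.vsubst vshift₂).vsubst (instV₂ u w) = G := by
  rw [GTy.vsubst_vsubst, GraphTypes.vshift₂_instV₂, GTy.vsubst_var]

@[simp] theorem Con.vshift_instV (c : Con) (u : VS) :
    (c.vsubst vshift).vsubst (instV u) = c := by
  rw [Con.vsubst_vsubst, GraphTypes.vshift_instV, Con.vsubst_var]

@[simp] theorem Con.vshift₂_instV₂ (c : Con) (u w : VS) :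
    (c.vsubst vshift₂).vsubst (instV₂ u w) = c := by
  rw [Con.vsubst_vsubst, GraphTypes.vshift₂_instV₂, Con.vsubst_var]

theorem Con.vsubst_instV (c : Con) (u : VS) (σ : ℕ → VS) :
    (c.vsubst (instV u)).vsubst σ = (c.vsubst (upV σ)).vsubst (instV (u.subst σ)) := by
  rw [Con.vsubst_vsubst, Con.vsubst_vsubst, instV_comp]

theorem Con.vsubst_instV₂ (c : Con) (u w : VS) (σ : ℕ → VS) :
    (c.vsubst (instV₂ u w)).vsubst σ =
      (c.vsubst (upV (upV σ))).vsubst (instV₂ (u.subst σ) (w.subst σ)) := by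
  rw [Con.vsubst_vsubst, Con.vsubst_vsubst, instV₂_comp]

/-! ### Graph type variables -/

theorem GTy.grename_vsubst (G : GTy) : ∀ (ρ : ℕ → ℕ) (σ : ℕ → VS),
    (G.grename ρ).vsubst σ = (G.vsubst σ).grename ρ := by
  induction G <;> intro ρ σ <;> simp_all [GTy.vsubst, GTy.grename]

theorem GTy.upG_gvar (ρ : ℕ → ℕ) : GTy.upG (fun n => .gvar (ρ n)) = fun n => .gvar (upr ρ n) := by
  funext n; cases n <;> rfl

@[simp] theorem GTy.upG_gvar_id : GTy.upG GTy.gvar = GTy.gvar := by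
  funext n; cases n <;> rfl

@[simp] theorem GTy.gsubst_gvar (G : GTy) : G.gsubst GTy.gvar = G := by
  induction G <;> simp_all [GTy.gsubst, GTy.vsubst]

theorem GTy.grename_eq (G : GTy) : ∀ ρ : ℕ → ℕ, G.grename ρ = G.gsubst fun n => .gvar (ρ n) := by
  induction G <;> intro ρ <;> simp_all [GTy.gsubst, GTy.grename, GTy.vsubst, GTy.upG_gvar]

theorem GTy.upG_vsubst (ξ : ℕ → GTy) (σ : ℕ → VS) :
    (fun n => (upG ξ n).vsubst σ) = upG fun n => (ξ n).vsubst σ := by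
  funext n
  cases n with
  | zero => rfl
  | succ n => simp only [upG, grename_vsubst]

theorem GTy.gsubst_vsubst (G : GTy) : ∀ (ξ : ℕ → GTy) (σ : ℕ → VS),
    (G.gsubst ξ).vsubst σ = (G.vsubst σ).gsubst fun n => (ξ n).vsubst σ := by
  induction G <;> intro ξ σ <;>
    simp_all [GTy.vsubst, GTy.gsubst, GTy.upG_vsubst, GTy.vshift_comm, GTy.vshift₂_comm]

theorem GTy.gsubst_grename_comp (G : GTy) : ∀ (ρ : ℕ → ℕ) (ξ : ℕ → GTy),
    (G.grename ρ).gsubst ξ = G.gsubst fun n => ξ (ρ n) := by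
  induction G <;> intro ρ ξ <;> simp_all [GTy.grename, GTy.gsubst]
  case mu G ih =>
    congr 1; funext n; cases n <;> rfl

theorem GTy.grename_grename (G : GTy) : ∀ ρ ρ' : ℕ → ℕ,
    (G.grename ρ).grename ρ' = G.grename fun n => ρ' (ρ n) := by
  induction G <;> intro ρ ρ' <;> simp_all [GTy.grename]
  case mu G ih =>
    congr 1; funext n; cases n <;> rfl

theorem GTy.upG_grename (ξ : ℕ → GTy) (ρ : ℕ → ℕ) :
    (fun n => (upG ξ n).grename (upr ρ)) = upG fun n => (ξ n).grename ρ := by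
  funext n
  cases n with
  | zero => rfl
  | succ n => simp only [upG, grename_grename, upr]

theorem GTy.grename_gsubst (G : GTy) : ∀ (ξ : ℕ → GTy) (ρ : ℕ → ℕ),
    (G.gsubst ξ).grename ρ = G.gsubst fun n => (ξ n).grename ρ := by
  induction G <;> intro ξ ρ <;>
    simp_all [GTy.grename, GTy.gsubst, GTy.upG_grename, ← GTy.grename_vsubst]

theorem GTy.instG_vsubst (M : GTy) (σ : ℕ → VS) :
    (fun n => (instG M n).vsubst σ) = instG (M.vsubst σ) := by
  funext n; cases n <;> rfl

theorem arrowAnn_vsubst (G : GTy) (σ : ℕ → VS) :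
    (arrowAnn G).vsubst (upV (upV σ)) = arrowAnn (G.vsubst σ) := by
  simp only [arrowAnn, GTy.vsubst, GTy.vshift₂_comm]; rfl

theorem arrowAnn_gsubst (G : GTy) (ξ : ℕ → GTy) :
    (arrowAnn G).gsubst (fun n => (ξ n).vsubst vshift₂) = arrowAnn (G.gsubst ξ) := by
  simp only [arrowAnn, GTy.gsubst, GTy.gsubst_vsubst]

/-- Weakening by two variables is undone by instantiating them, with any vertex structures whatever.
This makes function types invertible although the annotation is not a constructor pattern. -/
theorem arrowAnn_injective {G G' : GTy} (h : arrowAnn G = arrowAnn G') : G = G' := by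
  simp only [arrowAnn, GTy.app.injEq, and_true] at h
  have := congrArg (GTy.vsubst (instV₂ (.gen 0) (.gen 0))) h
  simpa using this

namespace Con

/-- Substitution of graph types for graph type variables in type constructors. -/
def gsubst (ξ : ℕ → GTy) : Con → Con
  | unit => unit
  | fn Uf Ut c₁ c₂ G =>
      fn Uf Ut (c₁.gsubst fun n => (ξ n).vsubst vshift₂) (c₂.gsubst fun n => (ξ n).vsubst vshift₂)
        (G.gsubst fun n => (ξ n).vsubst vshift₂)
  | prod c₁ c₂ => prod (c₁.gsubst ξ) (c₂.gsubst ξ)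
  | sum c₁ c₂ => sum (c₁.gsubst ξ) (c₂.gsubst ξ)
  | fut c u => fut (c.gsubst ξ) u
  | cvar n => cvar n
  | recty U c u => recty U (c.gsubst fun n => (ξ n).vsubst vshift) u
  | lam U c => lam U (c.gsubst fun n => (ξ n).vsubst vshift)
  | app c u => app (c.gsubst ξ) u

theorem grename_eq (c : Con) : ∀ ρ : ℕ → ℕ, c.grename ρ = c.gsubst fun n => .gvar (ρ n) := by
  induction c <;> intro ρ <;>
    simp_all [Con.gsubst, Con.grename, GTy.vsubst, GTy.grename_eq]

theorem grename_vsubst (c : Con) : ∀ (ρ : ℕ → ℕ) (σ : ℕ → VS),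
    (c.grename ρ).vsubst σ = (c.vsubst σ).grename ρ := by
  induction c <;> intro ρ σ <;> simp_all [Con.vsubst, Con.grename, GTy.grename_vsubst]

@[simp] theorem gsubst_gvar (c : Con) : c.gsubst GTy.gvar = c := by
  induction c <;> simp_all [Con.gsubst, GTy.vsubst]

theorem gsubst_vsubst (c : Con) : ∀ (ξ : ℕ → GTy) (σ : ℕ → VS),
    (c.gsubst ξ).vsubst σ = (c.vsubst σ).gsubst fun n => (ξ n).vsubst σ := by
  induction c <;> intro ξ σ <;>
    simp_all [Con.vsubst, Con.gsubst, GTy.gsubst_vsubst, GTy.vshift_comm, GTy.vshift₂_comm]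

theorem gsubst_grename_comp (c : Con) : ∀ (ρ : ℕ → ℕ) (ξ : ℕ → GTy),
    (c.grename ρ).gsubst ξ = c.gsubst fun n => ξ (ρ n) := by
  induction c <;> intro ρ ξ <;> simp_all [Con.grename, Con.gsubst, GTy.gsubst_grename_comp]

theorem grename_gsubst (c : Con) : ∀ (ξ : ℕ → GTy) (ρ : ℕ → ℕ),
    (c.gsubst ξ).grename ρ = c.gsubst fun n => (ξ n).grename ρ := by
  induction c <;> intro ξ ρ <;>
    simp_all [Con.grename, Con.gsubst, GTy.grename_gsubst, ← GTy.grename_vsubst]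

theorem grename_succ_upG (c : Con) (ξ : ℕ → GTy) :
    (c.grename Nat.succ).gsubst (GTy.upG ξ) = (c.gsubst ξ).grename Nat.succ := by
  rw [gsubst_grename_comp, grename_gsubst]; rfl

@[simp] theorem grename_succ_instG (c : Con) (M : GTy) :
    (c.grename Nat.succ).gsubst (GTy.instG M) = c := by
  rw [gsubst_grename_comp]; exact gsubst_gvar c

/-! ### Type constructor variables -/

theorem crename_vsubst (c : Con) : ∀ (ρ : ℕ → ℕ) (σ : ℕ → VS),
    (c.crename ρ).vsubst σ = (c.vsubst σ).crename ρ := by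
  induction c <;> intro ρ σ <;> simp_all [Con.vsubst, Con.crename]

theorem crename_gsubst (c : Con) : ∀ (ρ : ℕ → ℕ) (ξ : ℕ → GTy),
    (c.crename ρ).gsubst ξ = (c.gsubst ξ).crename ρ := by
  induction c <;> intro ρ σ <;> simp_all [Con.gsubst, Con.crename]

theorem upC_vsubst (χ : ℕ → Con) (σ : ℕ → VS) :
    (fun n => (upC χ n).vsubst σ) = upC fun n => (χ n).vsubst σ := by
  funext n
  cases n with
  | zero => rfl
  | succ n => simp only [upC, crename_vsubst]

theorem upC_gsubst (χ : ℕ → Con) (ξ : ℕ → GTy) :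
    (fun n => (upC χ n).gsubst ξ) = upC fun n => (χ n).gsubst ξ := by
  funext n
  cases n with
  | zero => rfl
  | succ n => simp only [upC, crename_gsubst]

theorem csubst_vsubst (c : Con) : ∀ (χ : ℕ → Con) (σ : ℕ → VS),
    (c.csubst χ).vsubst σ = (c.vsubst σ).csubst fun n => (χ n).vsubst σ := by
  induction c <;> intro χ σ <;>
    simp_all [Con.vsubst, Con.csubst, upC_vsubst, vshift_comm, vshift₂_comm]

theorem csubst_gsubst (c : Con) : ∀ (χ : ℕ → Con) (ξ : ℕ → GTy),
    (c.csubst χ).gsubst ξ = (c.gsubst ξ).csubst fun n => (χ n).gsubst ξ := by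
  induction c <;> intro χ ξ <;>
    simp_all [Con.gsubst, Con.csubst, upC_gsubst, ← gsubst_vsubst]

theorem instC_vsubst (c : Con) (σ : ℕ → VS) :
    (fun n => (instC c n).vsubst σ) = instC (c.vsubst σ) := by
  funext n; cases n <;> rfl

theorem instC_gsubst (c : Con) (ξ : ℕ → GTy) :
    (fun n => (instC c n).gsubst ξ) = instC (c.gsubst ξ) := by
  funext n; cases n <;> rfl

theorem vshift_up_comm (c : Con) (σ : ℕ → VS) :
    (c.vsubst (upV vshift)).vsubst (upV (upV σ)) = (c.vsubst (upV σ)).vsubst (upV vshift) := by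
  rw [vsubst_vsubst, vsubst_vsubst, upV_comp, upV_comp, vshift_upV]

theorem unroll_vsubst (U : VSTy) (c : Con) (u : VS) (σ : ℕ → VS) :
    (unroll U c u).vsubst σ = unroll U (c.vsubst (upV σ)) (u.subst σ) := by
  simp only [unroll, csubst_vsubst, instC_vsubst, Con.vsubst, vsubst_instV, vshift_up_comm]; rfl

theorem unroll_gsubst (U : VSTy) (c : Con) (u : VS) (ξ : ℕ → GTy) :
    (unroll U c u).gsubst ξ = unroll U (c.gsubst fun n => (ξ n).vsubst vshift) u := by
  have h1 : (fun n => ((ξ n).vsubst vshift).vsubst (instV u)) = ξ := by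
    funext n; simp
  have h2 : (fun n => ((ξ n).vsubst vshift).vsubst (upV vshift)) =
      fun n => ((ξ n).vsubst vshift).vsubst vshift := by
    funext n; rw [GTy.vshift_comm]
  simp only [unroll, csubst_gsubst, instC_gsubst, Con.gsubst, gsubst_vsubst, h1, h2]

end Con

/-! ## Subtyping and splitting -/

theorem VSub.unavLeft (U₁ U₃ U₂ : VSTy) (a : Avail) :
    VSub (.prod U₁ .unav U₂ a) (.prod U₃ .unav U₂ a) := .prodLeft ..

theorem VSub.unavRight (U₁ U₂ U₃ : VSTy) (a : Avail) :
    VSub (.prod U₁ a U₂ .unav) (.prod U₁ a U₃ .unav) := .prodRight ..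

theorem VSplit.sub₂ {U A B A' B' : VSTy} (h : VSplit U A B) (hA : VSub A A') (hB : VSub B B') :
    VSplit U A' B' := .sub (.comm (.sub (.comm h) hB)) hA

/-- A subtype offers at least as much as its supertype, so it can imitate any split; whatever it has
in excess is discarded from the halves by subtyping. -/
theorem VSplit.of_sub {U V : VSTy} (hs : VSub U V) :
    ∀ {A B : VSTy}, VSplit V A B → VSplit U A B := by
  induction hs with
  | prodLeft U₁ U₂ U₃ a₁ a₂ =>
    intro A B h
    generalize hP : VSTy.prod U₃ .unav U₂ a₂ = P at h
    induction h <;> cases hP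
    -- With the left component unavailable, `right` is the only structural rule that can split the
    -- product.
    case right.refl h _ => exact (VSplit.right _ _ h).sub₂ (.prodLeft ..) (.prodLeft ..)
    case sub.refl h _ ih => exact .sub (ih rfl) h
    case comm.refl ih => exact .comm (ih rfl)
  | prodRight U₁ U₂ U₃ a₁ a₂ =>
    intro A B h
    generalize hP : VSTy.prod U₁ a₁ U₃ .unav = P at h
    induction h <;> cases hP
    case left.refl h _ => exact (VSplit.left _ _ h).sub₂ (.prodRight ..) (.prodRight ..)
    case sub.refl h _ ih => exact .sub (ih rfl) h
    case comm.refl ih => exact .comm (ih rfl)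
  | @prod U₁ U₂ V₁ V₂ a₁ a₂ h₁ h₂ ih₁ ih₂ =>
    intro A B h
    generalize hP : VSTy.prod V₁ a₁ V₂ a₂ = P at h
    induction h <;> cases hP
    case prod.refl => exact (VSplit.prod _ _).sub₂ (.prod _ _ h₁ h₂) (.prod _ _ h₁ h₂)
    case both.refl h h' _ _ => exact .both (ih₁ h) (ih₂ h')
    case left.refl h _ =>
      exact (VSplit.left _ _ (ih₁ h)).sub₂ (.prod _ _ (.refl _) h₂)
        (.unavRight ..)
    case right.refl h _ =>
      exact (VSplit.right _ _ (ih₂ h)).sub₂ (.prod _ _ h₁ (.refl _)) (.unavLeft ..)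
    case sub.refl h _ ih => exact .sub (ih rfl) h
    case comm.refl ih => exact .comm (ih rfl)
  | corec1 U => intro A B h; exact .corec h
  | corec2 U =>
    intro A B h
    generalize hP : VSTy.corec U = P at h
    induction h <;> cases hP
    case corec.refl h _ => exact h
    case sub.refl h _ ih => exact .sub (ih rfl) h
    case comm.refl ih => exact .comm (ih rfl)
  | refl U => intro A B h; exact h
  | trans _ _ ih₁ ih₂ => intro A B h; exact ih₁ (ih₂ h)

theorem SplitEntry.comm {o a b : Option VSTy} (h : SplitEntry o a b) : SplitEntry o b a := by
  cases h with
  | none => exact .none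
  | left U => exact .right U
  | right U => exact .left U
  | both h => exact .both (.comm h)

/-! ### Splits of products, component by component -/

/-- The content of a component of a product. -/
def VSTy.avail (U : VSTy) : Avail → Option VSTy
  | .av => some U
  | .unav => none

/-- The product with the given contents of its components. -/
def VSTy.ofOpts (o p : Option VSTy) : VSTy :=
  .prod (o.getD .vty) (if o.isSome then .av else .unav)
    (p.getD .vty) (if p.isSome then .av else .unav)

/-- The placeholder `vty` is harmless: the VS type of an unavailable component can be exchanged for
any other by subtyping, in both directions. -/
theorem VSub.ofOpts_prod (U₁ U₂ : VSTy) (a₁ a₂ : Avail) :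
    VSub (VSTy.ofOpts (U₁.avail a₁) (U₂.avail a₂)) (.prod U₁ a₁ U₂ a₂) := by
  cases a₁ <;> cases a₂
  · exact .refl _
  · exact .unavRight ..
  · exact .unavLeft ..
  · exact .trans (.unavLeft ..) (.unavRight ..)

theorem VSub.prod_ofOpts (U₁ U₂ : VSTy) (a₁ a₂ : Avail) :
    VSub (.prod U₁ a₁ U₂ a₂) (VSTy.ofOpts (U₁.avail a₁) (U₂.avail a₂)) := by
  cases a₁ <;> cases a₂
  · exact .refl _
  · exact .unavRight ..
  · exact .unavLeft ..
  · exact .trans (.unavLeft ..) (.unavRight ..)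

/-- Each half must keep a component, since no structural rule of `VSplit` leaves a half with nothing
available; moving a whole entry to one side is left to `SplitEntry`. -/
theorem VSplit.ofOpts {o a b o' a' b' : Option VSTy} (h : SplitEntry o a b)
    (h' : SplitEntry o' a' b') (ha : a.isSome ∨ a'.isSome) (hb : b.isSome ∨ b'.isSome) :
    VSplit (VSTy.ofOpts o o') (VSTy.ofOpts a a') (VSTy.ofOpts b b') := by
  cases h <;> cases h' <;> simp at ha hb <;> simp only [VSTy.ofOpts]
  case none.both h => exact .right _ _ h
  case left.right => exact (VSplit.prod _ _).sub₂ (.unavRight ..) (.unavLeft ..)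
  case left.both _ _ _ h => exact (VSplit.right _ _ h).sub₂ (.refl _) (.unavLeft ..)
  case right.left => exact (VSplit.comm (.prod _ _)).sub₂ (.unavLeft ..) (.unavRight ..)
  case right.both _ _ _ h => exact (VSplit.comm (.right _ _ (.comm h))).sub₂ (.unavLeft ..) (.refl _)
  case both.none h => exact (VSplit.left _ _ h).sub₂ (.refl _) (.refl _)
  case both.left _ _ _ h _ => exact (VSplit.left _ _ h).sub₂ (.refl _) (.unavRight ..)
  case both.right _ _ _ h _ => exact (VSplit.comm (.left _ _ (.comm h))).sub₂ (.unavRight ..) (.refl _)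
  case both.both _ _ _ h _ _ _ h' => exact .both h h'

/-- The four product rules are instances of one scheme: both components split independently, like
entries of a context. Inversion is up to subtyping of the halves, as the rule `sub` may come last.
-/
theorem VSplit.prod_inv {P A B : VSTy} (h : VSplit P A B) :
    ∀ {U₁ U₂ : VSTy} {a₁ a₂ : Avail}, P = .prod U₁ a₁ U₂ a₂ →
    ∃ a b a' b', SplitEntry (U₁.avail a₁) a b ∧ SplitEntry (U₂.avail a₂) a' b' ∧
      (a.isSome ∨ a'.isSome) ∧ (b.isSome ∨ b'.isSome) ∧
      VSub (VSTy.ofOpts a a') A ∧ VSub (VSTy.ofOpts b b') B := by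
  induction h with
  | prod V₁ V₂ =>
    rintro _ _ _ _ ⟨⟩
    exact ⟨some V₁, none, none, some V₂, .left _, .right _, by simp, by simp,
      .ofOpts_prod V₁ V₂ .av .unav, .ofOpts_prod V₁ V₂ .unav .av⟩
  | both h h' =>
    rintro _ _ _ _ ⟨⟩
    exact ⟨_, _, _, _, .both h, .both h', by simp, by simp, .refl _, .refl _⟩
  | @left V₁ V V' V₂ a h =>
    rintro _ _ _ _ ⟨⟩
    refine ⟨some V, some V', V₂.avail a, none, .both h, ?_, by simp, by simp,
      .ofOpts_prod V V₂ .av a, .ofOpts_prod V' V₂ .av .unav⟩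
    cases a
    · exact .left _
    · exact .none
  | @right V₂ V V' V₁ a h =>
    rintro _ _ _ _ ⟨⟩
    refine ⟨V₁.avail a, none, some V, some V', ?_, .both h, by simp, by simp,
      .ofOpts_prod V₁ V a .av, .ofOpts_prod V₁ V' .unav .av⟩
    cases a
    · exact .left _
    · exact .none
  | corec => rintro _ _ _ _ ⟨⟩
  | sub _ hs ih =>
    rintro _ _ _ _ rfl
    obtain ⟨a, b, a', b', h, h', ha, hb, hA, hB⟩ := ih rfl
    exact ⟨a, b, a', b', h, h', ha, hb, .trans hA hs, hB⟩
  | comm _ ih =>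
    rintro _ _ _ _ rfl
    obtain ⟨a, b, a', b', h, h', ha, hb, hA, hB⟩ := ih rfl
    exact ⟨b, a, b', a', h.comm, h'.comm, hb, ha, hB, hA⟩

/-- Associativity at a split of an entry. -/
def SplitEntry.Assoc (o a b : Option VSTy) : Prop :=
  ∀ ⦃a₁ a₂ : Option VSTy⦄, SplitEntry a a₁ a₂ → ∃ x, SplitEntry o a₁ x ∧ SplitEntry x a₂ b

/-- Associativity at a split of a VS type. -/
def VSplit.Assoc (U A B : VSTy) : Prop :=
  ∀ ⦃A₁ A₂ : VSTy⦄, VSplit A A₁ A₂ → ∃ X, VSplit U A₁ X ∧ VSplit X A₂ B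

theorem SplitEntry.isSome_of_left {o a b : Option VSTy} (h : SplitEntry o a b)
    (ha : a.isSome) : o.isSome := by
  cases h <;> simp_all

/-- If the entry goes wholly to one side, regrouping is trivial. Only an entry that is split at both
stages depends on associativity for VS types. -/
theorem SplitEntry.assoc_of {o a b : Option VSTy} (h : SplitEntry o a b)
    (hV : ∀ {U A B}, o = some U → a = some A → b = some B → VSplit.Assoc U A B) :
    SplitEntry.Assoc o a b := by
  intro a₁ a₂ ha
  cases h with
  | none => cases ha; exact ⟨_, .none, .none⟩
  | left U =>
    refine ⟨a₂, ha, ?_⟩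
    cases ha
    · exact .none
    · exact .left _
    · exact .left _
  | right U => cases ha; exact ⟨_, .right _, .right _⟩
  | both h =>
    cases ha with
    | left => exact ⟨_, .both h, .right _⟩
    | right => exact ⟨_, .right _, .both h⟩
    | both ha =>
      obtain ⟨X, h₁, h₂⟩ := hV rfl rfl rfl ha
      exact ⟨_, .both h₁, .both h₂⟩

/-- By `VSplit.prod_inv` the second split decomposes over the components; these are regrouped
separately and reassembled. -/
theorem VSplit.assoc_ofOpts {U₁ U₂ A : VSTy} {c₁ c₂ a₁ a₂ : Avail} {V₁ V₂ : VSTy}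
    {b b' : Option VSTy}
    (h : SplitEntry.Assoc (U₁.avail c₁) (V₁.avail a₁) b)
    (h' : SplitEntry.Assoc (U₂.avail c₂) (V₂.avail a₂) b')
    (hb : b.isSome ∨ b'.isSome) (hA : VSub (VSTy.ofOpts b b') A) :
    VSplit.Assoc (.prod U₁ c₁ U₂ c₂) (.prod V₁ a₁ V₂ a₂) A := by
  intro A₁ A₂ hs
  obtain ⟨x, y, x', y', hx, hx', hxs, hys, hxA, hyA⟩ := hs.prod_inv rfl
  obtain ⟨z, hz₁, hz₂⟩ := h hx
  obtain ⟨z', hz₁', hz₂'⟩ := h' hx'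
  refine ⟨VSTy.ofOpts z z', ?_, ?_⟩
  · refine .of_sub (.prod_ofOpts ..) (.sub (VSplit.ofOpts hz₁ hz₁' hxs ?_) hxA)
    exact hys.imp hz₂.isSome_of_left hz₂'.isSome_of_left
  · exact (VSplit.ofOpts hz₂ hz₂' hys hb).sub₂ hyA hA

/-- Both orientations are proved at once because the rule `comm` exchanges them. For `sub`, the half
that is split next is handled by `VSplit.of_sub`, and the other half merely absorbs the subtyping.
-/
theorem VSplit.assoc_aux {U A B : VSTy} (h : VSplit U A B) :
    VSplit.Assoc U A B ∧ VSplit.Assoc U B A := by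
  induction h with
  | prod V₁ V₂ =>
    constructor
    · exact assoc_ofOpts (SplitEntry.assoc_of (.left V₁) (by simp [VSTy.avail]))
        (SplitEntry.assoc_of (.right V₂) (by simp [VSTy.avail])) (by simp)
        (.ofOpts_prod V₁ V₂ .unav .av)
    · exact assoc_ofOpts (SplitEntry.assoc_of (.right V₁) (by simp [VSTy.avail]))
        (SplitEntry.assoc_of (.left V₂) (by simp [VSTy.avail])) (by simp)
        (.ofOpts_prod V₁ V₂ .av .unav)
  | both h h' ih ih' =>
    constructor
    · exact assoc_ofOpts (SplitEntry.assoc_of (.both h) (by rintro _ _ _ ⟨⟩ ⟨⟩ ⟨⟩; exact ih.1))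
        (SplitEntry.assoc_of (.both h') (by rintro _ _ _ ⟨⟩ ⟨⟩ ⟨⟩; exact ih'.1)) (by simp)
        (.refl _)
    · exact assoc_ofOpts
        (SplitEntry.assoc_of (.both h.comm) (by rintro _ _ _ ⟨⟩ ⟨⟩ ⟨⟩; exact ih.2))
        (SplitEntry.assoc_of (.both h'.comm) (by rintro _ _ _ ⟨⟩ ⟨⟩ ⟨⟩; exact ih'.2)) (by simp)
        (.refl _)
  | @left V₁ V V' V₂ a h ih =>
    have hr : SplitEntry (V₂.avail a) (V₂.avail a) none := by
      cases a
      · exact .left _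
      · exact .none
    constructor
    · exact assoc_ofOpts (SplitEntry.assoc_of (.both h) (by rintro _ _ _ ⟨⟩ ⟨⟩ ⟨⟩; exact ih.1))
        (SplitEntry.assoc_of hr (by simp)) (by simp)
        (.ofOpts_prod V' V₂ .av .unav)
    · exact assoc_ofOpts
        (SplitEntry.assoc_of (.both h.comm) (by rintro _ _ _ ⟨⟩ ⟨⟩ ⟨⟩; exact ih.2))
        (SplitEntry.assoc_of hr.comm (by simp [VSTy.avail])) (by simp)
        (.ofOpts_prod V V₂ .av a)
  | @right V₂ V V' V₁ a h ih =>
    have hr : SplitEntry (V₁.avail a) (V₁.avail a) none := by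
      cases a
      · exact .left _
      · exact .none
    constructor
    · exact assoc_ofOpts (SplitEntry.assoc_of hr (by simp))
        (SplitEntry.assoc_of (.both h) (by rintro _ _ _ ⟨⟩ ⟨⟩ ⟨⟩; exact ih.1)) (by simp)
        (.ofOpts_prod V₁ V' .unav .av)
    · exact assoc_ofOpts (SplitEntry.assoc_of hr.comm (by simp [VSTy.avail]))
        (SplitEntry.assoc_of (.both h.comm) (by rintro _ _ _ ⟨⟩ ⟨⟩ ⟨⟩; exact ih.2)) (by simp)
        (.ofOpts_prod V₁ V a .av)
  | corec _ ih =>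
    constructor
    · intro _ _ h; obtain ⟨X, h₁, h₂⟩ := ih.1 h; exact ⟨X, .corec h₁, h₂⟩
    · intro _ _ h; obtain ⟨X, h₁, h₂⟩ := ih.2 h; exact ⟨X, .corec h₁, h₂⟩
  | sub _ hs ih =>
    constructor
    · intro _ _ h; exact ih.1 (.of_sub hs h)
    · intro _ _ h
      obtain ⟨X, h₁, h₂⟩ := ih.2 h
      exact ⟨X, h₁, h₂.sub₂ (.refl _) hs⟩
  | comm _ ih => exact ih.symm

/-! ### Splitting and inclusion of contexts -/

theorem CSplit.comm {Ω Ω₁ Ω₂ : VCtx} (h : CSplit Ω Ω₁ Ω₂) : CSplit Ω Ω₂ Ω₁ :=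
  fun r => (h r).comm

/-- Splitting of contexts is associative. -/
theorem CSplit.assoc {Ω Ω₁ Ω₂ Ω₃ Ω' : VCtx} (h : CSplit Ω Ω₁ Ω') (h' : CSplit Ω' Ω₂ Ω₃) :
    ∃ Ω'', CSplit Ω Ω'' Ω₃ ∧ CSplit Ω'' Ω₁ Ω₂ := by
  -- `SplitEntry.Assoc` splits the left part further, so both given splits are turned around.
  have key : ∀ r, ∃ x, SplitEntry (Ω r) (Ω₃ r) x ∧ SplitEntry x (Ω₂ r) (Ω₁ r) := fun r =>
    SplitEntry.assoc_of (h r).comm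
      (fun hU hA hB => by
        have := (h r).comm
        rw [hU, hA, hB] at this
        cases this with
        | both hs => exact hs.assoc_aux.1) (h' r).comm
  choose Ω'' h₁ h₂ using key
  exact ⟨Ω'', fun r => (h₁ r).comm, fun r => (h₂ r).comm⟩

theorem CSplit.empty_inv {Ω₁ Ω₂ : VCtx} (h : CSplit .empty Ω₁ Ω₂) :
    Ω₁ = .empty ∧ Ω₂ = .empty := by
  have key : ∀ {a b : Option VSTy}, SplitEntry none a b → a = none ∧ b = none := by
    intro a b h; cases h; exact ⟨rfl, rfl⟩
  exact ⟨funext fun r => (key (h r)).1, funext fun r => (key (h r)).2⟩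

theorem SplitEntry.right' (o : Option VSTy) : SplitEntry o Option.none o := by
  cases o
  · exact .none
  · exact .right _

theorem CSplit.empty_left (Ω : VCtx) : CSplit Ω .empty Ω := fun r => .right' (Ω r)

theorem CSplit.empty_right (Ω : VCtx) : CSplit Ω Ω .empty := (CSplit.empty_left Ω).comm

/-- Inclusion of contexts. -/
def VCtx.Sub (Ω Ω' : VCtx) : Prop := ∀ r U, Ω r = some U → Ω' r = some U

theorem VCtx.Sub.refl (Ω : VCtx) : Ω.Sub Ω := fun _ _ h => h

theorem VCtx.Sub.empty (Ω : VCtx) : VCtx.empty.Sub Ω := fun _ _ h => by cases h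

theorem VCtx.Sub.push {Ω Ω' : VCtx} (h : Ω.Sub Ω') (o : Option VSTy) :
    (Ω.push o).Sub (Ω'.push o) := by
  rintro ((_ | n) | s) U hU
  · exact hU
  · exact h (.var n) U hU
  · exact h (.gen s) U hU

/-- All surplus entries go to the left part. The right part stays literally the same, so premises
over it can be reused without change. -/
theorem CSplit.extend {Ω Ω₁ Ω₂ Ω' : VCtx} (h : CSplit Ω Ω₁ Ω₂) (hs : Ω.Sub Ω') :
    ∃ Ω₁', CSplit Ω' Ω₁' Ω₂ ∧ Ω₁.Sub Ω₁' := by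
  refine ⟨fun r => if Ω r = none then Ω' r else Ω₁ r, fun r => ?_, fun r U hU => ?_⟩
  · have hr := h r
    have hsr := hs r
    dsimp only
    generalize Ω r = o at *; generalize Ω₁ r = o₁ at *; generalize Ω₂ r = o₂ at *
    cases hr with
    | none => exact (SplitEntry.right' _).comm
    | left U => rw [hsr U rfl]; exact .left _
    | right U => rw [hsr U rfl]; exact .right _
    | both h => rw [hsr _ rfl]; exact .both h
  · have hr := h r
    dsimp only
    rw [hU] at hr ⊢
    generalize Ω r = o at *; generalize Ω₂ r = o₂ at *
    cases hr <;> simp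

theorem CSplit.sub_left {Ω Ω₁ Ω₂ : VCtx} (h : CSplit Ω Ω₁ Ω₂) {r : VRoot} (hr : Ω₁ r ≠ none) :
    Ω r ≠ none := by
  have := h r
  generalize Ω r = o at *; generalize Ω₁ r = o₁ at *; generalize Ω₂ r = o₂ at *
  cases this <;> simp_all

/-! ## Typing of vertex structures -/

theorem HasVS.mono {Ω Ψ : VCtx} {u : VS} {U : VSTy} (h : HasVS Ω Ψ u U) :
    ∀ {Ω' : VCtx}, Ω.Sub Ω' → HasVS Ω' Ψ u U := by
  induction h with
  | omegaVar h => intro Ω' hs; exact .omegaVar (hs _ _ h)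
  | psiVar h => intro Ω' hs; exact .psiVar h
  | omegaGen h => intro Ω' hs; exact .omegaGen (hs _ _ h)
  | psiGen h => intro Ω' hs; exact .psiGen h
  | pair hc _ _ ih₁ ih₂ =>
    intro Ω' hs
    obtain ⟨Ω₁', hc', hs'⟩ := hc.extend hs
    exact .pair hc' (ih₁ hs') (ih₂ (.refl _))
  | onlyLeft _ h ih => intro Ω' hs; exact .onlyLeft (ih hs) h
  | onlyRight h _ _ ih => intro Ω' hs; exact .onlyRight h (ih hs)
  | fst _ ih => intro Ω' hs; exact .fst (ih hs)
  | snd _ ih => intro Ω' hs; exact .snd (ih hs)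
  | sub _ h ih => intro Ω' hs; exact .sub (ih hs) h

/-- A VS type of every vertex structure. -/
def VSTy.univ : VSTy := .corec (.prod (.tvar 0) .av (.tvar 0) .av)

/-- The context that assigns `VSTy.univ` to every root. -/
def VCtx.univ : VCtx := fun _ => some .univ

/-- The universal type unfolds to the product of itself with itself, hence it is closed under
pairing and under both projections. -/
theorem HasVS.univ (u : VS) : HasVS .empty .univ u .univ := by
  have h₁ : VSub .univ (.prod .univ .av .univ .av) :=
    .corec1 (.prod (.tvar 0) .av (.tvar 0) .av)
  have h₂ : VSub (.prod .univ .av .univ .av) .univ :=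
    .corec2 (.prod (.tvar 0) .av (.tvar 0) .av)
  induction u with
  | var n => exact .psiVar rfl
  | gen s => exact .psiGen rfl
  | pair u₁ u₂ ih₁ ih₂ => exact .sub (.pair (CSplit.empty_left _) ih₁ ih₂) h₂
  | fst u h => exact .fst (.sub h h₁)
  | snd u h => exact .snd (.sub h h₁)

/-- Nothing has to be known about the unavailable component: it is typed by the universal type,
which subtyping then replaces by `U₂`. This matters under substitution, which is not assumed well
typed for the arbitrary context of that component. -/
theorem HasVS.left {Ω Ψ : VCtx} {u₁ : VS} {U₁ : VSTy} (u₂ : VS) (U₂ : VSTy)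
    (h : HasVS Ω Ψ u₁ U₁) : HasVS Ω Ψ (.pair u₁ u₂) (.prod U₁ .av U₂ .unav) :=
  .sub (.onlyLeft h (.univ u₂)) (.unavRight ..)

theorem HasVS.right {Ω Ψ : VCtx} {u₂ : VS} {U₂ : VSTy} (u₁ : VS) (U₁ : VSTy)
    (h : HasVS Ω Ψ u₂ U₂) : HasVS Ω Ψ (.pair u₁ u₂) (.prod U₁ .unav U₂ .av) :=
  .sub (.onlyRight (.univ u₁) h) (.unavLeft ..)

/-! ### Substitution into vertex structures -/

/-- The substitution `σ` and the identity on generators map `Ψ` to `Ψ'`. -/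
structure SubOK (σ : ℕ → VS) (Ψ Ψ' : VCtx) : Prop where
  var : ∀ {n U}, Ψ (.var n) = some U → HasVS .empty Ψ' (σ n) U
  gen : ∀ {s U}, Ψ (.gen s) = some U → HasVS .empty Ψ' (.gen s) U

/-- The substitution `σ` fixes the variables of `Ω`. -/
def FixOn (σ : ℕ → VS) (Ω : VCtx) : Prop := ∀ n, Ω (.var n) ≠ none → σ n = .var n

theorem FixOn.empty (σ : ℕ → VS) : FixOn σ .empty := fun _ h => (h rfl).elim

theorem FixOn.left {σ : ℕ → VS} {Ω Ω₁ Ω₂ : VCtx} (h : FixOn σ Ω) (hs : CSplit Ω Ω₁ Ω₂) :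
    FixOn σ Ω₁ := fun n hn => h n (hs.sub_left hn)

theorem FixOn.right {σ : ℕ → VS} {Ω Ω₁ Ω₂ : VCtx} (h : FixOn σ Ω) (hs : CSplit Ω Ω₁ Ω₂) :
    FixOn σ Ω₂ := h.left hs.comm

theorem FixOn.push {σ : ℕ → VS} {Ω : VCtx} (h : FixOn σ Ω) (o : Option VSTy) :
    FixOn (upV σ) (Ω.push o) := by
  rintro (_ | n) hn
  · rfl
  · simp only [upV, h n hn, VS.subst, vshift]

/-- Only unrestricted variables are replaced, and by vertex structures that need no affine entries.
Affine variables have to be fixed, as replacing them would demand a matching change of every split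
of `Ω`. -/
theorem HasVS.subst {Ω Ψ : VCtx} {u : VS} {U : VSTy} (h : HasVS Ω Ψ u U) :
    ∀ {Ψ' : VCtx} {σ : ℕ → VS}, SubOK σ Ψ Ψ' → FixOn σ Ω → HasVS Ω Ψ' (u.subst σ) U := by
  induction h with
  | @omegaVar Ω _ n _ h =>
    intro Ψ' σ hσ hΩ
    simp only [VS.subst, hΩ n (by simp [h])]
    exact .omegaVar h
  | psiVar h => intro Ψ' σ hσ hΩ; exact (hσ.var h).mono (.empty _)
  | omegaGen h => intro Ψ' σ hσ hΩ; exact .omegaGen h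
  | psiGen h => intro Ψ' σ hσ hΩ; exact (hσ.gen h).mono (.empty _)
  | pair hc _ _ ih₁ ih₂ =>
    intro Ψ' σ hσ hΩ
    exact .pair hc (ih₁ hσ (hΩ.left hc)) (ih₂ hσ (hΩ.right hc))
  | onlyLeft _ h ih => intro Ψ' σ hσ hΩ; exact .left _ _ (ih hσ hΩ)
  | onlyRight h _ _ ih => intro Ψ' σ hσ hΩ; exact .right _ _ (ih hσ hΩ)
  | fst _ ih => intro Ψ' σ hσ hΩ; exact .fst (ih hσ hΩ)
  | snd _ ih => intro Ψ' σ hσ hΩ; exact .snd (ih hσ hΩ)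
  | sub _ h ih => intro Ψ' σ hσ hΩ; exact .sub (ih hσ hΩ) h

theorem SubOK.vshift (Ψ : VCtx) (o : Option VSTy) : SubOK vshift Ψ (Ψ.push o) :=
  ⟨fun h => .psiVar h, fun h => .psiGen h⟩

theorem SubOK.up {σ : ℕ → VS} {Ψ Ψ' : VCtx} (h : SubOK σ Ψ Ψ') (o : Option VSTy) :
    SubOK (upV σ) (Ψ.push o) (Ψ'.push o) := by
  refine ⟨fun {n U} hn => ?_, fun hs => ?_⟩
  · cases n with
    | zero => exact .psiVar hn
    | succ n => exact (h.var hn).subst (.vshift _ _) (.empty _)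
  · exact (h.gen hs).subst (.vshift Ψ' o) (.empty _)

theorem SubOK.comp {σ τ : ℕ → VS} {Ψ Ψ' Ψ'' : VCtx} (h : SubOK σ Ψ Ψ') (h' : SubOK τ Ψ' Ψ'') :
    SubOK (fun n => (σ n).subst τ) Ψ Ψ'' :=
  ⟨fun hn => (h.var hn).subst h' (.empty _), fun hs => (h.gen hs).subst h' (.empty _)⟩

theorem SubOK.of_sub {Ψ Ψ' : VCtx} (h : Ψ.Sub Ψ') : SubOK VS.var Ψ Ψ' :=
  ⟨fun hn => .psiVar (h _ _ hn), fun hs => .psiGen (h _ _ hs)⟩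

theorem SubOK.vshift₂ (Ψ : VCtx) (o o' : Option VSTy) : SubOK vshift₂ Ψ ((Ψ.push o).push o') :=
  (SubOK.vshift Ψ o).comp (.vshift _ o')

theorem SubOK.instV {Ψ : VCtx} {u : VS} {U : VSTy} (h : HasVS .empty Ψ u U) :
    SubOK (instV u) (Ψ.push (some U)) Ψ := by
  refine ⟨fun {n V} hn => ?_, fun hs => .psiGen hs⟩
  cases n with
  | zero => cases hn; exact h
  | succ n => exact .psiVar hn

theorem SubOK.instV₂ {Ψ : VCtx} {u w : VS} {U W : VSTy} (h : HasVS .empty Ψ u U)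
    (h' : HasVS .empty Ψ w W) : SubOK (instV₂ u w) ((Ψ.push (some U)).push (some W)) Ψ := by
  refine ⟨fun {n V} hn => ?_, fun hs => .psiGen hs⟩
  match n with
  | 0 => cases hn; exact h'
  | 1 => cases hn; exact h
  | n + 2 => exact .psiVar hn

/-! ### Inversion for pairs -/

/-- `HeadProd U U₁ a₁ U₂ a₂`: unfolding `U` at its head yields the product of `U₁` and `U₂`. -/
inductive HeadProd : VSTy → VSTy → Avail → VSTy → Avail → Prop
  | prod (U₁ : VSTy) (a₁ : Avail) (U₂ : VSTy) (a₂ : Avail) :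
      HeadProd (.prod U₁ a₁ U₂ a₂) U₁ a₁ U₂ a₂
  | corec {U U₁ U₂ : VSTy} {a₁ a₂ : Avail} : HeadProd U.unfold U₁ a₁ U₂ a₂ →
      HeadProd (.corec U) U₁ a₁ U₂ a₂

/-- Unfolding at the head absorbs the two `corec` rules, after which subtyping can only lose
components or act inside them. This replaces an inversion lemma for products, which transitivity
through `corec` would obstruct. -/
theorem VSub.headProd {A B : VSTy} (h : VSub A B) : ∀ {U₁ U₂ : VSTy} {a₁ a₂ : Avail},
    HeadProd A U₁ a₁ U₂ a₂ → ∃ V₁ b₁ V₂ b₂, HeadProd B V₁ b₁ V₂ b₂ ∧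
      (b₁ = .av → a₁ = .av ∧ VSub U₁ V₁) ∧ (b₂ = .av → a₂ = .av ∧ VSub U₂ V₂) := by
  induction h with
  | prodLeft =>
    rintro _ _ _ _ ⟨⟩
    exact ⟨_, _, _, _, .prod .., nofun, fun h => ⟨h, .refl _⟩⟩
  | prodRight =>
    rintro _ _ _ _ ⟨⟩
    exact ⟨_, _, _, _, .prod .., fun h => ⟨h, .refl _⟩, nofun⟩
  | prod _ _ h₁ h₂ =>
    rintro _ _ _ _ ⟨⟩
    exact ⟨_, _, _, _, .prod .., fun h => ⟨h, h₁⟩, fun h => ⟨h, h₂⟩⟩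
  | corec1 =>
    rintro _ _ _ _ ⟨⟩
    rename_i h
    exact ⟨_, _, _, _, h, fun h => ⟨h, .refl _⟩, fun h => ⟨h, .refl _⟩⟩
  | corec2 =>
    intro _ _ _ _ h
    exact ⟨_, _, _, _, .corec h, fun h => ⟨h, .refl _⟩, fun h => ⟨h, .refl _⟩⟩
  | refl =>
    intro _ _ _ _ h
    exact ⟨_, _, _, _, h, fun h => ⟨h, .refl _⟩, fun h => ⟨h, .refl _⟩⟩
  | trans _ _ ih₁ ih₂ =>
    intro _ _ _ _ h
    obtain ⟨_, _, _, _, h₁, l₁, r₁⟩ := ih₁ h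
    obtain ⟨_, _, _, _, h₂, l₂, r₂⟩ := ih₂ h₁
    exact ⟨_, _, _, _, h₂, fun h => ⟨(l₁ (l₂ h).1).1, .trans (l₁ (l₂ h).1).2 (l₂ h).2⟩,
      fun h => ⟨(r₁ (r₂ h).1).1, .trans (r₁ (r₂ h).1).2 (r₂ h).2⟩⟩

/-- The head product is carried through subsumption by `VSub.headProd`. Emptiness of the affine
context makes both parts of the split in the pair rule empty too. -/
theorem HasVS.pair_headProd {Ω Ψ : VCtx} {u : VS} {U : VSTy} (h : HasVS Ω Ψ u U) :
    Ω = .empty → ∀ {u₁ u₂ : VS}, u = .pair u₁ u₂ → ∃ U₁ a₁ U₂ a₂, HeadProd U U₁ a₁ U₂ a₂ ∧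
      (a₁ = .av → HasVS .empty Ψ u₁ U₁) ∧ (a₂ = .av → HasVS .empty Ψ u₂ U₂) := by
  induction h with
  | omegaVar | psiVar | omegaGen | psiGen | fst | snd => rintro _ _ _ ⟨⟩
  | pair hc h₁ h₂ =>
    rintro rfl _ _ ⟨⟩
    obtain ⟨rfl, rfl⟩ := hc.empty_inv
    exact ⟨_, _, _, _, .prod .., fun _ => h₁, fun _ => h₂⟩
  | onlyLeft h _ => rintro rfl _ _ ⟨⟩; exact ⟨_, _, _, _, .prod .., fun _ => h, nofun⟩
  | onlyRight _ h => rintro rfl _ _ ⟨⟩; exact ⟨_, _, _, _, .prod .., nofun, fun _ => h⟩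
  | sub _ hs ih =>
    intro hΩ _ _ hu
    obtain ⟨_, _, _, _, h, l, r⟩ := ih hΩ hu
    obtain ⟨_, _, _, _, h', l', r'⟩ := hs.headProd h
    exact ⟨_, _, _, _, h', fun h => .sub (l (l' h).1) (l' h).2,
      fun h => .sub (r (r' h).1) (r' h).2⟩

theorem HasVS.pair_left {Ψ : VCtx} {u₁ u₂ : VS} {U₁ U₂ : VSTy} {a : Avail}
    (h : HasVS .empty Ψ (.pair u₁ u₂) (.prod U₁ .av U₂ a)) : HasVS .empty Ψ u₁ U₁ := by
  obtain ⟨_, _, _, _, ⟨⟩, l, _⟩ := h.pair_headProd rfl rfl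
  exact l rfl

theorem HasVS.pair_right {Ψ : VCtx} {u₁ u₂ : VS} {U₁ U₂ : VSTy} {a : Avail}
    (h : HasVS .empty Ψ (.pair u₁ u₂) (.prod U₁ a U₂ .av)) : HasVS .empty Ψ u₂ U₂ := by
  obtain ⟨_, _, _, _, ⟨⟩, _, r⟩ := h.pair_headProd rfl rfl
  exact r rfl

/-! ### Normal forms -/

namespace VS

/-- First projection of a normal form. -/
def nfst : VS → VS
  | pair u _ => u
  | u => fst u

/-- Second projection of a normal form. -/
def nsnd : VS → VS
  | pair _ u => u
  | u => snd u

/-- The normal form of a vertex structure. -/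
def nf : VS → VS
  | var n => var n
  | gen s => gen s
  | pair u₁ u₂ => pair u₁.nf u₂.nf
  | fst u => u.nf.nfst
  | snd u => u.nf.nsnd

/-- A substitution may create new redexes but never destroys one, so normalizing beforehand makes no
difference to the final normal form. -/
theorem nf_subst (u : VS) (σ : ℕ → VS) : (u.nf.subst σ).nf = (u.subst σ).nf := by
  induction u with
  | var | gen => rfl
  | pair u₁ u₂ ih₁ ih₂ => simp only [nf, subst, ih₁, ih₂]
  | fst u ih =>
    simp only [subst, nf, ← ih]
    cases u.nf <;> rfl
  | snd u ih =>
    simp only [subst, nf, ← ih]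
    cases u.nf <;> rfl

@[simp] theorem nf_nf (u : VS) : u.nf.nf = u.nf := by
  simpa using nf_subst u VS.var

theorem nf_subst_congr {σ σ' : ℕ → VS} (h : ∀ n, (σ n).nf = (σ' n).nf) (u : VS) :
    (u.subst σ).nf = (u.subst σ').nf := by
  induction u <;> simp_all [subst, nf]

theorem nf_subst_congr' {σ σ' : ℕ → VS} (h : ∀ n, (σ n).nf = (σ' n).nf) {u u' : VS}
    (hu : u.nf = u'.nf) : (u.subst σ).nf = (u'.subst σ').nf := by
  rw [← nf_subst u, ← nf_subst u', hu]
  exact nf_subst_congr h _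

/-- Renamings of variables. -/
def IsRen (σ : ℕ → VS) : Prop := ∀ n, ∃ m, σ n = var m

theorem IsRen.vshift : IsRen vshift := fun n => ⟨n + 1, rfl⟩

theorem IsRen.vshift₂ : IsRen vshift₂ := fun n => ⟨n + 2, rfl⟩

theorem IsRen.up {σ : ℕ → VS} (h : IsRen σ) : IsRen (upV σ) := by
  rintro (_ | n)
  · exact ⟨0, rfl⟩
  · obtain ⟨m, hm⟩ := h n
    exact ⟨m + 1, by simp only [upV, hm, subst, GraphTypes.vshift]⟩

/-- No variable is replaced by a pair, so no projection becomes reducible and a second normalization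
is unnecessary. -/
theorem nf_ren {σ : ℕ → VS} (h : IsRen σ) (u : VS) : (u.subst σ).nf = u.nf.subst σ := by
  have hf (w : VS) : (w.subst σ).nfst = w.nfst.subst σ := by
    cases w with
    | var n => obtain ⟨m, hm⟩ := h n; simp only [subst, nfst, hm]
    | _ => rfl
  have hs (w : VS) : (w.subst σ).nsnd = w.nsnd.subst σ := by
    cases w with
    | var n => obtain ⟨m, hm⟩ := h n; simp only [subst, nsnd, hm]
    | _ => rfl
  induction u with
  | var n => obtain ⟨m, hm⟩ := h n; simp only [subst, nf, hm]
  | gen => rfl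
  | pair u₁ u₂ ih₁ ih₂ => simp only [nf, subst, ih₁, ih₂]
  | fst u ih => simp only [nf, subst, ih, hf]
  | snd u ih => simp only [nf, subst, ih, hs]

end VS

theorem VSEval.nf (u : VS) : VSEval u u.nf := by
  induction u with
  | var n => exact .var n
  | gen s => exact .gen s
  | pair _ _ ih₁ ih₂ => exact .pair ih₁ ih₂
  | fst u ih =>
    simp only [VS.nf]
    generalize u.nf = w at *
    cases w with
    | pair => exact .fstPair ih
    | _ => exact .fstNotPair ih nofun
  | snd u ih =>
    simp only [VS.nf]
    generalize u.nf = w at *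
    cases w with
    | pair => exact .sndPair ih
    | _ => exact .sndNotPair ih nofun

theorem VSEval.eq_nf {u p : VS} (h : VSEval u p) : p = u.nf := by
  induction h with
  | var | gen => rfl
  | pair _ _ ih₁ ih₂ => rw [ih₁, ih₂]; rfl
  | fstPair _ ih => simp only [VS.nf, ← ih]; rfl
  | @fstNotPair u u' _ hn ih =>
    simp only [VS.nf, ← ih]
    cases u' with
    | pair a b => exact (hn a b rfl).elim
    | _ => rfl
  | sndPair _ ih => simp only [VS.nf, ← ih]; rfl
  | @sndNotPair u u' _ hn ih =>
    simp only [VS.nf, ← ih]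
    cases u' with
    | pair a b => exact (hn a b rfl).elim
    | _ => rfl

theorem IsPath.nf_eq {p : VS} (h : IsPath p) : p.nf = p := by
  induction h with
  | gen => rfl
  | @fst p h ih => simp only [VS.nf, ih]; cases h <;> rfl
  | @snd p h ih => simp only [VS.nf, ih]; cases h <;> rfl

theorem IsPath.subst {p : VS} (h : IsPath p) (σ : ℕ → VS) : p.subst σ = p := by
  induction h <;> simp_all [VS.subst]

/-- The rules `fstPair` and `sndPair` of equivalence already allow for an equivalent pair under the
projection, which is exactly what the recursive call on the normal form provides. -/
theorem HasVS.eq_nf {Ω Ψ : VCtx} {u : VS} {U : VSTy} (h : HasVS Ω Ψ u U) :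
    Ω = .empty → VSEq Ψ u u.nf U := by
  induction h with
  | omegaVar h => rintro rfl; cases h
  | psiVar h => rintro rfl; exact .refl (.psiVar h)
  | omegaGen h => rintro rfl; cases h
  | psiGen h => rintro rfl; exact .refl (.psiGen h)
  | pair hc _ _ ih₁ ih₂ =>
    rintro rfl
    obtain ⟨rfl, rfl⟩ := hc.empty_inv
    exact .pair (ih₁ rfl) (ih₂ rfl)
  | onlyLeft _ _ ih₁ ih₂ => intro h; exact .onlyLeft (ih₁ h) (ih₂ rfl)
  | onlyRight _ _ ih₁ ih₂ => intro h; exact .onlyRight (ih₁ rfl) (ih₂ h)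
  | @fst _ _ u _ _ _ _ ih =>
    intro h
    have := ih h
    simp only [VS.nf]
    generalize u.nf = w at *
    cases w with
    | pair => exact .fstPair this
    | _ => exact .fst this
  | @snd _ _ u _ _ _ _ ih =>
    intro h
    have := ih h
    simp only [VS.nf]
    generalize u.nf = w at *
    cases w with
    | pair => exact .sndPair this
    | _ => exact .snd this
  | sub _ hs ih => intro h; exact .sub (ih h) hs

/-- Each rule preserves typing and normal forms. The beta rules are the only ones that need
inversion of a typed pair. -/
theorem VSEq.inv {Ψ : VCtx} {u u' : VS} {U : VSTy} (h : VSEq Ψ u u' U) :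
    HasVS .empty Ψ u U ∧ HasVS .empty Ψ u' U ∧ u.nf = u'.nf := by
  induction h with
  | refl h => exact ⟨h, h, rfl⟩
  | comm _ ih => exact ⟨ih.2.1, ih.1, ih.2.2.symm⟩
  | trans _ _ ih₁ ih₂ => exact ⟨ih₁.1, ih₂.2.1, ih₁.2.2.trans ih₂.2.2⟩
  | onlyLeft _ _ ih₁ ih₂ =>
    exact ⟨.left _ _ ih₁.1, .left _ _ ih₁.2.1, by simp only [VS.nf, ih₁.2.2, ih₂.2.2]⟩
  | onlyRight _ _ ih₁ ih₂ =>
    exact ⟨.right _ _ ih₂.1, .right _ _ ih₂.2.1, by simp only [VS.nf, ih₁.2.2, ih₂.2.2]⟩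
  | pair _ _ ih₁ ih₂ =>
    exact ⟨.pair (.empty_left _) ih₁.1 ih₂.1, .pair (.empty_left _) ih₁.2.1 ih₂.2.1,
      by simp only [VS.nf, ih₁.2.2, ih₂.2.2]⟩
  | fst _ ih => exact ⟨.fst ih.1, .fst ih.2.1, by simp only [VS.nf, ih.2.2]⟩
  | snd _ ih => exact ⟨.snd ih.1, .snd ih.2.1, by simp only [VS.nf, ih.2.2]⟩
  | fstPair _ ih => exact ⟨.fst ih.1, ih.2.1.pair_left, by simp only [VS.nf, ih.2.2, VS.nfst]⟩
  | sndPair _ ih => exact ⟨.snd ih.1, ih.2.1.pair_right, by simp only [VS.nf, ih.2.2, VS.nsnd]⟩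
  | sub _ hs ih => exact ⟨.sub ih.1 hs, .sub ih.2.1 hs, ih.2.2⟩

/-- VS equivalence is equality of normal forms of well-typed vertex structures. -/
theorem VSEq.of_nf {Ψ : VCtx} {u u' : VS} {U : VSTy} (h : HasVS .empty Ψ u U)
    (h' : HasVS .empty Ψ u' U) (hn : u.nf = u'.nf) : VSEq Ψ u u' U :=
  .trans (h.eq_nf rfl) (.comm (hn ▸ h'.eq_nf rfl))

theorem VSEq.subst {Ψ Ψ' : VCtx} {σ σ' : ℕ → VS} {u u' : VS} {U : VSTy} (h : VSEq Ψ u u' U)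
    (hσ : SubOK σ Ψ Ψ') (hσ' : SubOK σ' Ψ Ψ') (hn : ∀ n, (σ n).nf = (σ' n).nf) :
    VSEq Ψ' (u.subst σ) (u'.subst σ') U :=
  .of_nf (h.inv.1.subst hσ (.empty _)) (h.inv.2.1.subst hσ' (.empty _))
    (VS.nf_subst_congr' hn h.inv.2.2)

/-! ## Graph type formation -/

theorem DagWF.mono {Δ : List GKind} {Ω Ψ : VCtx} {G : GTy} {K : GKind} (h : DagWF Δ Ω Ψ G K) :
    ∀ {Ω' : VCtx}, Ω.Sub Ω' → DagWF Δ Ω' Ψ G K := by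
  induction h with
  | emp => intro _ _; exact .emp
  | gvar h => intro _ _; exact .gvar h
  | seq hc _ _ ih₁ ih₂ =>
    intro _ hs
    obtain ⟨_, hc', hs'⟩ := hc.extend hs
    exact .seq hc' (ih₁ hs') (ih₂ (.refl _))
  | or _ _ ih₁ ih₂ => intro _ hs; exact .or (ih₁ hs) (ih₂ hs)
  | spawn hc _ hu ih =>
    intro _ hs
    obtain ⟨_, hc', hs'⟩ := hc.extend hs
    exact .spawn hc' (ih hs') hu
  | touch h => intro _ _; exact .touch h
  | new _ ih => intro _ hs; exact .new (ih (hs.push _))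
  | pi _ ih => intro _ hs; exact .pi (ih ((hs.push _).push _))
  | recPi h => intro _ _; exact .recPi h
  | app hc _ huf huf' hut ih =>
    intro _ hs
    obtain ⟨_, hc', hs'⟩ := hc.extend hs
    exact .app hc' (ih hs') huf huf' hut

theorem SubOK.empty (σ : ℕ → VS) (Ψ : VCtx) : SubOK σ .empty Ψ :=
  ⟨fun h => (nomatch h), fun h => (nomatch h)⟩

theorem DagWF.vsubst {Δ : List GKind} {Ω Ψ : VCtx} {G : GTy} {K : GKind}
    (h : DagWF Δ Ω Ψ G K) : ∀ {Ψ' : VCtx} {σ : ℕ → VS}, SubOK σ Ψ Ψ' → FixOn σ Ω →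
      DagWF Δ Ω Ψ' (G.vsubst σ) K := by
  induction h with
  | emp => intro _ _ _ _; exact .emp
  | gvar h => intro _ _ _ _; exact .gvar h
  | seq hc _ _ ih₁ ih₂ =>
    intro _ _ hσ hΩ
    exact .seq hc (ih₁ hσ (hΩ.left hc)) (ih₂ hσ (hΩ.right hc))
  | or _ _ ih₁ ih₂ => intro _ _ hσ hΩ; exact .or (ih₁ hσ hΩ) (ih₂ hσ hΩ)
  | spawn hc _ hu ih =>
    intro _ _ hσ hΩ
    -- End vertices are typed without an unrestricted context, so any substitution that fixes the
    -- affine variables is admissible for them.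
    exact .spawn hc (ih hσ (hΩ.left hc)) (hu.subst (.empty _ _) (hΩ.right hc))
  | touch h => intro _ _ hσ _; exact .touch (h.subst hσ (.empty _))
  | new _ ih => intro _ _ hσ hΩ; exact .new (ih (hσ.up _) (hΩ.push _))
  | pi _ ih =>
    intro _ _ hσ hΩ
    exact .pi (ih ((hσ.up _).up _) ((hΩ.push _).push _))
  | recPi _ ih =>
    intro _ σ hσ hΩ
    exact .recPi (ih ((hσ.up _).up _) (((FixOn.empty σ).push _).push _))
  | app hc _ huf huf' hut ih =>
    intro _ _ hσ hΩ
    exact .app hc (ih hσ (hΩ.left hc)) (huf.subst (.empty _ _) (hΩ.right hc))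
      (huf'.subst hσ (.empty _)) (hut.subst hσ (.empty _))

theorem DagWF.grename {Δ : List GKind} {Ω Ψ : VCtx} {G : GTy} {K : GKind}
    (h : DagWF Δ Ω Ψ G K) : ∀ {Δ' : List GKind} {ρ : ℕ → ℕ},
      (∀ n K, Δ[n]? = some K → Δ'[ρ n]? = some K) → DagWF Δ' Ω Ψ (G.grename ρ) K := by
  induction h with
  | emp => intro _ _ _; exact .emp
  | gvar h => intro _ _ hρ; exact .gvar (hρ _ _ h)
  | seq hc _ _ ih₁ ih₂ => intro _ _ hρ; exact .seq hc (ih₁ hρ) (ih₂ hρ)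
  | or _ _ ih₁ ih₂ => intro _ _ hρ; exact .or (ih₁ hρ) (ih₂ hρ)
  | spawn hc _ hu ih => intro _ _ hρ; exact .spawn hc (ih hρ) hu
  | touch h => intro _ _ _; exact .touch h
  | new _ ih => intro _ _ hρ; exact .new (ih hρ)
  | pi _ ih => intro _ _ hρ; exact .pi (ih hρ)
  | recPi _ ih =>
    intro _ _ hρ
    refine .recPi (ih ?_)
    rintro (_ | n) K hn
    · exact hn
    · exact hρ n K hn
  | app hc _ huf huf' hut ih => intro _ _ hρ; exact .app hc (ih hρ) huf huf' hut

/-- The substitution `ξ` of graph types maps `Δ` to `Δ'`. -/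
def GSubOK (ξ : ℕ → GTy) (Δ Δ' : List GKind) (Ψ : VCtx) : Prop :=
  ∀ n K, Δ[n]? = some K → DagWF Δ' .empty Ψ (ξ n) K

theorem GSubOK.vsubst {ξ : ℕ → GTy} {Δ Δ' : List GKind} {Ψ Ψ' : VCtx} {σ : ℕ → VS}
    (h : GSubOK ξ Δ Δ' Ψ) (hσ : SubOK σ Ψ Ψ') : GSubOK (fun n => (ξ n).vsubst σ) Δ Δ' Ψ' :=
  fun n K hn => (h n K hn).vsubst hσ (.empty _)

theorem GSubOK.push {ξ : ℕ → GTy} {Δ Δ' : List GKind} {Ψ : VCtx} (h : GSubOK ξ Δ Δ' Ψ)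
    (o : Option VSTy) : GSubOK (fun n => (ξ n).vsubst vshift) Δ Δ' (Ψ.push o) :=
  h.vsubst (.vshift _ _)

theorem GSubOK.push₂ {ξ : ℕ → GTy} {Δ Δ' : List GKind} {Ψ : VCtx} (h : GSubOK ξ Δ Δ' Ψ)
    (o o' : Option VSTy) :
    GSubOK (fun n => (ξ n).vsubst vshift₂) Δ Δ' ((Ψ.push o).push o') :=
  h.vsubst (.vshift₂ _ _ _)

theorem DagWF.weaken {Δ : List GKind} {Ω Ψ : VCtx} {G : GTy} {K : GKind}
    (h : DagWF Δ Ω Ψ G K) (K' : GKind) : DagWF (K' :: Δ) Ω Ψ (G.grename Nat.succ) K :=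
  h.grename fun _ _ hn => hn

theorem GSubOK.up {ξ : ℕ → GTy} {Δ Δ' : List GKind} {Ψ : VCtx} (h : GSubOK ξ Δ Δ' Ψ)
    (K : GKind) : GSubOK (GTy.upG ξ) (K :: Δ) (K :: Δ') Ψ := by
  rintro (_ | n) K' hn
  · exact .gvar hn
  · exact (h n K' hn).weaken K

theorem GSubOK.instG {M : GTy} {K : GKind} {Δ : List GKind} {Ψ : VCtx}
    (h : DagWF Δ .empty Ψ M K) : GSubOK (GTy.instG M) (K :: Δ) Δ Ψ := by
  rintro (_ | n) K' hn
  · cases hn; exact h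
  · exact .gvar hn

theorem GSubOK.gvar {ρ : ℕ → ℕ} {Δ Δ' : List GKind} (h : ∀ n K, Δ[n]? = some K → Δ'[ρ n]? = some K)
    (Ψ : VCtx) : GSubOK (fun n => .gvar (ρ n)) Δ Δ' Ψ := fun n K hn => .gvar (h n K hn)

/-- The graph types substituted consume no affine entries (`GSubOK` has an empty affine context),
hence they may occur any number of times and fit every part of a split. -/
theorem DagWF.gsubst {Δ : List GKind} {Ω Ψ : VCtx} {G : GTy} {K : GKind}
    (h : DagWF Δ Ω Ψ G K) : ∀ {Δ' : List GKind} {ξ : ℕ → GTy},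
      GSubOK ξ Δ Δ' Ψ → DagWF Δ' Ω Ψ (G.gsubst ξ) K := by
  induction h with
  | emp => intro _ _ _; exact .emp
  | gvar h => intro _ _ hξ; exact (hξ _ _ h).mono (.empty _)
  | seq hc _ _ ih₁ ih₂ => intro _ _ hξ; exact .seq hc (ih₁ hξ) (ih₂ hξ)
  | or _ _ ih₁ ih₂ => intro _ _ hξ; exact .or (ih₁ hξ) (ih₂ hξ)
  | spawn hc _ hu ih => intro _ _ hξ; exact .spawn hc (ih hξ) hu
  | touch h => intro _ _ _; exact .touch h
  | new _ ih => intro _ _ hξ; exact .new (ih (hξ.push _))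
  | pi _ ih => intro _ _ hξ; exact .pi (ih (hξ.push₂ _ _))
  | recPi _ ih => intro _ _ hξ; exact .recPi (ih ((hξ.up _).push₂ _ _))
  | app hc _ huf huf' hut ih => intro _ _ hξ; exact .app hc (ih hξ) huf huf' hut

/-! ### The identification of graph types -/

theorem GEq.vsubst {G G' : GTy} (h : GEq G G') : ∀ σ : ℕ → VS, GEq (G.vsubst σ) (G'.vsubst σ) := by
  induction h with
  | unit => intro σ; exact .unit
  | refl G => intro σ; exact .refl _
  | symm _ ih => intro σ; exact .symm (ih σ)
  | trans _ _ ih₁ ih₂ => intro σ; exact .trans (ih₁ σ) (ih₂ σ)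
  | seq _ _ ih₁ ih₂ => intro σ; exact .seq (ih₁ σ) (ih₂ σ)
  | or _ _ ih₁ ih₂ => intro σ; exact .or (ih₁ σ) (ih₂ σ)
  | mu _ ih => intro σ; exact .mu (ih σ)
  | spawn u _ ih => intro σ; exact .spawn _ (ih σ)
  | pi _ _ _ ih => intro σ; exact .pi _ _ (ih _)
  | app _ _ _ ih => intro σ; exact .app _ _ (ih σ)
  | new _ _ ih => intro σ; exact .new _ (ih _)

theorem GEq.gsubst {G G' : GTy} (h : GEq G G') :
    ∀ ξ : ℕ → GTy, GEq (G.gsubst ξ) (G'.gsubst ξ) := by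
  induction h with
  | unit => intro σ; exact .unit
  | refl G => intro σ; exact .refl _
  | symm _ ih => intro σ; exact .symm (ih σ)
  | trans _ _ ih₁ ih₂ => intro σ; exact .trans (ih₁ σ) (ih₂ σ)
  | seq _ _ ih₁ ih₂ => intro σ; exact .seq (ih₁ σ) (ih₂ σ)
  | or _ _ ih₁ ih₂ => intro σ; exact .or (ih₁ σ) (ih₂ σ)
  | mu _ ih => intro σ; exact .mu (ih _)
  | spawn u _ ih => intro σ; exact .spawn _ (ih σ)
  | pi _ _ _ ih => intro σ; exact .pi _ _ (ih _)
  | app _ _ _ ih => intro σ; exact .app _ _ (ih σ)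
  | new _ _ ih => intro σ; exact .new _ (ih _)

/-- Whether a graph type is a function of vertex structures. -/
def GTy.isPi : GTy → Bool
  | .pi _ _ _ => true
  | _ => false

theorem GEq.isPi_eq {G G' : GTy} (h : GEq G G') : G.isPi = G'.isPi := by
  induction h <;> simp_all [GTy.isPi]

/-- The kinding rule for recursion looks through `mu` at the `pi` below, which an induction on `GEq`
cannot follow. Here the two layers are separated, with the shape of the body as a condition that
`GEq` preserves. -/
theorem DagWF.mu_iff {Δ : List GKind} {Ω Ψ : VCtx} {G : GTy} {K : GKind} :
    DagWF Δ Ω Ψ (.mu G) K ↔ G.isPi ∧ DagWF (K :: Δ) .empty Ψ G K := by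
  constructor
  · intro h
    cases h with
    | recPi h => exact ⟨rfl, .pi h⟩
  · rintro ⟨hp, h⟩
    cases h with
    | pi h => exact .recPi h
    | _ => simp [GTy.isPi] at hp

theorem GEq.dagWF_iff {G G' : GTy} (h : GEq G G') : ∀ {Δ : List GKind} {Ω Ψ : VCtx} {K : GKind},
    DagWF Δ Ω Ψ G K ↔ DagWF Δ Ω Ψ G' K := by
  induction h with
  | unit =>
    intro Δ Ω Ψ K
    constructor
    · intro h; cases h; exact .emp
    · intro h; cases h; exact .seq (.empty_left _) .emp .emp
  | refl G => intros; exact Iff.rfl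
  | symm _ ih => intros; exact ih.symm
  | trans _ _ ih₁ ih₂ => intros; exact ih₁.trans ih₂
  | seq _ _ ih₁ ih₂ =>
    intro Δ Ω Ψ K
    constructor
    · intro h
      cases h with
      | seq hc h₁ h₂ => exact .seq hc (ih₁.1 h₁) (ih₂.1 h₂)
    · intro h
      cases h with
      | seq hc h₁ h₂ => exact .seq hc (ih₁.2 h₁) (ih₂.2 h₂)
  | or _ _ ih₁ ih₂ =>
    intro Δ Ω Ψ K
    constructor
    · intro h
      cases h with
      | or h₁ h₂ => exact .or (ih₁.1 h₁) (ih₂.1 h₂)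
    · intro h
      cases h with
      | or h₁ h₂ => exact .or (ih₁.2 h₁) (ih₂.2 h₂)
  | mu h ih => intro Δ Ω Ψ K; rw [DagWF.mu_iff, DagWF.mu_iff, h.isPi_eq, ih]
  | spawn u _ ih =>
    intro Δ Ω Ψ K
    constructor
    · intro h
      cases h with
      | spawn hc h hu => exact .spawn hc (ih.1 h) hu
    · intro h
      cases h with
      | spawn hc h hu => exact .spawn hc (ih.2 h) hu
  | pi _ _ _ ih =>
    intro Δ Ω Ψ K
    constructor
    · intro h
      cases h with
      | pi h => exact .pi (ih.1 h)
    · intro h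
      cases h with
      | pi h => exact .pi (ih.2 h)
  | app _ _ _ ih =>
    intro Δ Ω Ψ K
    constructor
    · intro h
      cases h with
      | app hc h h₁ h₂ h₃ => exact .app hc (ih.1 h) h₁ h₂ h₃
    · intro h
      cases h with
      | app hc h h₁ h₂ h₃ => exact .app hc (ih.2 h) h₁ h₂ h₃
  | new _ _ ih =>
    intro Δ Ω Ψ K
    constructor
    · intro h
      cases h with
      | new h => exact .new (ih.1 h)
    · intro h
      cases h with
      | new h => exact .new (ih.2 h)

/-! ## Kinding -/

theorem HasKind.vsubst {Δ : List GKind} {Ψ : VCtx} {Θ : List Kind} {c : Con} {k : Kind}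
    (h : HasKind Δ Ψ Θ c k) : ∀ {Ψ' : VCtx} {σ : ℕ → VS}, SubOK σ Ψ Ψ' →
      HasKind Δ Ψ' Θ (c.vsubst σ) k := by
  induction h with
  | unit => intro _ _ _; exact .unit
  | cvar h => intro _ _ _; exact .cvar h
  | fn _ _ hG ih₁ ih₂ =>
    intro _ _ hσ
    simp only [Con.vsubst, arrowAnn_vsubst]
    exact .fn (ih₁ ((hσ.up _).up _)) (ih₂ ((hσ.up _).up _)) (hG.vsubst hσ (.empty _))
  | sum _ _ ih₁ ih₂ => intro _ _ hσ; exact .sum (ih₁ hσ) (ih₂ hσ)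
  | prod _ _ ih₁ ih₂ => intro _ _ hσ; exact .prod (ih₁ hσ) (ih₂ hσ)
  | fut _ hu ih => intro _ _ hσ; exact .fut (ih hσ) (hu.subst hσ (.empty _))
  | recty _ hu ih => intro _ _ hσ; exact .recty (ih (hσ.up _)) (hu.subst hσ (.empty _))
  | lam _ ih => intro _ _ hσ; exact .lam (ih (hσ.up _))
  | app _ hu ih => intro _ _ hσ; exact .app (ih hσ) (hu.subst hσ (.empty _))

theorem HasKind.gsubst {Δ : List GKind} {Ψ : VCtx} {Θ : List Kind} {c : Con} {k : Kind}
    (h : HasKind Δ Ψ Θ c k) : ∀ {Δ' : List GKind} {ξ : ℕ → GTy}, GSubOK ξ Δ Δ' Ψ →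
      HasKind Δ' Ψ Θ (c.gsubst ξ) k := by
  induction h with
  | unit => intro _ _ _; exact .unit
  | cvar h => intro _ _ _; exact .cvar h
  | fn _ _ hG ih₁ ih₂ =>
    intro _ _ hξ
    simp only [Con.gsubst, arrowAnn_gsubst]
    exact .fn (ih₁ (hξ.push₂ _ _)) (ih₂ (hξ.push₂ _ _)) (hG.gsubst hξ)
  | sum _ _ ih₁ ih₂ => intro _ _ hξ; exact .sum (ih₁ hξ) (ih₂ hξ)
  | prod _ _ ih₁ ih₂ => intro _ _ hξ; exact .prod (ih₁ hξ) (ih₂ hξ)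
  | fut _ hu ih => intro _ _ hξ; exact .fut (ih hξ) hu
  | recty _ hu ih => intro _ _ hξ; exact .recty (ih (hξ.push _)) hu
  | lam _ ih => intro _ _ hξ; exact .lam (ih (hξ.push _))
  | app _ hu ih => intro _ _ hξ; exact .app (ih hξ) hu

theorem HasKind.weaken {Δ : List GKind} {Ψ : VCtx} {Θ : List Kind} {c : Con} {k : Kind}
    (h : HasKind Δ Ψ Θ c k) (K : GKind) : HasKind (K :: Δ) Ψ Θ (c.grename Nat.succ) k := by
  rw [Con.grename_eq]
  exact h.gsubst (.gvar (ρ := Nat.succ) (fun _ _ hn => hn) _)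

theorem HasKind.crename {Δ : List GKind} {Ψ : VCtx} {Θ : List Kind} {c : Con} {k : Kind}
    (h : HasKind Δ Ψ Θ c k) : ∀ {Θ' : List Kind} {ρ : ℕ → ℕ},
      (∀ n k, Θ[n]? = some k → Θ'[ρ n]? = some k) → HasKind Δ Ψ Θ' (c.crename ρ) k := by
  induction h with
  | unit => intro _ _ _; exact .unit
  | cvar h => intro _ _ hρ; exact .cvar (hρ _ _ h)
  | fn _ _ hG ih₁ ih₂ => intro _ _ hρ; exact .fn (ih₁ hρ) (ih₂ hρ) hG
  | sum _ _ ih₁ ih₂ => intro _ _ hρ; exact .sum (ih₁ hρ) (ih₂ hρ)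
  | prod _ _ ih₁ ih₂ => intro _ _ hρ; exact .prod (ih₁ hρ) (ih₂ hρ)
  | fut _ hu ih => intro _ _ hρ; exact .fut (ih hρ) hu
  | recty _ hu ih =>
    intro _ _ hρ
    refine .recty (ih ?_) hu
    rintro (_ | n) k hn
    · exact hn
    · exact hρ n k hn
  | lam _ ih => intro _ _ hρ; exact .lam (ih hρ)
  | app _ hu ih => intro _ _ hρ; exact .app (ih hρ) hu

/-! ### Substitution of type constructors -/

/-- The substitution `χ` of type constructors maps `Θ` to `Θ'`. -/
def CSubOK (Δ : List GKind) (Ψ : VCtx) (χ : ℕ → Con) (Θ Θ' : List Kind) : Prop :=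
  ∀ n k, Θ[n]? = some k → HasKind Δ Ψ Θ' (χ n) k

theorem CSubOK.vsubst {Δ : List GKind} {Ψ Ψ' : VCtx} {χ : ℕ → Con} {Θ Θ' : List Kind}
    {σ : ℕ → VS} (h : CSubOK Δ Ψ χ Θ Θ') (hσ : SubOK σ Ψ Ψ') :
    CSubOK Δ Ψ' (fun n => (χ n).vsubst σ) Θ Θ' := fun n k hn => (h n k hn).vsubst hσ

theorem CSubOK.up {Δ : List GKind} {Ψ : VCtx} {χ : ℕ → Con} {Θ Θ' : List Kind}
    (h : CSubOK Δ Ψ χ Θ Θ') (k : Kind) : CSubOK Δ Ψ (Con.upC χ) (k :: Θ) (k :: Θ') := by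
  rintro (_ | n) k' hn
  · exact .cvar hn
  · exact (h n k' hn).crename fun _ _ hn => hn

theorem HasKind.csubst {Δ : List GKind} {Ψ : VCtx} {Θ : List Kind} {c : Con} {k : Kind}
    (h : HasKind Δ Ψ Θ c k) : ∀ {Θ' : List Kind} {χ : ℕ → Con}, CSubOK Δ Ψ χ Θ Θ' →
      HasKind Δ Ψ Θ' (c.csubst χ) k := by
  induction h with
  | unit => intro _ _ _; exact .unit
  | cvar h => intro _ _ hχ; exact hχ _ _ h
  | fn _ _ hG ih₁ ih₂ =>
    intro _ _ hχ
    exact .fn (ih₁ (hχ.vsubst (.vshift₂ _ _ _))) (ih₂ (hχ.vsubst (.vshift₂ _ _ _))) hG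
  | sum _ _ ih₁ ih₂ => intro _ _ hχ; exact .sum (ih₁ hχ) (ih₂ hχ)
  | prod _ _ ih₁ ih₂ => intro _ _ hχ; exact .prod (ih₁ hχ) (ih₂ hχ)
  | fut _ hu ih => intro _ _ hχ; exact .fut (ih hχ) hu
  | recty _ hu ih => intro _ _ hχ; exact .recty (ih ((hχ.vsubst (.vshift _ _)).up _)) hu
  | lam _ ih => intro _ _ hχ; exact .lam (ih (hχ.vsubst (.vshift _ _)))
  | app _ hu ih => intro _ _ hχ; exact .app (ih hχ) hu

theorem HasKind.fn_inv {Δ : List GKind} {Ψ : VCtx} {Θ : List Kind} {Uf Ut : VSTy} {c₁ c₂ : Con}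
    {G : GTy} {k : Kind} (h : HasKind Δ Ψ Θ (.fn Uf Ut c₁ c₂ (arrowAnn G)) k) :
    HasKind Δ ((Ψ.push (some Uf)).push (some Ut)) Θ c₁ .ty ∧
    HasKind Δ ((Ψ.push (some Uf)).push (some Ut)) Θ c₂ .ty ∧
    DagWF Δ .empty Ψ G (.pi Uf Ut .graph) := by
  generalize hc : Con.fn Uf Ut c₁ c₂ (arrowAnn G) = c at h
  cases h with
  | fn h₁ h₂ h₃ =>
    simp only [Con.fn.injEq] at hc
    obtain ⟨rfl, rfl, rfl, rfl, hG⟩ := hc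
    rw [arrowAnn_injective hG]
    exact ⟨h₁, h₂, h₃⟩
  | _ => cases hc

theorem CSubOK.instC {Δ : List GKind} {Ψ : VCtx} {U : VSTy} {c : Con} {Θ : List Kind}
    (h : HasKind Δ (Ψ.push (some U)) (.arr U :: Θ) c .ty) :
    CSubOK Δ Ψ (Con.instC (.lam U (.recty U (c.vsubst (upV vshift)) (.var 0))))
      (.arr U :: Θ) Θ := by
  rintro (_ | n) k hn
  · cases hn
    exact .lam (.recty (h.vsubst ((SubOK.vshift _ _).up _)) (.psiVar rfl))
  · exact .cvar hn

theorem HasKind.unroll {Δ : List GKind} {Ψ : VCtx} {Θ : List Kind} {U : VSTy} {c : Con} {u : VS}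
    {k : Kind} (h : HasKind Δ Ψ Θ (.recty U c u) k) : HasKind Δ Ψ Θ (Con.unroll U c u) .ty := by
  cases h with
  | recty h hu => exact (h.vsubst (.instV hu)).csubst (.instC h)

/-! ## Equivalence of type constructors -/

theorem ConEq.hasKind {Δ : List GKind} {Ψ : VCtx} {Θ : List Kind} {c c' : Con} {k : Kind}
    (h : ConEq Δ Ψ Θ c c' k) : HasKind Δ Ψ Θ c k ∧ HasKind Δ Ψ Θ c' k := by
  induction h with
  | refl h => exact ⟨h, h⟩
  | comm _ ih => exact ih.symm
  | trans _ _ ih₁ ih₂ => exact ⟨ih₁.1, ih₂.2⟩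
  | prod _ _ ih₁ ih₂ => exact ⟨.prod ih₁.1 ih₂.1, .prod ih₁.2 ih₂.2⟩
  | sum _ _ ih₁ ih₂ => exact ⟨.sum ih₁.1 ih₂.1, .sum ih₁.2 ih₂.2⟩
  | fut _ hu ih => exact ⟨.fut ih.1 hu.inv.1, .fut ih.2 hu.inv.2.1⟩
  | lam _ ih => exact ⟨.lam ih.1, .lam ih.2⟩
  | app _ hu ih => exact ⟨.app ih.1 hu.inv.1, .app ih.2 hu.inv.2.1⟩
  | beta h hu => exact ⟨.app (.lam h) hu, h.vsubst (.instV hu)⟩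
  | recty _ hu ih => exact ⟨.recty ih.1 hu.inv.1, .recty ih.2 hu.inv.2.1⟩
  | fn _ _ hG hGG ih₁ ih₂ =>
    exact ⟨.fn ih₁.1 ih₂.1 hG, .fn ih₁.2 ih₂.2 (hGG.dagWF_iff.1 hG)⟩

theorem ConEq.vsubst {Δ : List GKind} {Ψ : VCtx} {Θ : List Kind} {c c' : Con} {k : Kind}
    (h : ConEq Δ Ψ Θ c c' k) : ∀ {Ψ' : VCtx} {σ : ℕ → VS}, SubOK σ Ψ Ψ' →
      ConEq Δ Ψ' Θ (c.vsubst σ) (c'.vsubst σ) k := by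
  induction h with
  | refl h => intro _ _ hσ; exact .refl (h.vsubst hσ)
  | comm _ ih => intro _ _ hσ; exact .comm (ih hσ)
  | trans _ _ ih₁ ih₂ => intro _ _ hσ; exact .trans (ih₁ hσ) (ih₂ hσ)
  | prod _ _ ih₁ ih₂ => intro _ _ hσ; exact .prod (ih₁ hσ) (ih₂ hσ)
  | sum _ _ ih₁ ih₂ => intro _ _ hσ; exact .sum (ih₁ hσ) (ih₂ hσ)
  | fut _ hu ih => intro _ _ hσ; exact .fut (ih hσ) (hu.subst hσ hσ fun _ => rfl)
  | lam _ ih => intro _ _ hσ; exact .lam (ih (hσ.up _))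
  | app _ hu ih => intro _ _ hσ; exact .app (ih hσ) (hu.subst hσ hσ fun _ => rfl)
  | beta h hu =>
    intro _ _ hσ
    rw [Con.vsubst_instV]
    exact .beta (h.vsubst (hσ.up _)) (hu.subst hσ (.empty _))
  | recty _ hu ih => intro _ _ hσ; exact .recty (ih (hσ.up _)) (hu.subst hσ hσ fun _ => rfl)
  | fn _ _ hG hGG ih₁ ih₂ =>
    intro _ _ hσ
    simp only [Con.vsubst, arrowAnn_vsubst]
    exact .fn (ih₁ ((hσ.up _).up _)) (ih₂ ((hσ.up _).up _)) (hG.vsubst hσ (.empty _))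
      (hGG.vsubst _)

theorem ConEq.gsubst {Δ : List GKind} {Ψ : VCtx} {Θ : List Kind} {c c' : Con} {k : Kind}
    (h : ConEq Δ Ψ Θ c c' k) : ∀ {Δ' : List GKind} {ξ : ℕ → GTy}, GSubOK ξ Δ Δ' Ψ →
      ConEq Δ' Ψ Θ (c.gsubst ξ) (c'.gsubst ξ) k := by
  induction h with
  | refl h => intro _ _ hξ; exact .refl (h.gsubst hξ)
  | comm _ ih => intro _ _ hξ; exact .comm (ih hξ)
  | trans _ _ ih₁ ih₂ => intro _ _ hξ; exact .trans (ih₁ hξ) (ih₂ hξ)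
  | prod _ _ ih₁ ih₂ => intro _ _ hξ; exact .prod (ih₁ hξ) (ih₂ hξ)
  | sum _ _ ih₁ ih₂ => intro _ _ hξ; exact .sum (ih₁ hξ) (ih₂ hξ)
  | fut _ hu ih => intro _ _ hξ; exact .fut (ih hξ) hu
  | lam _ ih => intro _ _ hξ; exact .lam (ih (hξ.push _))
  | app _ hu ih => intro _ _ hξ; exact .app (ih hξ) hu
  | beta h hu =>
    intro _ ξ hξ
    have := ConEq.beta (h.gsubst (hξ.push _)) hu
    rw [Con.gsubst_vsubst] at this
    simp only [GTy.vshift_instV] at this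
    exact this
  | recty _ hu ih => intro _ _ hξ; exact .recty (ih (hξ.push _)) hu
  | fn _ _ hG hGG ih₁ ih₂ =>
    intro _ _ hξ
    simp only [Con.gsubst, arrowAnn_gsubst]
    exact .fn (ih₁ (hξ.push₂ _ _)) (ih₂ (hξ.push₂ _ _)) (hG.gsubst hξ) (hGG.gsubst _)

theorem Con.crename_vsubst_instV (c : Con) (u : VS) (ρ : ℕ → ℕ) :
    (c.vsubst (instV u)).crename ρ = (c.crename ρ).vsubst (instV u) :=
  (Con.crename_vsubst ..).symm

theorem ConEq.crename {Δ : List GKind} {Ψ : VCtx} {Θ : List Kind} {c c' : Con} {k : Kind}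
    (h : ConEq Δ Ψ Θ c c' k) : ∀ {Θ' : List Kind} {ρ : ℕ → ℕ},
      (∀ n k, Θ[n]? = some k → Θ'[ρ n]? = some k) →
      ConEq Δ Ψ Θ' (c.crename ρ) (c'.crename ρ) k := by
  induction h with
  | refl h => intro _ _ hρ; exact .refl (h.crename hρ)
  | comm _ ih => intro _ _ hρ; exact .comm (ih hρ)
  | trans _ _ ih₁ ih₂ => intro _ _ hρ; exact .trans (ih₁ hρ) (ih₂ hρ)
  | prod _ _ ih₁ ih₂ => intro _ _ hρ; exact .prod (ih₁ hρ) (ih₂ hρ)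
  | sum _ _ ih₁ ih₂ => intro _ _ hρ; exact .sum (ih₁ hρ) (ih₂ hρ)
  | fut _ hu ih => intro _ _ hρ; exact .fut (ih hρ) hu
  | lam _ ih => intro _ _ hρ; exact .lam (ih hρ)
  | app _ hu ih => intro _ _ hρ; exact .app (ih hρ) hu
  | beta h hu =>
    intro _ _ hρ
    rw [Con.crename_vsubst_instV]
    exact .beta (h.crename hρ) hu
  | recty _ hu ih =>
    intro _ _ hρ
    refine .recty (ih ?_) hu
    rintro (_ | n) k hn
    · exact hn
    · exact hρ n k hn
  | fn _ _ hG hGG ih₁ ih₂ => intro _ _ hρ; exact .fn (ih₁ hρ) (ih₂ hρ) hG hGG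

theorem ConEq.csubst {Δ : List GKind} {Ψ : VCtx} {Θ : List Kind} {c c' : Con} {k : Kind}
    (h : ConEq Δ Ψ Θ c c' k) : ∀ {Θ' : List Kind} {χ : ℕ → Con}, CSubOK Δ Ψ χ Θ Θ' →
      ConEq Δ Ψ Θ' (c.csubst χ) (c'.csubst χ) k := by
  induction h with
  | refl h => intro _ _ hχ; exact .refl (h.csubst hχ)
  | comm _ ih => intro _ _ hχ; exact .comm (ih hχ)
  | trans _ _ ih₁ ih₂ => intro _ _ hχ; exact .trans (ih₁ hχ) (ih₂ hχ)
  | prod _ _ ih₁ ih₂ => intro _ _ hχ; exact .prod (ih₁ hχ) (ih₂ hχ)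
  | sum _ _ ih₁ ih₂ => intro _ _ hχ; exact .sum (ih₁ hχ) (ih₂ hχ)
  | fut _ hu ih => intro _ _ hχ; exact .fut (ih hχ) hu
  | lam _ ih => intro _ _ hχ; exact .lam (ih (hχ.vsubst (.vshift _ _)))
  | app _ hu ih => intro _ _ hχ; exact .app (ih hχ) hu
  | beta h hu =>
    intro _ χ hχ
    have := ConEq.beta (h.csubst (hχ.vsubst (.vshift _ _))) hu
    rw [Con.csubst_vsubst] at this
    simp only [Con.vshift_instV] at this
    exact this
  | recty _ hu ih => intro _ _ hχ; exact .recty (ih ((hχ.vsubst (.vshift _ _)).up _)) hu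
  | fn _ _ hG hGG ih₁ ih₂ =>
    intro _ _ hχ
    exact .fn (ih₁ (hχ.vsubst (.vshift₂ _ _ _))) (ih₂ (hχ.vsubst (.vshift₂ _ _ _))) hG hGG

/-! ### Equivalence under equivalent substitutions -/

/-- The substitutions `χ` and `χ'` of type constructors are equivalent. -/
def CSubEq (Δ : List GKind) (Ψ : VCtx) (χ χ' : ℕ → Con) (Θ Θ' : List Kind) : Prop :=
  ∀ n k, Θ[n]? = some k → ConEq Δ Ψ Θ' (χ n) (χ' n) k

theorem CSubEq.vsubst {Δ : List GKind} {Ψ Ψ' : VCtx} {χ χ' : ℕ → Con} {Θ Θ' : List Kind}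
    {σ : ℕ → VS} (h : CSubEq Δ Ψ χ χ' Θ Θ') (hσ : SubOK σ Ψ Ψ') :
    CSubEq Δ Ψ' (fun n => (χ n).vsubst σ) (fun n => (χ' n).vsubst σ) Θ Θ' :=
  fun n k hn => (h n k hn).vsubst hσ

theorem CSubEq.up {Δ : List GKind} {Ψ : VCtx} {χ χ' : ℕ → Con} {Θ Θ' : List Kind}
    (h : CSubEq Δ Ψ χ χ' Θ Θ') (k : Kind) :
    CSubEq Δ Ψ (Con.upC χ) (Con.upC χ') (k :: Θ) (k :: Θ') := by
  rintro (_ | n) k' hn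
  · exact .refl (.cvar hn)
  · exact (h n k' hn).crename fun _ _ hn => hn

theorem HasKind.csubst_eq {Δ : List GKind} {Ψ : VCtx} {Θ : List Kind} {c : Con} {k : Kind}
    (h : HasKind Δ Ψ Θ c k) : ∀ {Θ' : List Kind} {χ χ' : ℕ → Con}, CSubEq Δ Ψ χ χ' Θ Θ' →
      ConEq Δ Ψ Θ' (c.csubst χ) (c.csubst χ') k := by
  induction h with
  | unit => intro _ _ _ _; exact .refl .unit
  | cvar h => intro _ _ _ hχ; exact hχ _ _ h
  | fn _ _ hG ih₁ ih₂ =>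
    intro _ _ _ hχ
    exact .fn (ih₁ (hχ.vsubst (.vshift₂ _ _ _))) (ih₂ (hχ.vsubst (.vshift₂ _ _ _))) hG (.refl _)
  | sum _ _ ih₁ ih₂ => intro _ _ _ hχ; exact .sum (ih₁ hχ) (ih₂ hχ)
  | prod _ _ ih₁ ih₂ => intro _ _ _ hχ; exact .prod (ih₁ hχ) (ih₂ hχ)
  | fut _ hu ih => intro _ _ _ hχ; exact .fut (ih hχ) (.refl hu)
  | recty _ hu ih =>
    intro _ _ _ hχ
    exact .recty (ih ((hχ.vsubst (.vshift _ _)).up _)) (.refl hu)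
  | lam _ ih => intro _ _ _ hχ; exact .lam (ih (hχ.vsubst (.vshift _ _)))
  | app _ hu ih => intro _ _ _ hχ; exact .app (ih hχ) (.refl hu)

/-- The substitutions `σ` and `σ'` from `Ψ` to `Ψ'` differ at most at one variable, where they are
equivalent. -/
structure SubEq (σ σ' : ℕ → VS) (Ψ Ψ' : VCtx) (k : ℕ) (W : VSTy) : Prop where
  left : SubOK σ Ψ Ψ'
  typed : Ψ (.var k) = some W
  eq : ∀ n, n ≠ k → σ' n = σ n
  equiv : VSEq Ψ' (σ k) (σ' k) W

theorem SubEq.right {σ σ' : ℕ → VS} {Ψ Ψ' : VCtx} {k : ℕ} {W : VSTy}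
    (h : SubEq σ σ' Ψ Ψ' k W) : SubOK σ' Ψ Ψ' := by
  refine ⟨fun {n U} hn => ?_, h.left.gen⟩
  by_cases hk : n = k
  · subst hk
    rw [h.typed] at hn
    cases hn
    exact h.equiv.inv.2.1
  · rw [h.eq n hk]
    exact h.left.var hn

theorem SubEq.nf {σ σ' : ℕ → VS} {Ψ Ψ' : VCtx} {k : ℕ} {W : VSTy}
    (h : SubEq σ σ' Ψ Ψ' k W) (n : ℕ) : (σ n).nf = (σ' n).nf := by
  by_cases hk : n = k
  · subst hk; exact h.equiv.inv.2.2
  · rw [h.eq n hk]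

theorem SubEq.up {σ σ' : ℕ → VS} {Ψ Ψ' : VCtx} {k : ℕ} {W : VSTy}
    (h : SubEq σ σ' Ψ Ψ' k W) (o : Option VSTy) :
    SubEq (upV σ) (upV σ') (Ψ.push o) (Ψ'.push o) (k + 1) W := by
  refine ⟨h.left.up o, h.typed, ?_, h.equiv.subst (.vshift _ _) (.vshift _ _) fun _ => rfl⟩
  rintro (_ | n) hn
  · rfl
  · simp only [upV, h.eq n (by omega)]

theorem SubEq.instV {Ψ : VCtx} {u u' : VS} {U : VSTy} (h : VSEq Ψ u u' U) :
    SubEq (instV u) (instV u') (Ψ.push (some U)) Ψ 0 U := by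
  refine ⟨.instV h.inv.1, rfl, ?_, h⟩
  rintro (_ | n) hn
  · exact (hn rfl).elim
  · rfl

/-- Equivalence of types is preserved under equivalent substitutions, by beta reduction. -/
theorem ConEq.vsubst₂ {Δ : List GKind} {Ψ Ψ' : VCtx} {Θ : List Kind} {c c' : Con}
    {σ σ' : ℕ → VS} {k : ℕ} {W : VSTy} (h : ConEq Δ Ψ Θ c c' .ty) (hσ : SubEq σ σ' Ψ Ψ' k W) :
    ConEq Δ Ψ' Θ (c.vsubst σ) (c'.vsubst σ') .ty := by
  -- `τ` applies the common part of the two substitutions and moves the variable `k` to a fresh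
  -- innermost one. Instantiating that one by `σ k` or `σ' k` gives back `σ` or `σ'`.
  let τ : ℕ → VS := fun n => if n = k then .var 0 else (σ n).subst vshift
  have hτ : SubOK τ Ψ (Ψ'.push (some W)) := by
    refine ⟨fun {n U} hn => ?_, fun hs => (hσ.left.gen hs).subst (.vshift _ _) (.empty _)⟩
    by_cases hk : n = k
    · subst hk
      rw [hσ.typed] at hn
      simp only [τ, if_true]
      exact .psiVar hn
    · simp only [τ, if_neg hk]
      exact (hσ.left.var hn).subst (.vshift _ _) (.empty _)
  have hl : (fun n => (τ n).subst (GraphTypes.instV (σ k))) = σ := by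
    funext n
    by_cases hk : n = k
    · subst hk; simp only [τ, if_true]; rfl
    · simp only [τ, if_neg hk, VS.vshift_instV]
  have hr : (fun n => (τ n).subst (GraphTypes.instV (σ' k))) = σ' := by
    funext n
    by_cases hk : n = k
    · subst hk; simp only [τ, if_true]; rfl
    · simp only [τ, if_neg hk, VS.vshift_instV, hσ.eq n hk]
  have key := h.vsubst hτ
  have h₁ := ConEq.beta key.hasKind.1 hσ.equiv.inv.1
  have h₂ := ConEq.beta key.hasKind.2 hσ.equiv.inv.2.1
  rw [Con.vsubst_vsubst, hl] at h₁
  rw [Con.vsubst_vsubst, hr] at h₂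
  -- Expand to a redex, change its body and its argument by congruence, and contract again.
  exact .trans (.comm h₁) (.trans (.app (.lam key) hσ.equiv) h₂)

/-- The body occurs twice in an unrolling: as the term substituted into and within the recursive
type substituted for the constructor variable. The two occurrences are replaced one after the other.
-/
theorem ConEq.unroll {Δ : List GKind} {Ψ : VCtx} {Θ : List Kind} {U : VSTy} {c c' : Con}
    {u u' : VS} (h : ConEq Δ (Ψ.push (some U)) (.arr U :: Θ) c c' .ty) (hu : VSEq Ψ u u' U) :
    ConEq Δ Ψ Θ (Con.unroll U c u) (Con.unroll U c' u') .ty := by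
  have h₁ := h.vsubst₂ (.instV hu)
  refine .trans (h₁.csubst (.instC h.hasKind.1)) (h₁.hasKind.2.csubst_eq ?_)
  rintro (_ | n) k hn
  · cases hn
    exact .lam (.recty (h.vsubst ((SubOK.vshift _ _).up _)) (.refl (.psiVar rfl)))
  · exact .refl (.cvar hn)

/-! ## Graph types with normalized vertex structures -/

namespace GTy

/-- Normalize all vertex structures in a graph type. -/
def nf : GTy → GTy
  | gvar n => gvar n
  | emp => emp
  | seq G₁ G₂ => seq G₁.nf G₂.nf
  | or G₁ G₂ => or G₁.nf G₂.nf
  | mu G => mu G.nf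
  | spawn G u => spawn G.nf u.nf
  | touch u => touch u.nf
  | pi Uf Ut G => pi Uf Ut G.nf
  | app G uf ut => app G.nf uf.nf ut.nf
  | new U G => new U G.nf

@[simp] theorem nf_nf (G : GTy) : G.nf.nf = G.nf := by
  induction G <;> simp_all [nf]

theorem nf_upV_congr {σ σ' : ℕ → VS} (h : ∀ n, (σ n).nf = (σ' n).nf) (n : ℕ) :
    (upV σ n).nf = (upV σ' n).nf := by
  cases n with
  | zero => rfl
  | succ n => simp only [upV, VS.nf_ren .vshift, h]

/-- Under a binder the substitutions are shifted, and equality of normal forms survives because the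
shift is a renaming. -/
theorem nf_vsubst_congr {G G' : GTy} (hG : G.nf = G'.nf) : ∀ {σ σ' : ℕ → VS},
    (∀ n, (σ n).nf = (σ' n).nf) → (G.vsubst σ).nf = (G'.vsubst σ').nf := by
  induction G generalizing G' with
  | gvar | emp => intro _ _ _; cases G' <;> cases hG; rfl
  | seq G₁ G₂ ih₁ ih₂ | or G₁ G₂ ih₁ ih₂ =>
    intro _ _ h
    cases G' <;> simp only [nf, reduceCtorEq, seq.injEq, or.injEq] at hG
    simp only [vsubst, nf, ih₁ hG.1 h, ih₂ hG.2 h]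
  | mu G ih =>
    intro _ _ h
    cases G' <;> simp only [nf, reduceCtorEq, mu.injEq] at hG
    simp only [vsubst, nf, ih hG h]
  | spawn G u ih =>
    intro _ _ h
    cases G' <;> simp only [nf, reduceCtorEq, spawn.injEq] at hG
    simp only [vsubst, nf, ih hG.1 h, VS.nf_subst_congr' h hG.2]
  | touch u =>
    intro _ _ h
    cases G' <;> simp only [nf, reduceCtorEq, touch.injEq] at hG
    simp only [vsubst, nf, VS.nf_subst_congr' h hG]
  | pi Uf Ut G ih =>
    intro _ _ h
    cases G' <;> simp only [nf, reduceCtorEq, pi.injEq] at hG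
    simp only [vsubst, nf, ih hG.2.2 (nf_upV_congr (nf_upV_congr h)), hG.1, hG.2.1]
  | app G uf ut ih =>
    intro _ _ h
    cases G' <;> simp only [nf, reduceCtorEq, app.injEq] at hG
    simp only [vsubst, nf, ih hG.1 h, VS.nf_subst_congr' h hG.2.1, VS.nf_subst_congr' h hG.2.2]
  | new U G ih =>
    intro _ _ h
    cases G' <;> simp only [nf, reduceCtorEq, new.injEq] at hG
    simp only [vsubst, nf, ih hG.2 (nf_upV_congr h), hG.1]

theorem nf_vsubst (G : GTy) (σ : ℕ → VS) : (G.nf.vsubst σ).nf = (G.vsubst σ).nf :=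
  nf_vsubst_congr (nf_nf G) fun _ => rfl

end GTy

theorem GEq.nf {G G' : GTy} (h : GEq G G') : GEq G.nf G'.nf := by
  induction h with
  | unit => exact .unit
  | refl G => exact .refl _
  | symm _ ih => exact .symm ih
  | trans _ _ ih₁ ih₂ => exact .trans ih₁ ih₂
  | seq _ _ ih₁ ih₂ => exact .seq ih₁ ih₂
  | or _ _ ih₁ ih₂ => exact .or ih₁ ih₂
  | mu _ ih => exact .mu ih
  | spawn u _ ih => exact .spawn _ ih
  | pi _ _ _ ih => exact .pi _ _ ih
  | app _ _ _ ih => exact .app _ _ ih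
  | new _ _ ih => exact .new _ ih

/-- Graph types that agree up to `GEq` and normalization of vertex structures. -/
def GSim (G G' : GTy) : Prop := GEq G.nf G'.nf

/-- `GEq` never looks at vertex structures and so survives any substitution; normalization then
erases the difference between `σ` and `σ'`. -/
theorem GSim.vsubst {G G' : GTy} {σ σ' : ℕ → VS} (h : GSim G G')
    (hσ : ∀ n, (σ n).nf = (σ' n).nf) : GSim (G.vsubst σ) (G'.vsubst σ') := by
  have := (GEq.vsubst h σ).nf
  rwa [GTy.nf_vsubst, GTy.nf_vsubst, GTy.nf_vsubst_congr (G := G') rfl hσ] at this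

/-! ## Injectivity of type equivalence -/

namespace Con

/-- Beta reduction at the head of a type. -/
def whd : Con → Con
  | app (lam _ c) u => (whd c).vsubst (instV u)
  | c => c

/-- Substituting vertex structures creates no constructor redex. For the same reason `whd` may
reduce the body before inserting the argument, which makes it structurally recursive. -/
theorem whd_vsubst : ∀ (c : Con) (σ : ℕ → VS), (c.vsubst σ).whd = c.whd.vsubst σ
  | app (lam U c) u, σ => by
    simp only [vsubst, whd, whd_vsubst c, vsubst_instV]
  | unit, _ => rfl
  | fn .., _ => rfl
  | prod .., _ => rfl
  | sum .., _ => rfl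
  | fut .., _ => rfl
  | cvar _, _ => rfl
  | recty .., _ => rfl
  | lam .., _ => rfl
  | app unit _, _ => rfl
  | app (fn ..) _, _ => rfl
  | app (prod ..) _, _ => rfl
  | app (sum ..) _, _ => rfl
  | app (fut ..) _, _ => rfl
  | app (cvar _) _, _ => rfl
  | app (recty ..) _, _ => rfl
  | app (app ..) _, _ => rfl

/-- Types with the same head former and equivalent components. -/
inductive Shape (Δ : List GKind) (Ψ : VCtx) (Θ : List Kind) : Con → Con → Prop
  | unit : Shape Δ Ψ Θ .unit .unit
  | cvar (n m : ℕ) : Shape Δ Ψ Θ (.cvar n) (.cvar m)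
  | neutral (n m : ℕ) (u u' : VS) : Shape Δ Ψ Θ (.app (.cvar n) u) (.app (.cvar m) u')
  | prod {c₁ c₁' c₂ c₂' : Con} : ConEq Δ Ψ Θ c₁ c₁' .ty → ConEq Δ Ψ Θ c₂ c₂' .ty →
      Shape Δ Ψ Θ (.prod c₁ c₂) (.prod c₁' c₂')
  | sum {c₁ c₁' c₂ c₂' : Con} : ConEq Δ Ψ Θ c₁ c₁' .ty → ConEq Δ Ψ Θ c₂ c₂' .ty →
      Shape Δ Ψ Θ (.sum c₁ c₂) (.sum c₁' c₂')
  | fut {c c' : Con} {u u' : VS} : ConEq Δ Ψ Θ c c' .ty → VSEq Ψ u u' .vty →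
      Shape Δ Ψ Θ (.fut c u) (.fut c' u')
  | recty {U : VSTy} {c c' : Con} {u u' : VS} :
      ConEq Δ (Ψ.push (some U)) (.arr U :: Θ) c c' .ty → VSEq Ψ u u' U →
      Shape Δ Ψ Θ (.recty U c u) (.recty U c' u')
  | fn {Uf Ut : VSTy} {c₁ c₁' c₂ c₂' : Con} {G G' : GTy} :
      ConEq Δ ((Ψ.push (some Uf)).push (some Ut)) Θ c₁ c₁' .ty →
      ConEq Δ ((Ψ.push (some Uf)).push (some Ut)) Θ c₂ c₂' .ty → GSim G G' →
      Shape Δ Ψ Θ (.fn Uf Ut c₁ c₂ (arrowAnn G)) (.fn Uf Ut c₁' c₂' (arrowAnn G'))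

theorem Shape.symm {Δ : List GKind} {Ψ : VCtx} {Θ : List Kind} {c c' : Con}
    (h : Shape Δ Ψ Θ c c') : Shape Δ Ψ Θ c' c := by
  cases h with
  | unit => exact .unit
  | cvar => exact .cvar ..
  | neutral => exact .neutral ..
  | prod h₁ h₂ => exact .prod (.comm h₁) (.comm h₂)
  | sum h₁ h₂ => exact .sum (.comm h₁) (.comm h₂)
  | fut h hu => exact .fut (.comm h) (.comm hu)
  | recty h hu => exact .recty (.comm h) (.comm hu)
  | fn h₁ h₂ hG => exact .fn (.comm h₁) (.comm h₂) hG.symm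

theorem Shape.fn_inv {Δ : List GKind} {Ψ : VCtx} {Θ : List Kind} {Uf Ut : VSTy} {c₁ c₂ c' : Con}
    {G : GTy} (h : Shape Δ Ψ Θ (.fn Uf Ut c₁ c₂ (arrowAnn G)) c') :
    ∃ c₁' c₂' G', c' = .fn Uf Ut c₁' c₂' (arrowAnn G') ∧
      ConEq Δ ((Ψ.push (some Uf)).push (some Ut)) Θ c₁ c₁' .ty ∧
      ConEq Δ ((Ψ.push (some Uf)).push (some Ut)) Θ c₂ c₂' .ty ∧ GSim G G' := by
  generalize hc : Con.fn Uf Ut c₁ c₂ (arrowAnn G) = c at h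
  cases h with
  | fn h₁ h₂ hG =>
    simp only [Con.fn.injEq] at hc
    obtain ⟨rfl, rfl, rfl, rfl, hA⟩ := hc
    rw [← arrowAnn_injective hA] at hG
    exact ⟨_, _, _, rfl, h₁, h₂, hG⟩
  | _ => cases hc

theorem Shape.trans {Δ : List GKind} {Ψ : VCtx} {Θ : List Kind} {c c' c'' : Con}
    (h : Shape Δ Ψ Θ c c') (h' : Shape Δ Ψ Θ c' c'') : Shape Δ Ψ Θ c c'' := by
  cases h with
  | unit => exact h'
  | cvar => cases h'; exact .cvar ..
  | neutral => cases h'; exact .neutral ..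
  | prod h₁ h₂ => cases h' with | prod h₁' h₂' => exact .prod (.trans h₁ h₁') (.trans h₂ h₂')
  | sum h₁ h₂ => cases h' with | sum h₁' h₂' => exact .sum (.trans h₁ h₁') (.trans h₂ h₂')
  | fut h hu => cases h' with | fut h' hu' => exact .fut (.trans h h') (.trans hu hu')
  | recty h hu => cases h' with | recty h' hu' => exact .recty (.trans h h') (.trans hu hu')
  | fn h₁ h₂ hG =>
    obtain ⟨_, _, _, rfl, h₁', h₂', hG'⟩ := h'.fn_inv
    exact .fn (.trans h₁ h₁') (.trans h₂ h₂') (hG.trans hG')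

/-- This is where equivalent vertex structures enter the annotations of arrows, and the reason why
`Shape` compares annotations by `GSim` and not by `GEq`. -/
theorem Shape.vsubst₂ {Δ : List GKind} {Ψ Ψ' : VCtx} {Θ : List Kind} {c c' : Con}
    {σ σ' : ℕ → VS} {k : ℕ} {W : VSTy} (h : Shape Δ Ψ Θ c c') (hσ : SubEq σ σ' Ψ Ψ' k W) :
    Shape Δ Ψ' Θ (c.vsubst σ) (c'.vsubst σ') := by
  cases h with
  | unit => exact .unit
  | cvar => exact .cvar ..
  | neutral => exact .neutral ..
  | prod h₁ h₂ => exact .prod (h₁.vsubst₂ hσ) (h₂.vsubst₂ hσ)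
  | sum h₁ h₂ => exact .sum (h₁.vsubst₂ hσ) (h₂.vsubst₂ hσ)
  | fut h hu => exact .fut (h.vsubst₂ hσ) (hu.subst hσ.left hσ.right hσ.nf)
  | recty h hu =>
    exact .recty (h.vsubst₂ (hσ.up _)) (hu.subst hσ.left hσ.right hσ.nf)
  | fn h₁ h₂ hG =>
    simp only [Con.vsubst, arrowAnn_vsubst]
    exact .fn (h₁.vsubst₂ ((hσ.up _).up _)) (h₂.vsubst₂ ((hσ.up _).up _)) (hG.vsubst hσ.nf)

/-- `Shape` of the weak head normal forms, for constructors of all kinds. -/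
def HeadShape (Δ : List GKind) (Ψ : VCtx) (Θ : List Kind) (c c' : Con) : Kind → Prop
  | .ty => Shape Δ Ψ Θ c.whd c'.whd
  | .arr U => (∃ n m, c = .cvar n ∧ c' = .cvar m) ∨
      ∃ a a', c = .lam U a ∧ c' = .lam U a' ∧ Shape Δ (Ψ.push (some U)) Θ a.whd a'.whd

theorem HeadShape.app {Δ : List GKind} {Ψ : VCtx} {Θ : List Kind} {c c' : Con} {U : VSTy}
    {u u' : VS} (h : HeadShape Δ Ψ Θ c c' (.arr U)) (hu : VSEq Ψ u u' U) :
    HeadShape Δ Ψ Θ (.app c u) (.app c' u') .ty := by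
  rcases h with ⟨n, m, rfl, rfl⟩ | ⟨a, a', rfl, rfl, h⟩
  · exact .neutral ..
  · exact h.vsubst₂ (.instV hu)

theorem _root_.GraphTypes.HasKind.headShape {Δ : List GKind} {Ψ : VCtx} {Θ : List Kind} {c : Con}
    {k : Kind} (h : HasKind Δ Ψ Θ c k) : HeadShape Δ Ψ Θ c c k := by
  induction h with
  | unit => exact .unit
  | @cvar _ _ n k =>
    cases k with
    | ty => exact .cvar ..
    | arr U => exact .inl ⟨n, n, rfl, rfl⟩
  | fn h₁ h₂ => exact .fn (.refl h₁) (.refl h₂) (.refl _)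
  | sum h₁ h₂ => exact .sum (.refl h₁) (.refl h₂)
  | prod h₁ h₂ => exact .prod (.refl h₁) (.refl h₂)
  | fut h hu => exact .fut (.refl h) (.refl hu)
  | recty h hu => exact .recty (.refl h) (.refl hu)
  | lam _ ih => exact .inr ⟨_, _, rfl, rfl, ih⟩
  | app _ hu ih => exact ih.app (.refl hu)

/-- The congruence rules supply the components of a `Shape` directly as equivalences. Only an
application can be a redex; its operator, having arrow kind, is a variable or an abstraction, and in
the latter case the two bodies are compared under equivalent instantiations. -/
theorem _root_.GraphTypes.ConEq.headShape {Δ : List GKind} {Ψ : VCtx} {Θ : List Kind}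
    {c c' : Con} {k : Kind} (h : ConEq Δ Ψ Θ c c' k) : HeadShape Δ Ψ Θ c c' k := by
  induction h with
  | refl h => exact h.headShape
  | @comm _ _ _ _ k _ ih =>
    cases k with
    | ty => exact Shape.symm ih
    | arr U =>
      rcases ih with ⟨n, m, rfl, rfl⟩ | ⟨a, a', rfl, rfl, h⟩
      · exact .inl ⟨_, _, rfl, rfl⟩
      · exact .inr ⟨_, _, rfl, rfl, h.symm⟩
  | @trans _ _ _ _ _ k _ _ ih₁ ih₂ =>
    cases k with
    | ty => exact Shape.trans ih₁ ih₂
    | arr U =>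
      rcases ih₁ with ⟨n, m, rfl, rfl⟩ | ⟨a, a', rfl, rfl, h⟩ <;>
      rcases ih₂ with ⟨n', m', hn, rfl⟩ | ⟨b, b', hb, rfl, h'⟩
      · exact .inl ⟨_, _, rfl, rfl⟩
      · cases hb
      · cases hn
      · cases hb
        exact .inr ⟨_, _, rfl, rfl, h.trans h'⟩
  | prod h₁ h₂ => exact .prod h₁ h₂
  | sum h₁ h₂ => exact .sum h₁ h₂
  | fut h hu => exact .fut h hu
  | lam _ ih => exact .inr ⟨_, _, rfl, rfl, ih⟩
  | app _ hu ih => exact ih.app hu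
  | @beta _ _ _ c u h hu =>
    -- Redex and contractum have the same head-reduced form, so the beta case becomes reflexivity of
    -- the redex.
    have : (c.vsubst (instV u)).whd = (Con.app (.lam ‹_› c) u).whd := by
      rw [whd_vsubst]; rfl
    simp only [HeadShape, this]
    exact (HasKind.app (.lam h) hu).headShape
  | recty h hu => exact .recty h hu
  | fn h₁ h₂ _ hG => exact .fn h₁ h₂ hG.nf

end Con

section Injectivity

variable {Δ : List GKind} {Ψ : VCtx} {Θ : List Kind}

theorem ConEq.prod_inj {c₁ c₂ c₁' c₂' : Con}
    (h : ConEq Δ Ψ Θ (.prod c₁ c₂) (.prod c₁' c₂') .ty) :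
    ConEq Δ Ψ Θ c₁ c₁' .ty ∧ ConEq Δ Ψ Θ c₂ c₂' .ty := by
  cases h.headShape with
  | prod h₁ h₂ => exact ⟨h₁, h₂⟩

theorem ConEq.sum_inj {c₁ c₂ c₁' c₂' : Con}
    (h : ConEq Δ Ψ Θ (.sum c₁ c₂) (.sum c₁' c₂') .ty) :
    ConEq Δ Ψ Θ c₁ c₁' .ty ∧ ConEq Δ Ψ Θ c₂ c₂' .ty := by
  cases h.headShape with
  | sum h₁ h₂ => exact ⟨h₁, h₂⟩

theorem ConEq.fut_inj {c c' : Con} {u u' : VS}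
    (h : ConEq Δ Ψ Θ (.fut c u) (.fut c' u') .ty) :
    ConEq Δ Ψ Θ c c' .ty ∧ VSEq Ψ u u' .vty := by
  cases h.headShape with
  | fut h hu => exact ⟨h, hu⟩

theorem ConEq.recty_inj {U U' : VSTy} {c c' : Con} {u u' : VS}
    (h : ConEq Δ Ψ Θ (.recty U c u) (.recty U' c' u') .ty) :
    U = U' ∧ ConEq Δ (Ψ.push (some U)) (.arr U :: Θ) c c' .ty ∧ VSEq Ψ u u' U := by
  cases h.headShape with
  | recty h hu => exact ⟨rfl, h, hu⟩

theorem ConEq.fn_inj {Uf Ut Uf' Ut' : VSTy} {c₁ c₂ c₁' c₂' : Con} {G G' : GTy}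
    (h : ConEq Δ Ψ Θ (.fn Uf Ut c₁ c₂ (arrowAnn G)) (.fn Uf' Ut' c₁' c₂' (arrowAnn G')) .ty) :
    Uf = Uf' ∧ Ut = Ut' ∧ ConEq Δ ((Ψ.push (some Uf)).push (some Ut)) Θ c₁ c₁' .ty ∧
      ConEq Δ ((Ψ.push (some Uf)).push (some Ut)) Θ c₂ c₂' .ty ∧ GSim G G' := by
  obtain ⟨_, _, _, he, h₁, h₂, hG⟩ := Con.Shape.fn_inv h.headShape
  simp only [Con.whd, Con.fn.injEq] at he
  obtain ⟨rfl, rfl, rfl, rfl, hA⟩ := he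
  rw [← arrowAnn_injective hA] at hG
  exact ⟨rfl, rfl, h₁, h₂, hG⟩

end Injectivity

/-! ## Closed graph types -/

/-- All free graph type variables have index less than `n`. -/
def GTy.Closed : ℕ → GTy → Prop
  | n, .gvar m => m < n
  | _, .emp => True
  | n, .seq G₁ G₂ => G₁.Closed n ∧ G₂.Closed n
  | n, .or G₁ G₂ => G₁.Closed n ∧ G₂.Closed n
  | n, .mu G => G.Closed (n + 1)
  | n, .spawn G _ => G.Closed n
  | _, .touch _ => True
  | n, .pi _ _ G => G.Closed n
  | n, .app G _ _ => G.Closed n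
  | n, .new _ G => G.Closed n

theorem DagWF.closed {Δ : List GKind} {Ω Ψ : VCtx} {G : GTy} {K : GKind} (h : DagWF Δ Ω Ψ G K) :
    G.Closed Δ.length := by
  induction h with
  | emp | touch => trivial
  | gvar h => exact (List.getElem?_eq_some_iff.1 h).1
  | seq _ _ _ ih₁ ih₂ | or _ _ ih₁ ih₂ => exact ⟨ih₁, ih₂⟩
  | spawn _ _ _ ih | new _ ih | pi _ ih | recPi _ ih | app _ _ _ _ _ ih => exact ih

theorem GEq.closed_iff {G G' : GTy} (h : GEq G G') : ∀ n : ℕ, G.Closed n ↔ G'.Closed n := by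
  induction h <;> simp_all [GTy.Closed]

/-! ## Typing with optional affinity -/

/-- Typing in which the affine premises outside of functions are imposed only if `b` is `true`. -/
inductive HasTyB : Bool → List GKind → VCtx → VCtx → List Con → Exp → Con → GTy → Prop
  | var {b : Bool} {Δ : List GKind} {Ω Ψ : VCtx} {Γ : List Con} {n : ℕ} {τ : Con} :
      Γ[n]? = some τ → HasTyB b Δ Ω Ψ Γ (.var n) τ .emp
  | triv {b : Bool} {Δ : List GKind} {Ω Ψ : VCtx} {Γ : List Con} :
      HasTyB b Δ Ω Ψ Γ .triv .unit .emp
  | fn {b : Bool} {Δ : List GKind} {Ω Ψ : VCtx} {Γ : List Con} {Uf Ut : VSTy} {e : Exp}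
      {τ₁ τ₂ : Con} {G : GTy} :
      HasTyB true (.pi Uf Ut .graph :: Δ) ((VCtx.empty.push (some Uf)).push none)
        ((Ψ.push (some Uf)).push (some Ut))
        (τ₁.grename Nat.succ ::
          (Con.fn Uf Ut (τ₁.grename Nat.succ) (τ₂.grename Nat.succ)
            (arrowAnn (.gvar 0))).vsubst vshift₂ ::
          Γ.map fun c => (c.grename Nat.succ).vsubst vshift₂)
        e (τ₂.grename Nat.succ) G →
      HasKind Δ ((Ψ.push (some Uf)).push (some Ut)) [] τ₁ .ty →
      HasKind Δ ((Ψ.push (some Uf)).push (some Ut)) [] τ₂ .ty →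
      HasTyB b Δ Ω Ψ Γ (.fn e) (.fn Uf Ut τ₁ τ₂ (arrowAnn (.mu (.pi Uf Ut G)))) .emp
  | app {b : Bool} {Δ : List GKind} {Ω Ω₁ Ω' Ω₂ Ω₃ Ψ : VCtx} {Γ : List Con} {Uf Ut : VSTy}
      {e₁ e₂ : Exp} {uf ut : VS} {τ₁ τ₂ : Con} {G₁ G₂ G₃ : GTy} :
      (b = true → CSplit Ω Ω₁ Ω') → (b = true → CSplit Ω' Ω₂ Ω₃) →
      HasTyB b Δ Ω₁ Ψ Γ e₁ (.fn Uf Ut τ₁ τ₂ (arrowAnn G₃)) G₁ →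
      HasTyB b Δ Ω₂ Ψ Γ e₂ (τ₁.vsubst (instV₂ uf ut)) G₂ →
      (b = true → HasVS Ω₃ .empty uf Uf) → HasVS .empty Ψ uf Uf → HasVS .empty Ψ ut Ut →
      HasTyB b Δ Ω Ψ Γ (.app e₁ uf ut e₂) (τ₂.vsubst (instV₂ uf ut))
        (.seq (.seq G₁ G₂) (.app G₃ uf ut))
  | pair {b : Bool} {Δ : List GKind} {Ω Ω₁ Ω₂ Ψ : VCtx} {Γ : List Con} {e₁ e₂ : Exp}
      {τ₁ τ₂ : Con} {G₁ G₂ : GTy} : (b = true → CSplit Ω Ω₁ Ω₂) →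
      HasTyB b Δ Ω₁ Ψ Γ e₁ τ₁ G₁ → HasTyB b Δ Ω₂ Ψ Γ e₂ τ₂ G₂ →
      HasTyB b Δ Ω Ψ Γ (.pair e₁ e₂) (.prod τ₁ τ₂) (.seq G₁ G₂)
  | fst {b : Bool} {Δ : List GKind} {Ω Ψ : VCtx} {Γ : List Con} {e : Exp} {τ₁ τ₂ : Con}
      {G : GTy} : HasTyB b Δ Ω Ψ Γ e (.prod τ₁ τ₂) G → HasTyB b Δ Ω Ψ Γ (.fst e) τ₁ G
  | snd {b : Bool} {Δ : List GKind} {Ω Ψ : VCtx} {Γ : List Con} {e : Exp} {τ₁ τ₂ : Con}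
      {G : GTy} : HasTyB b Δ Ω Ψ Γ e (.prod τ₁ τ₂) G → HasTyB b Δ Ω Ψ Γ (.snd e) τ₂ G
  | inl {b : Bool} {Δ : List GKind} {Ω Ψ : VCtx} {Γ : List Con} {e : Exp} {τ₁ τ₂ : Con}
      {G : GTy} : HasTyB b Δ Ω Ψ Γ e τ₁ G → HasKind Δ Ψ [] τ₂ .ty →
      HasTyB b Δ Ω Ψ Γ (.inl e) (.sum τ₁ τ₂) G
  | inr {b : Bool} {Δ : List GKind} {Ω Ψ : VCtx} {Γ : List Con} {e : Exp} {τ₁ τ₂ : Con}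
      {G : GTy} : HasTyB b Δ Ω Ψ Γ e τ₂ G → HasKind Δ Ψ [] τ₁ .ty →
      HasTyB b Δ Ω Ψ Γ (.inr e) (.sum τ₁ τ₂) G
  | case {b : Bool} {Δ : List GKind} {Ω Ω₁ Ω₂ Ψ : VCtx} {Γ : List Con} {e e₁ e₂ : Exp}
      {τ₁ τ₂ τ : Con} {G₁ G₂ G₃ : GTy} : (b = true → CSplit Ω Ω₁ Ω₂) →
      HasTyB b Δ Ω₁ Ψ Γ e (.sum τ₁ τ₂) G₁ → HasTyB b Δ Ω₂ Ψ (τ₁ :: Γ) e₁ τ G₂ →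
      HasTyB b Δ Ω₂ Ψ (τ₂ :: Γ) e₂ τ G₃ →
      HasTyB b Δ Ω Ψ Γ (.case e e₁ e₂) τ (.seq G₁ (.or G₂ G₃))
  | roll {b : Bool} {Δ : List GKind} {Ω Ψ : VCtx} {Γ : List Con} {e : Exp} {U : VSTy} {τ : Con}
      {u : VS} {G : GTy} :
      HasTyB b Δ Ω Ψ Γ e (Con.unroll U τ u) G → HasKind Δ Ψ [] (.recty U τ u) .ty →
      HasTyB b Δ Ω Ψ Γ (.roll e) (.recty U τ u) G
  | unroll {b : Bool} {Δ : List GKind} {Ω Ψ : VCtx} {Γ : List Con} {e : Exp} {U : VSTy}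
      {τ : Con} {u : VS} {G : GTy} :
      HasTyB b Δ Ω Ψ Γ e (.recty U τ u) G → HasTyB b Δ Ω Ψ Γ (.unroll e) (Con.unroll U τ u) G
  | future {b : Bool} {Δ : List GKind} {Ω Ω₁ Ω₂ Ψ : VCtx} {Γ : List Con} {e : Exp} {τ : Con}
      {u : VS} {G : GTy} : (b = true → CSplit Ω Ω₁ Ω₂) →
      HasTyB b Δ Ω₁ Ψ Γ e τ G → (b = true → HasVS Ω₂ .empty u .vty) → HasVS .empty Ψ u .vty →
      HasTyB b Δ Ω Ψ Γ (.future u e) (.fut τ u) (.spawn G u)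
  | force {b : Bool} {Δ : List GKind} {Ω Ψ : VCtx} {Γ : List Con} {e : Exp} {τ : Con} {u : VS}
      {G : GTy} :
      HasTyB b Δ Ω Ψ Γ e (.fut τ u) G → HasTyB b Δ Ω Ψ Γ (.force e) τ (.seq G (.touch u))
  | new {b : Bool} {Δ : List GKind} {Ω Ψ : VCtx} {Γ : List Con} {U : VSTy} {e : Exp} {τ : Con}
      {G : GTy} :
      HasTyB b Δ (Ω.push (some U)) (Ψ.push (some U)) (Γ.map fun c => c.vsubst vshift) e
        (τ.vsubst vshift) G →
      HasKind Δ Ψ [] τ .ty → HasTyB b Δ Ω Ψ Γ (.new U e) τ (.new U G)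
  | typeEq {b : Bool} {Δ : List GKind} {Ω Ψ : VCtx} {Γ : List Con} {e : Exp} {τ₁ τ₂ : Con}
      {G : GTy} :
      ConEq Δ Ψ [] τ₁ τ₂ .ty → HasTyB b Δ Ω Ψ Γ e τ₁ G → HasTyB b Δ Ω Ψ Γ e τ₂ G
  | handle {b : Bool} {Δ : List GKind} {Ω Ψ : VCtx} {Γ : List Con} {p : VS} {v : Exp} {τ : Con} :
      IsPath p → Value v →
      HasTyB b Δ .empty Ψ Γ v τ .emp → HasVS .empty Ψ p .vty →
      HasTyB b Δ Ω Ψ Γ (.handle p v) (.fut τ p) .emp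
  | graphEq {b : Bool} {Δ : List GKind} {Ω Ψ : VCtx} {Γ : List Con} {e : Exp} {τ : Con}
      {G G' : GTy} : GEq G G' → HasTyB b Δ Ω Ψ Γ e τ G → HasTyB b Δ Ω Ψ Γ e τ G'

theorem HasTyB.of_hasTy {Δ : List GKind} {Ω Ψ : VCtx} {Γ : List Con} {e : Exp} {τ : Con} {G : GTy}
    (h : HasTy Δ Ω Ψ Γ e τ G) : HasTyB true Δ Ω Ψ Γ e τ G := by
  induction h with
  | var h => exact .var h
  | triv => exact .triv
  | fn _ h₁ h₂ ih => exact .fn ih h₁ h₂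
  | app hc hc' _ _ h₁ h₂ h₃ ih₁ ih₂ =>
    exact .app (fun _ => hc) (fun _ => hc') ih₁ ih₂ (fun _ => h₁) h₂ h₃
  | pair hc _ _ ih₁ ih₂ => exact .pair (fun _ => hc) ih₁ ih₂
  | fst _ ih => exact .fst ih
  | snd _ ih => exact .snd ih
  | inl _ h ih => exact .inl ih h
  | inr _ h ih => exact .inr ih h
  | case hc _ _ _ ih ih₁ ih₂ => exact .case (fun _ => hc) ih ih₁ ih₂
  | roll _ h ih => exact .roll ih h
  | unroll _ ih => exact .unroll ih
  | future hc _ h₁ h₂ ih => exact .future (fun _ => hc) ih (fun _ => h₁) h₂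
  | force _ ih => exact .force ih
  | new _ h ih => exact .new ih h
  | typeEq h _ ih => exact .typeEq h ih
  | handle hp hv _ h ih => exact .handle hp hv ih h
  | graphEq h _ ih => exact .graphEq h ih

theorem HasTyB.hasTy {b : Bool} {Δ : List GKind} {Ω Ψ : VCtx} {Γ : List Con} {e : Exp} {τ : Con}
    {G : GTy} (h : HasTyB b Δ Ω Ψ Γ e τ G) : b = true → HasTy Δ Ω Ψ Γ e τ G := by
  induction h with
  | var h => intro _; exact .var h
  | triv => intro _; exact .triv
  | fn _ h₁ h₂ ih => intro _; exact .fn (ih rfl) h₁ h₂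
  | app hc hc' _ _ h₁ h₂ h₃ ih₁ ih₂ =>
    intro hb; exact .app (hc hb) (hc' hb) (ih₁ hb) (ih₂ hb) (h₁ hb) h₂ h₃
  | pair hc _ _ ih₁ ih₂ => intro hb; exact .pair (hc hb) (ih₁ hb) (ih₂ hb)
  | fst _ ih => intro hb; exact .fst (ih hb)
  | snd _ ih => intro hb; exact .snd (ih hb)
  | inl _ h ih => intro hb; exact .inl (ih hb) h
  | inr _ h ih => intro hb; exact .inr (ih hb) h
  | case hc _ _ _ ih ih₁ ih₂ => intro hb; exact .case (hc hb) (ih hb) (ih₁ hb) (ih₂ hb)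
  | roll _ h ih => intro hb; exact .roll (ih hb) h
  | unroll _ ih => intro hb; exact .unroll (ih hb)
  | future hc _ h₁ h₂ ih => intro hb; exact .future (hc hb) (ih hb) (h₁ hb) h₂
  | force _ ih => intro hb; exact .force (ih hb)
  | new _ h ih => intro hb; exact .new (ih hb) h
  | typeEq h _ ih => intro hb; exact .typeEq h (ih hb)
  | handle hp hv _ h ih => intro hb; exact .handle hp hv (ih hb) h
  | graphEq h _ ih => intro hb; exact .graphEq h (ih hb)

/-- With every affine premise vacuous, the affine context becomes irrelevant and may be changed at
will. Function bodies are taken over in their strict form. -/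
theorem HasTyB.relax {b : Bool} {Δ : List GKind} {Ω Ψ : VCtx} {Γ : List Con} {e : Exp} {τ : Con}
    {G : GTy} (h : HasTyB b Δ Ω Ψ Γ e τ G) : ∀ Ω' : VCtx, HasTyB false Δ Ω' Ψ Γ e τ G := by
  induction h with
  | var h => intro _; exact .var h
  | triv => intro _; exact .triv
  | fn h h₁ h₂ ih => intro _; exact .fn h h₁ h₂
  | app _ _ _ _ _ h₂ h₃ ih₁ ih₂ =>
    intro Ω'
    exact .app (Ω₁ := Ω') (Ω' := Ω') (Ω₂ := Ω') (Ω₃ := Ω') nofun nofun (ih₁ _) (ih₂ _) nofun h₂ h₃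
  | pair _ _ _ ih₁ ih₂ =>
    intro Ω'; exact .pair (Ω₁ := Ω') (Ω₂ := Ω') nofun (ih₁ _) (ih₂ _)
  | fst _ ih => intro _; exact .fst (ih _)
  | snd _ ih => intro _; exact .snd (ih _)
  | inl _ h ih => intro _; exact .inl (ih _) h
  | inr _ h ih => intro _; exact .inr (ih _) h
  | case _ _ _ _ ih ih₁ ih₂ =>
    intro Ω'; exact .case (Ω₁ := Ω') (Ω₂ := Ω') nofun (ih _) (ih₁ _) (ih₂ _)
  | roll _ h ih => intro _; exact .roll (ih _) h
  | unroll _ ih => intro _; exact .unroll (ih _)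
  | future _ _ _ h₂ ih =>
    intro Ω'; exact .future (Ω₁ := Ω') (Ω₂ := Ω') nofun (ih _) nofun h₂
  | force _ ih => intro _; exact .force (ih _)
  | new _ h ih => intro _; exact .new (ih _) h
  | typeEq h _ ih => intro _; exact .typeEq h (ih _)
  | handle hp hv _ h ih => intro _; exact .handle hp hv (ih _) h
  | graphEq h _ ih => intro _; exact .graphEq h (ih _)

theorem HasTyB.mono {b : Bool} {Δ : List GKind} {Ω Ψ : VCtx} {Γ : List Con} {e : Exp} {τ : Con}
    {G : GTy} (h : HasTyB b Δ Ω Ψ Γ e τ G) :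
    b = true → ∀ {Ω' : VCtx}, Ω.Sub Ω' → HasTyB b Δ Ω' Ψ Γ e τ G := by
  induction h with
  | var h => intro _ _ _; exact .var h
  | triv => intro _ _ _; exact .triv
  | fn h h₁ h₂ => intro _ _ _; exact .fn h h₁ h₂
  | app hc hc' _ h' h₁ h₂ h₃ ih₁ _ =>
    intro hb _ hs
    obtain ⟨_, hd, hs'⟩ := (hc hb).extend hs
    exact .app (fun _ => hd) hc' (ih₁ hb hs') h' h₁ h₂ h₃
  | pair hc _ h' ih₁ _ =>
    intro hb _ hs
    obtain ⟨_, hd, hs'⟩ := (hc hb).extend hs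
    exact .pair (fun _ => hd) (ih₁ hb hs') h'
  | fst _ ih => intro hb _ hs; exact .fst (ih hb hs)
  | snd _ ih => intro hb _ hs; exact .snd (ih hb hs)
  | inl _ h ih => intro hb _ hs; exact .inl (ih hb hs) h
  | inr _ h ih => intro hb _ hs; exact .inr (ih hb hs) h
  | case hc _ h₁ h₂ ih _ _ =>
    intro hb _ hs
    obtain ⟨_, hd, hs'⟩ := (hc hb).extend hs
    exact .case (fun _ => hd) (ih hb hs') h₁ h₂
  | roll _ h ih => intro hb _ hs; exact .roll (ih hb hs) h
  | unroll _ ih => intro hb _ hs; exact .unroll (ih hb hs)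
  | future hc _ h₁ h₂ ih =>
    intro hb _ hs
    obtain ⟨_, hd, hs'⟩ := (hc hb).extend hs
    exact .future (fun _ => hd) (ih hb hs') h₁ h₂
  | force _ ih => intro hb _ hs; exact .force (ih hb hs)
  | new _ h ih => intro hb _ hs; exact .new (ih hb (hs.push _)) h
  | typeEq h _ ih => intro hb _ hs; exact .typeEq h (ih hb hs)
  | handle hp hv h' h _ => intro _ _ _; exact .handle hp hv h' h
  | graphEq h _ ih => intro hb _ hs; exact .graphEq h (ih hb hs)

theorem HasTyB.of_empty {b : Bool} {Δ : List GKind} {Ψ : VCtx} {Γ : List Con} {e : Exp} {τ : Con}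
    {G : GTy} (h : HasTyB true Δ .empty Ψ Γ e τ G) (Ω : VCtx) : HasTyB b Δ Ω Ψ Γ e τ G := by
  cases b
  · exact h.relax _
  · exact h.mono rfl (.empty _)

/-! ### Values -/

/-- A value performs no computation and spawns nothing, so it uses no affine entries and its graph
type collapses to a single vertex by `• ⊕ • = •`. Thus even a lenient typing of a value gives a
strict one, which makes values suitable for substitution into function bodies. -/
theorem HasTyB.value {b : Bool} {Δ : List GKind} {Ω Ψ : VCtx} {Γ : List Con} {v : Exp} {τ : Con}
    {G : GTy} (h : HasTyB b Δ Ω Ψ Γ v τ G) :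
    Value v → HasTyB true Δ .empty Ψ Γ v τ .emp ∧ GEq G .emp := by
  induction h with
  | var | app | fst | snd | case | unroll | future | force | new => intro hv; cases hv
  | triv => intro _; exact ⟨.triv, .refl _⟩
  | fn h h₁ h₂ => intro _; exact ⟨.fn h h₁ h₂, .refl _⟩
  | pair _ _ _ ih₁ ih₂ =>
    intro hv
    cases hv with
    | pair hv₁ hv₂ =>
      exact ⟨.graphEq .unit (.pair (fun _ => .empty_left _) (ih₁ hv₁).1 (ih₂ hv₂).1),
        .trans (.seq (ih₁ hv₁).2 (ih₂ hv₂).2) .unit⟩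
  | inl _ h ih => intro hv; cases hv with | inl hv => exact ⟨.inl (ih hv).1 h, (ih hv).2⟩
  | inr _ h ih => intro hv; cases hv with | inr hv => exact ⟨.inr (ih hv).1 h, (ih hv).2⟩
  | roll _ h ih => intro hv; cases hv with | roll hv => exact ⟨.roll (ih hv).1 h, (ih hv).2⟩
  | typeEq h _ ih => intro hv; exact ⟨.typeEq h (ih hv).1, (ih hv).2⟩
  | handle hp hv _ h ih => intro _; exact ⟨.handle hp hv (ih hv).1 h, .refl _⟩
  | graphEq h _ ih => intro hv; exact ⟨(ih hv).1, .trans (.symm h) (ih hv).2⟩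

theorem Value.vsubst {v : Exp} (h : Value v) (σ : ℕ → VS) : Value (v.vsubst σ) := by
  induction h with
  | triv => exact .triv
  | fn => exact .fn _
  | pair _ _ ih₁ ih₂ => exact .pair ih₁ ih₂
  | inl _ ih => exact .inl ih
  | inr _ ih => exact .inr ih
  | roll _ ih => exact .roll ih
  | handle hp _ ih => exact .handle (by rwa [hp.subst]) ih

theorem Value.erename {v : Exp} (h : Value v) (ρ : ℕ → ℕ) : Value (v.erename ρ) := by
  induction h with
  | triv => exact .triv
  | fn => exact .fn _
  | pair _ _ ih₁ ih₂ => exact .pair ih₁ ih₂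
  | inl _ ih => exact .inl ih
  | inr _ ih => exact .inr ih
  | roll _ ih => exact .roll ih
  | handle hp _ ih => exact .handle hp ih

theorem Value.esubst {v : Exp} (h : Value v) (ε : ℕ → Exp) : Value (v.esubst ε) := by
  induction h with
  | triv => exact .triv
  | fn => exact .fn _
  | pair _ _ ih₁ ih₂ => exact .pair ih₁ ih₂
  | inl _ ih => exact .inl ih
  | inr _ ih => exact .inr ih
  | roll _ ih => exact .roll ih
  | handle hp _ ih => exact .handle hp ih

/-! ### Substitution -/

theorem HasTyB.erename {b : Bool} {Δ : List GKind} {Ω Ψ : VCtx} {Γ : List Con} {e : Exp}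
    {τ : Con} {G : GTy} (h : HasTyB b Δ Ω Ψ Γ e τ G) : ∀ {Γ' : List Con} {ρ : ℕ → ℕ},
      (∀ n τ, Γ[n]? = some τ → Γ'[ρ n]? = some τ) →
      HasTyB b Δ Ω Ψ Γ' (e.erename ρ) τ G := by
  have up {Γ Γ' : List Con} {ρ : ℕ → ℕ} (hρ : ∀ n τ, Γ[n]? = some τ → Γ'[ρ n]? = some τ)
      (c : Con) : ∀ n τ, (c :: Γ)[n]? = some τ → (c :: Γ')[upr ρ n]? = some τ := by
    rintro (_ | n) τ hn
    · exact hn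
    · exact hρ n τ hn
  have map {Γ Γ' : List Con} {ρ : ℕ → ℕ} (hρ : ∀ n τ, Γ[n]? = some τ → Γ'[ρ n]? = some τ)
      (f : Con → Con) : ∀ n τ, (Γ.map f)[n]? = some τ → (Γ'.map f)[ρ n]? = some τ := by
    intro n τ hn
    rw [List.getElem?_map, Option.map_eq_some_iff] at hn ⊢
    obtain ⟨a, ha, rfl⟩ := hn
    exact ⟨a, hρ n a ha, rfl⟩
  induction h with
  | var h => intro _ _ hρ; exact .var (hρ _ _ h)
  | triv => intro _ _ _; exact .triv
  | fn _ h₁ h₂ ih => intro _ _ hρ; exact .fn (ih (up (up (map hρ _) _) _)) h₁ h₂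
  | app hc hc' _ _ h₁ h₂ h₃ ih₁ ih₂ =>
    intro _ _ hρ; exact .app hc hc' (ih₁ hρ) (ih₂ hρ) h₁ h₂ h₃
  | pair hc _ _ ih₁ ih₂ => intro _ _ hρ; exact .pair hc (ih₁ hρ) (ih₂ hρ)
  | fst _ ih => intro _ _ hρ; exact .fst (ih hρ)
  | snd _ ih => intro _ _ hρ; exact .snd (ih hρ)
  | inl _ h ih => intro _ _ hρ; exact .inl (ih hρ) h
  | inr _ h ih => intro _ _ hρ; exact .inr (ih hρ) h
  | case hc _ _ _ ih ih₁ ih₂ =>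
    intro _ _ hρ; exact .case hc (ih hρ) (ih₁ (up hρ _)) (ih₂ (up hρ _))
  | roll _ h ih => intro _ _ hρ; exact .roll (ih hρ) h
  | unroll _ ih => intro _ _ hρ; exact .unroll (ih hρ)
  | future hc _ h₁ h₂ ih => intro _ _ hρ; exact .future hc (ih hρ) h₁ h₂
  | force _ ih => intro _ _ hρ; exact .force (ih hρ)
  | new _ h ih => intro _ _ hρ; exact .new (ih (map hρ _)) h
  | typeEq h _ ih => intro _ _ hρ; exact .typeEq h (ih hρ)
  | handle hp hv _ h ih => intro _ _ hρ; exact .handle hp (hv.erename _) (ih hρ) h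
  | graphEq h _ ih => intro _ _ hρ; exact .graphEq h (ih hρ)

theorem HasTyB.gsubst {b : Bool} {Δ : List GKind} {Ω Ψ : VCtx} {Γ : List Con} {e : Exp}
    {τ : Con} {G : GTy} (h : HasTyB b Δ Ω Ψ Γ e τ G) : ∀ {Δ' : List GKind} {ξ : ℕ → GTy},
      GSubOK ξ Δ Δ' Ψ →
      HasTyB b Δ' Ω Ψ (Γ.map fun c => c.gsubst ξ) e (τ.gsubst ξ) (G.gsubst ξ) := by
  induction h with
  | var h => intro _ _ _; exact .var (by rw [List.getElem?_map, h]; rfl)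
  | triv => intro _ _ _; exact .triv
  | @fn _ Δ Ω Ψ Γ Uf Ut e τ₁ τ₂ G _ h₁ h₂ ih =>
    intro Δ' ξ hξ
    have key := ih ((hξ.up _).push₂ _ _)
    have h₀ : (GTy.gvar 0).gsubst (GTy.upG ξ) = .gvar 0 := rfl
    have hτ (c : Con) : (c.grename Nat.succ).gsubst (fun n => (GTy.upG ξ n).vsubst vshift₂) =
        (c.gsubst fun n => (ξ n).vsubst vshift₂).grename Nat.succ := by
      rw [GTy.upG_vsubst, Con.grename_succ_upG]
    simp only [List.map_cons, List.map_map, Function.comp_def, hτ, ← Con.gsubst_vsubst,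
      Con.gsubst, arrowAnn_gsubst, Con.grename_succ_upG, h₀] at key
    simp only [Con.gsubst, arrowAnn_gsubst]
    refine .fn ?_ (h₁.gsubst (hξ.push₂ _ _)) (h₂.gsubst (hξ.push₂ _ _))
    simpa only [List.map_map, Function.comp_def] using key
  | @app _ _ _ _ _ _ _ _ _ _ _ _ _ uf ut _ _ _ _ _ hc hc' _ _ h₁ h₂ h₃ ih₁ ih₂ =>
    intro _ ξ hξ
    have key₁ := ih₁ hξ
    have key₂ := ih₂ hξ
    simp only [Con.gsubst, arrowAnn_gsubst] at key₁
    have hτ (c : Con) : (c.vsubst (instV₂ uf ut)).gsubst ξ =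
        (c.gsubst fun n => (ξ n).vsubst vshift₂).vsubst (instV₂ uf ut) := by
      simp only [Con.gsubst_vsubst, GTy.vshift₂_instV₂]
    rw [hτ] at key₂ ⊢
    exact .app hc hc' key₁ key₂ h₁ h₂ h₃
  | pair hc _ _ ih₁ ih₂ => intro _ _ hξ; exact .pair hc (ih₁ hξ) (ih₂ hξ)
  | fst _ ih => intro _ _ hξ; exact .fst (ih hξ)
  | snd _ ih => intro _ _ hξ; exact .snd (ih hξ)
  | inl _ h ih => intro _ _ hξ; exact .inl (ih hξ) (h.gsubst hξ)
  | inr _ h ih => intro _ _ hξ; exact .inr (ih hξ) (h.gsubst hξ)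
  | case hc _ _ _ ih ih₁ ih₂ => intro _ _ hξ; exact .case hc (ih hξ) (ih₁ hξ) (ih₂ hξ)
  | roll _ h ih =>
    intro _ _ hξ
    have key := ih hξ
    rw [Con.unroll_gsubst] at key
    exact .roll key (h.gsubst hξ)
  | unroll _ ih =>
    intro _ _ hξ
    rw [Con.unroll_gsubst]
    exact .unroll (ih hξ)
  | future hc _ h₁ h₂ ih => intro _ _ hξ; exact .future hc (ih hξ) h₁ h₂
  | force _ ih => intro _ _ hξ; exact .force (ih hξ)
  | new _ h ih =>
    intro _ _ hξ
    have key := ih (hξ.push _)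
    simp only [List.map_map, Function.comp_def, ← Con.gsubst_vsubst] at key
    refine .new ?_ (h.gsubst hξ)
    simpa only [List.map_map, Function.comp_def] using key
  | typeEq h _ ih => intro _ _ hξ; exact .typeEq (h.gsubst hξ) (ih hξ)
  | handle hp hv _ h ih => intro _ _ hξ; exact .handle hp hv (ih hξ) h
  | graphEq h _ ih => intro _ _ hξ; exact .graphEq (h.gsubst _) (ih hξ)

theorem HasTyB.weaken {b : Bool} {Δ : List GKind} {Ω Ψ : VCtx} {Γ : List Con} {e : Exp}
    {τ : Con} {G : GTy} (h : HasTyB b Δ Ω Ψ Γ e τ G) (K : GKind) :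
    HasTyB b (K :: Δ) Ω Ψ (Γ.map fun c => c.grename Nat.succ) e (τ.grename Nat.succ)
      (G.grename Nat.succ) := by
  simp only [Con.grename_eq, GTy.grename_eq]
  exact h.gsubst (.gvar (ρ := Nat.succ) (fun _ _ hn => hn) _)

/-- The affine variables need to be fixed only for strict typings. In a function body the affine
context holds its own bound parameter alone, which a lifted substitution fixes anyway, so the case
of functions puts no condition on `σ`. -/
theorem HasTyB.vsubst {b : Bool} {Δ : List GKind} {Ω Ψ : VCtx} {Γ : List Con} {e : Exp}
    {τ : Con} {G : GTy} (h : HasTyB b Δ Ω Ψ Γ e τ G) : ∀ {Ψ' : VCtx} {σ : ℕ → VS},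
      SubOK σ Ψ Ψ' → (b = true → FixOn σ Ω) →
      HasTyB b Δ Ω Ψ' (Γ.map fun c => c.vsubst σ) (e.vsubst σ) (τ.vsubst σ) (G.vsubst σ) := by
  induction h with
  | var h => intro _ _ _ _; exact .var (by rw [List.getElem?_map, h]; rfl)
  | triv => intro _ _ _ _; exact .triv
  | fn _ h₁ h₂ ih =>
    intro _ σ hσ _
    have key := ih ((hσ.up _).up _) fun _ => ((FixOn.empty σ).push _).push _
    simp only [List.map_cons, List.map_map, Function.comp_def, Con.vshift₂_comm,
      Con.grename_vsubst] at key
    simp only [Con.vsubst, arrowAnn_vsubst]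
    refine .fn ?_ (h₁.vsubst ((hσ.up _).up _)) (h₂.vsubst ((hσ.up _).up _))
    simpa only [List.map_map, Function.comp_def, Con.grename_vsubst, Con.vsubst,
      arrowAnn_vsubst, GTy.vsubst] using key
  | app hc hc' _ _ h₁ h₂ h₃ ih₁ ih₂ =>
    intro _ _ hσ hΩ
    have key₁ := ih₁ hσ fun hb => (hΩ hb).left (hc hb)
    have key₂ := ih₂ hσ fun hb => ((hΩ hb).right (hc hb)).left (hc' hb)
    simp only [Con.vsubst, arrowAnn_vsubst] at key₁
    rw [Con.vsubst_instV₂] at key₂ ⊢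
    exact .app hc hc' key₁ key₂
      (fun hb => (h₁ hb).subst (.empty _ _) (((hΩ hb).right (hc hb)).right (hc' hb)))
      (h₂.subst hσ (.empty _)) (h₃.subst hσ (.empty _))
  | pair hc _ _ ih₁ ih₂ =>
    intro _ _ hσ hΩ
    exact .pair hc (ih₁ hσ fun hb => (hΩ hb).left (hc hb))
      (ih₂ hσ fun hb => (hΩ hb).right (hc hb))
  | fst _ ih => intro _ _ hσ hΩ; exact .fst (ih hσ hΩ)
  | snd _ ih => intro _ _ hσ hΩ; exact .snd (ih hσ hΩ)
  | inl _ h ih => intro _ _ hσ hΩ; exact .inl (ih hσ hΩ) (h.vsubst hσ)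
  | inr _ h ih => intro _ _ hσ hΩ; exact .inr (ih hσ hΩ) (h.vsubst hσ)
  | case hc _ _ _ ih ih₁ ih₂ =>
    intro _ _ hσ hΩ
    exact .case hc (ih hσ fun hb => (hΩ hb).left (hc hb))
      (ih₁ hσ fun hb => (hΩ hb).right (hc hb)) (ih₂ hσ fun hb => (hΩ hb).right (hc hb))
  | roll _ h ih =>
    intro _ _ hσ hΩ
    have key := ih hσ hΩ
    rw [Con.unroll_vsubst] at key
    exact .roll key (h.vsubst hσ)
  | unroll _ ih =>
    intro _ _ hσ hΩ
    rw [Con.unroll_vsubst]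
    exact .unroll (ih hσ hΩ)
  | future hc _ h₁ h₂ ih =>
    intro _ _ hσ hΩ
    exact .future hc (ih hσ fun hb => (hΩ hb).left (hc hb))
      (fun hb => (h₁ hb).subst (.empty _ _) ((hΩ hb).right (hc hb))) (h₂.subst hσ (.empty _))
  | force _ ih => intro _ _ hσ hΩ; exact .force (ih hσ hΩ)
  | new _ h ih =>
    intro _ _ hσ hΩ
    have key := ih (hσ.up _) fun hb => (hΩ hb).push _
    simp only [List.map_map, Function.comp_def, Con.vshift_comm] at key
    refine .new ?_ (h.vsubst hσ)
    simpa only [List.map_map, Function.comp_def] using key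
  | typeEq h _ ih => intro _ _ hσ hΩ; exact .typeEq (h.vsubst hσ) (ih hσ hΩ)
  | handle hp hv _ h ih =>
    intro _ _ hσ hΩ
    exact .handle (by rwa [hp.subst]) (hv.vsubst _) (ih hσ fun _ => .empty _)
      (h.subst hσ (.empty _))
  | graphEq h _ ih => intro _ _ hσ hΩ; exact .graphEq (h.vsubst _) (ih hσ hΩ)

/-- The values `ε` for the variables of `Γ` are well typed. -/
def ESubOK (Δ : List GKind) (Ψ : VCtx) (ε : ℕ → Exp) (Γ Γ' : List Con) : Prop :=
  ∀ n τ, Γ[n]? = some τ → HasTyB true Δ .empty Ψ Γ' (ε n) τ .emp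

theorem ESubOK.up {Δ : List GKind} {Ψ : VCtx} {ε : ℕ → Exp} {Γ Γ' : List Con}
    (h : ESubOK Δ Ψ ε Γ Γ') (c : Con) : ESubOK Δ Ψ (Exp.upE ε) (c :: Γ) (c :: Γ') := by
  rintro (_ | n) τ hn
  · exact .var hn
  · exact (h n τ hn).erename fun _ _ hn => hn

theorem ESubOK.vsubst {Δ : List GKind} {Ψ Ψ' : VCtx} {ε : ℕ → Exp} {Γ Γ' : List Con}
    {σ : ℕ → VS} (h : ESubOK Δ Ψ ε Γ Γ') (hσ : SubOK σ Ψ Ψ') :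
    ESubOK Δ Ψ' (fun n => (ε n).vsubst σ) (Γ.map fun c => c.vsubst σ)
      (Γ'.map fun c => c.vsubst σ) := by
  intro n τ hn
  rw [List.getElem?_map, Option.map_eq_some_iff] at hn
  obtain ⟨c, hc, rfl⟩ := hn
  exact (h n c hc).vsubst hσ fun _ => .empty _

theorem ESubOK.weaken {Δ : List GKind} {Ψ : VCtx} {ε : ℕ → Exp} {Γ Γ' : List Con}
    (h : ESubOK Δ Ψ ε Γ Γ') (K : GKind) :
    ESubOK (K :: Δ) Ψ ε (Γ.map fun c => c.grename Nat.succ)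
      (Γ'.map fun c => c.grename Nat.succ) := by
  intro n τ hn
  rw [List.getElem?_map, Option.map_eq_some_iff] at hn
  obtain ⟨c, hc, rfl⟩ := hn
  exact (h n c hc).weaken K

/-- The expressions substituted are typed strictly and without affine entries: they can be
duplicated, fit every part of a split, and may land inside the body of a function. -/
theorem HasTyB.esubst {b : Bool} {Δ : List GKind} {Ω Ψ : VCtx} {Γ : List Con} {e : Exp}
    {τ : Con} {G : GTy} (h : HasTyB b Δ Ω Ψ Γ e τ G) : ∀ {Γ' : List Con} {ε : ℕ → Exp},
      ESubOK Δ Ψ ε Γ Γ' → HasTyB b Δ Ω Ψ Γ' (e.esubst ε) τ G := by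
  induction h with
  | var h => intro _ _ hε; exact (hε _ _ h).of_empty _
  | triv => intro _ _ _; exact .triv
  | @fn _ _ _ _ _ Uf Ut _ _ _ _ _ h₁ h₂ ih =>
    intro _ _ hε
    have key := (hε.weaken (.pi Uf Ut .graph)).vsubst (.vshift₂ _ (some Uf) (some Ut))
    simp only [List.map_map, Function.comp_def] at key
    exact .fn (ih ((key.up _).up _)) h₁ h₂
  | app hc hc' _ _ h₁ h₂ h₃ ih₁ ih₂ =>
    intro _ _ hε; exact .app hc hc' (ih₁ hε) (ih₂ hε) h₁ h₂ h₃
  | pair hc _ _ ih₁ ih₂ => intro _ _ hε; exact .pair hc (ih₁ hε) (ih₂ hε)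
  | fst _ ih => intro _ _ hε; exact .fst (ih hε)
  | snd _ ih => intro _ _ hε; exact .snd (ih hε)
  | inl _ h ih => intro _ _ hε; exact .inl (ih hε) h
  | inr _ h ih => intro _ _ hε; exact .inr (ih hε) h
  | case hc _ _ _ ih ih₁ ih₂ =>
    intro _ _ hε; exact .case hc (ih hε) (ih₁ (hε.up _)) (ih₂ (hε.up _))
  | roll _ h ih => intro _ _ hε; exact .roll (ih hε) h
  | unroll _ ih => intro _ _ hε; exact .unroll (ih hε)
  | future hc _ h₁ h₂ ih => intro _ _ hε; exact .future hc (ih hε) h₁ h₂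
  | force _ ih => intro _ _ hε; exact .force (ih hε)
  | new _ h ih => intro _ _ hε; exact .new (ih (hε.vsubst (.vshift _ _))) h
  | typeEq h _ ih => intro _ _ hε; exact .typeEq h (ih hε)
  | handle hp hv _ h ih => intro _ _ hε; exact .handle hp (hv.esubst _) (ih hε) h
  | graphEq h _ ih => intro _ _ hε; exact .graphEq h (ih hε)

/-! ### Regularity -/

/-- Well-formedness of the graph type is available only for strict typings, but closedness holds for
lenient ones as well. It is recorded separately since the existence of normal forms relies on it. -/
theorem HasTyB.regular {b : Bool} {Δ : List GKind} {Ω Ψ : VCtx} {Γ : List Con} {e : Exp}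
    {τ : Con} {G : GTy} (h : HasTyB b Δ Ω Ψ Γ e τ G) : (∀ c ∈ Γ, HasKind Δ Ψ [] c .ty) →
      HasKind Δ Ψ [] τ .ty ∧ (b = true → DagWF Δ Ω Ψ G .graph) ∧ G.Closed Δ.length := by
  induction h with
  | var h =>
    intro hΓ
    exact ⟨hΓ _ (List.mem_of_getElem? h), fun _ => .emp, trivial⟩
  | triv => intro _; exact ⟨.unit, fun _ => .emp, trivial⟩
  | fn _ h₁ h₂ ih =>
    intro hΓ
    -- Here the strictness of function bodies is indispensable: the kind of the function type
    -- requires its recursive graph type to be well formed.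
    refine ⟨.fn h₁ h₂ (.recPi ((ih ?_).2.1 rfl)), fun _ => .emp, trivial⟩
    intro c hc
    rcases List.mem_cons.1 hc with rfl | hc
    · exact h₁.weaken _
    rcases List.mem_cons.1 hc with rfl | hc
    · exact (HasKind.fn (h₁.weaken _) (h₂.weaken _) (.gvar rfl)).vsubst (.vshift₂ _ _ _)
    · obtain ⟨c, hc', rfl⟩ := List.mem_map.1 hc
      exact ((hΓ c hc').weaken _).vsubst (.vshift₂ _ _ _)
  | app hc hc' _ _ h₁ h₂ h₃ ih₁ ih₂ =>
    intro hΓ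
    obtain ⟨k₁, d₁, c₁⟩ := ih₁ hΓ
    obtain ⟨k₂, d₂, c₂⟩ := ih₂ hΓ
    obtain ⟨_, kτ, dG⟩ := k₁.fn_inv
    refine ⟨kτ.vsubst (.instV₂ h₂ h₃), fun hb => ?_, ⟨c₁, c₂⟩, dG.closed⟩
    -- Typing splits as `Ω₁, (Ω₂, Ω₃)`, whereas the graph type `(G₁ ⊕ G₂) ⊕ G₃[uf; ut]` needs `(Ω₁,
    -- Ω₂), Ω₃`.
    obtain ⟨_, hd, hd'⟩ := (hc hb).assoc (hc' hb)
    exact .seq hd (.seq hd' (d₁ hb) (d₂ hb)) (.app (.empty_left _) dG (h₁ hb) h₂ h₃)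
  | pair hc _ _ ih₁ ih₂ =>
    intro hΓ
    obtain ⟨k₁, d₁, c₁⟩ := ih₁ hΓ
    obtain ⟨k₂, d₂, c₂⟩ := ih₂ hΓ
    exact ⟨.prod k₁ k₂, fun hb => .seq (hc hb) (d₁ hb) (d₂ hb), c₁, c₂⟩
  | fst _ ih =>
    intro hΓ
    obtain ⟨k, h⟩ := ih hΓ
    cases k with
    | prod k _ => exact ⟨k, h⟩
  | snd _ ih =>
    intro hΓ
    obtain ⟨k, h⟩ := ih hΓ
    cases k with
    | prod _ k => exact ⟨k, h⟩
  | inl _ h ih => intro hΓ; exact ⟨.sum (ih hΓ).1 h, (ih hΓ).2⟩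
  | inr _ h ih => intro hΓ; exact ⟨.sum h (ih hΓ).1, (ih hΓ).2⟩
  | case hc _ _ _ ih ih₁ ih₂ =>
    intro hΓ
    obtain ⟨k, d, c⟩ := ih hΓ
    cases k with
    | sum k₁ k₂ =>
      obtain ⟨k, d₁, c₁⟩ := ih₁ (List.forall_mem_cons.2 ⟨k₁, hΓ⟩)
      obtain ⟨_, d₂, c₂⟩ := ih₂ (List.forall_mem_cons.2 ⟨k₂, hΓ⟩)
      exact ⟨k, fun hb => .seq (hc hb) (d hb) (.or (d₁ hb) (d₂ hb)), c, c₁, c₂⟩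
  | roll _ h ih => intro hΓ; exact ⟨h, (ih hΓ).2⟩
  | unroll _ ih => intro hΓ; exact ⟨(ih hΓ).1.unroll, (ih hΓ).2⟩
  | future hc _ h₁ h₂ ih =>
    intro hΓ
    obtain ⟨k, d, c⟩ := ih hΓ
    exact ⟨.fut k h₂, fun hb => .spawn (hc hb) (d hb) (h₁ hb), c⟩
  | force _ ih =>
    intro hΓ
    obtain ⟨k, d, c⟩ := ih hΓ
    cases k with
    | fut k hu => exact ⟨k, fun hb => .seq (.empty_right _) (d hb) (.touch hu), c, trivial⟩
  | new _ h ih =>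
    intro hΓ
    obtain ⟨_, d, c⟩ := ih fun c hc => by
      obtain ⟨c, hc', rfl⟩ := List.mem_map.1 hc
      exact (hΓ c hc').vsubst (.vshift _ _)
    exact ⟨h, fun hb => .new (d hb), c⟩
  | typeEq h _ ih => intro hΓ; exact ⟨h.hasKind.2, (ih hΓ).2⟩
  | handle _ _ _ h ih => intro hΓ; exact ⟨.fut (ih hΓ).1 h, fun _ => .emp, trivial⟩
  | graphEq h _ ih =>
    intro hΓ
    obtain ⟨k, d, c⟩ := ih hΓ
    exact ⟨k, fun hb => h.dagWF_iff.1 (d hb), (h.closed_iff _).1 c⟩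

/-! ## Unrolling up to normalization of vertex structures -/

namespace GTy

theorem nf_ren (G : GTy) : ∀ {σ : ℕ → VS}, VS.IsRen σ → (G.vsubst σ).nf = G.nf.vsubst σ := by
  induction G <;> intro σ h <;> simp only [vsubst, nf, VS.nf_ren h]
  case seq ih₁ ih₂ | or ih₁ ih₂ => rw [ih₁ h, ih₂ h]
  case mu ih | spawn ih | app ih => rw [ih h]
  case pi ih => rw [ih h.up.up]
  case new ih => rw [ih h.up]

theorem nf_grename (G : GTy) : ∀ ρ : ℕ → ℕ, (G.grename ρ).nf = G.nf.grename ρ := by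
  induction G <;> intro ρ <;> simp_all [grename, nf]

theorem nf_upG (ξ : ℕ → GTy) : (fun n => (upG ξ n).nf) = upG fun n => (ξ n).nf := by
  funext n
  cases n with
  | zero => rfl
  | succ n => exact nf_grename _ _

theorem nf_gsubst (G : GTy) : ∀ ξ : ℕ → GTy, (G.gsubst ξ).nf = G.nf.gsubst fun n => (ξ n).nf := by
  induction G <;> intro ξ <;> simp only [gsubst, nf]
  case seq ih₁ ih₂ | or ih₁ ih₂ => rw [ih₁, ih₂]
  case mu ih => rw [ih, nf_upG]
  case spawn ih | app ih => rw [ih]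
  case pi ih => rw [ih]; simp only [nf_ren _ VS.IsRen.vshift₂]
  case new ih => rw [ih]; simp only [nf_ren _ VS.IsRen.vshift]

theorem nf_instG (G : GTy) : (fun n => (instG G n).nf) = instG G.nf := by
  funext n; cases n <;> rfl

/-- `A` is the instance of `G` under `σ`, up to normalization of vertex structures. -/
def Inst (σ : ℕ → VS) (G A : GTy) : Prop := (G.vsubst σ).nf = A.nf

theorem Inst.trans {σ : ℕ → VS} {G A B : GTy} (h : G.Inst σ A) (h' : A.nf = B.nf) : G.Inst σ B :=
  Eq.trans h h'

variable {σ : ℕ → VS} {G A : GTy}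

theorem Inst.emp_inv (h : G.Inst σ .emp) : G = .emp := by
  cases G <;> simp only [Inst, vsubst, nf, reduceCtorEq] at h ⊢

theorem Inst.seq_inv {A₁ A₂ : GTy} (h : G.Inst σ (.seq A₁ A₂)) :
    ∃ G₁ G₂, G = .seq G₁ G₂ ∧ G₁.Inst σ A₁ ∧ G₂.Inst σ A₂ := by
  cases G <;> simp only [Inst, vsubst, nf, reduceCtorEq, seq.injEq] at h
  exact ⟨_, _, rfl, h⟩

theorem Inst.or_inv {A₁ A₂ : GTy} (h : G.Inst σ (.or A₁ A₂)) :
    ∃ G₁ G₂, G = .or G₁ G₂ ∧ G₁.Inst σ A₁ ∧ G₂.Inst σ A₂ := by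
  cases G <;> simp only [Inst, vsubst, nf, reduceCtorEq, or.injEq] at h
  exact ⟨_, _, rfl, h⟩

theorem Inst.mu_inv (h : G.Inst σ (.mu A)) : ∃ G', G = .mu G' ∧ G'.Inst σ A := by
  cases G <;> simp only [Inst, vsubst, nf, reduceCtorEq, mu.injEq] at h
  exact ⟨_, rfl, h⟩

theorem Inst.spawn_inv {u : VS} (h : G.Inst σ (.spawn A u)) :
    ∃ G' u', G = .spawn G' u' ∧ G'.Inst σ A ∧ (u'.subst σ).nf = u.nf := by
  cases G <;> simp only [Inst, vsubst, nf, reduceCtorEq, spawn.injEq] at h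
  exact ⟨_, _, rfl, h⟩

theorem Inst.pi_inv {Uf Ut : VSTy} (h : G.Inst σ (.pi Uf Ut A)) :
    ∃ G', G = .pi Uf Ut G' ∧ G'.Inst (upV (upV σ)) A := by
  cases G <;> simp only [Inst, vsubst, nf, reduceCtorEq, pi.injEq] at h
  obtain ⟨rfl, rfl, h⟩ := h
  exact ⟨_, rfl, h⟩

theorem Inst.app_inv {uf ut : VS} (h : G.Inst σ (.app A uf ut)) :
    ∃ G' uf' ut', G = .app G' uf' ut' ∧ G'.Inst σ A ∧ (uf'.subst σ).nf = uf.nf ∧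
      (ut'.subst σ).nf = ut.nf := by
  cases G <;> simp only [Inst, vsubst, nf, reduceCtorEq, app.injEq] at h
  exact ⟨_, _, _, rfl, h⟩

theorem Inst.new_inv {U : VSTy} (h : G.Inst σ (.new U A)) :
    ∃ G', G = .new U G' ∧ G'.Inst (upV σ) A := by
  cases G <;> simp only [Inst, vsubst, nf, reduceCtorEq, new.injEq] at h
  obtain ⟨rfl, h⟩ := h
  exact ⟨_, rfl, h⟩

theorem Inst.seq {G₁ G₂ A₁ A₂ : GTy} (h₁ : G₁.Inst σ A₁) (h₂ : G₂.Inst σ A₂) :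
    (GTy.seq G₁ G₂).Inst σ (.seq A₁ A₂) := congrArg₂ GTy.seq h₁ h₂

theorem Inst.or {G₁ G₂ A₁ A₂ : GTy} (h₁ : G₁.Inst σ A₁) (h₂ : G₂.Inst σ A₂) :
    (GTy.or G₁ G₂).Inst σ (.or A₁ A₂) := congrArg₂ GTy.or h₁ h₂

theorem Inst.mu (h : G.Inst σ A) : (GTy.mu G).Inst σ (.mu A) := congrArg GTy.mu h

theorem Inst.spawn {u u' : VS} (h : G.Inst σ A) (hu : (u.subst σ).nf = u'.nf) :
    (GTy.spawn G u).Inst σ (.spawn A u') := congrArg₂ GTy.spawn h hu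

theorem Inst.pi (Uf Ut : VSTy) (h : G.Inst (upV (upV σ)) A) :
    (GTy.pi Uf Ut G).Inst σ (.pi Uf Ut A) := congrArg (GTy.pi Uf Ut) h

theorem Inst.app {uf uf' ut ut' : VS} (h : G.Inst σ A) (hf : (uf.subst σ).nf = uf'.nf)
    (ht : (ut.subst σ).nf = ut'.nf) : (GTy.app G uf ut).Inst σ (.app A uf' ut') := by
  simp only [Inst, vsubst, nf, hf, ht, show (G.vsubst σ).nf = A.nf from h]

theorem Inst.new (U : VSTy) (h : G.Inst (upV σ) A) : (GTy.new U G).Inst σ (.new U A) :=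
  congrArg (GTy.new U) h

/-- One unfolding commutes with substitution of vertex structures and with their normalization; this
is the only case of lifting that is not purely structural. -/
theorem Inst.unfold (h : G.Inst σ A) :
    (G.gsubst (instG (.mu G))).Inst σ (A.gsubst (instG (.mu A))) := by
  simp only [Inst, gsubst_vsubst, nf_gsubst, instG_vsubst, nf_instG]
  simp only [vsubst, nf, show (G.vsubst σ).nf = A.nf from h]

end GTy

open GTy in
-- The identification is insensitive to vertex structures, so each of its steps on an instance is
-- matched by a step on the original. Both directions are carried along because of symmetry.
theorem GEq.lift {A B : GTy} (h : GEq A B) : ∀ σ : ℕ → VS,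
    (∀ G, G.Inst σ A → ∃ G', GEq G G' ∧ G'.Inst σ B) ∧
    (∀ G, G.Inst σ B → ∃ G', GEq G G' ∧ G'.Inst σ A) := by
  induction h with
  | unit =>
    intro σ
    refine ⟨fun G hG => ?_, fun G hG => ?_⟩
    · obtain ⟨_, _, rfl, h₁, h₂⟩ := hG.seq_inv
      obtain rfl := h₁.emp_inv
      obtain rfl := h₂.emp_inv
      exact ⟨_, .unit, rfl⟩
    · obtain rfl := hG.emp_inv
      exact ⟨_, .symm .unit, rfl⟩
  | refl => exact fun σ => ⟨fun G hG => ⟨G, .refl _, hG⟩, fun G hG => ⟨G, .refl _, hG⟩⟩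
  | symm _ ih => exact fun σ => (ih σ).symm
  | trans _ _ ih₁ ih₂ =>
    intro σ
    refine ⟨fun G hG => ?_, fun G hG => ?_⟩
    · obtain ⟨_, e, h⟩ := (ih₁ σ).1 G hG
      obtain ⟨_, e', h'⟩ := (ih₂ σ).1 _ h
      exact ⟨_, e.trans e', h'⟩
    · obtain ⟨_, e, h⟩ := (ih₂ σ).2 G hG
      obtain ⟨_, e', h'⟩ := (ih₁ σ).2 _ h
      exact ⟨_, e.trans e', h'⟩
  | seq _ _ ih₁ ih₂ =>
    intro σ
    refine ⟨fun G hG => ?_, fun G hG => ?_⟩ <;> obtain ⟨_, _, rfl, h₁, h₂⟩ := hG.seq_inv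
    · obtain ⟨_, e, h⟩ := (ih₁ σ).1 _ h₁
      obtain ⟨_, e', h'⟩ := (ih₂ σ).1 _ h₂
      exact ⟨_, .seq e e', h.seq h'⟩
    · obtain ⟨_, e, h⟩ := (ih₁ σ).2 _ h₁
      obtain ⟨_, e', h'⟩ := (ih₂ σ).2 _ h₂
      exact ⟨_, .seq e e', h.seq h'⟩
  | or _ _ ih₁ ih₂ =>
    intro σ
    refine ⟨fun G hG => ?_, fun G hG => ?_⟩ <;> obtain ⟨_, _, rfl, h₁, h₂⟩ := hG.or_inv
    · obtain ⟨_, e, h⟩ := (ih₁ σ).1 _ h₁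
      obtain ⟨_, e', h'⟩ := (ih₂ σ).1 _ h₂
      exact ⟨_, .or e e', h.or h'⟩
    · obtain ⟨_, e, h⟩ := (ih₁ σ).2 _ h₁
      obtain ⟨_, e', h'⟩ := (ih₂ σ).2 _ h₂
      exact ⟨_, .or e e', h.or h'⟩
  | mu _ ih =>
    intro σ
    refine ⟨fun G hG => ?_, fun G hG => ?_⟩ <;> obtain ⟨_, rfl, h⟩ := hG.mu_inv
    · obtain ⟨_, e, h⟩ := (ih σ).1 _ h
      exact ⟨_, .mu e, h.mu⟩
    · obtain ⟨_, e, h⟩ := (ih σ).2 _ h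
      exact ⟨_, .mu e, h.mu⟩
  | spawn _ _ ih =>
    intro σ
    refine ⟨fun G hG => ?_, fun G hG => ?_⟩ <;> obtain ⟨_, _, rfl, h, hu⟩ := hG.spawn_inv
    · obtain ⟨_, e, h⟩ := (ih σ).1 _ h
      exact ⟨_, .spawn _ e, h.spawn hu⟩
    · obtain ⟨_, e, h⟩ := (ih σ).2 _ h
      exact ⟨_, .spawn _ e, h.spawn hu⟩
  | pi _ _ _ ih =>
    intro σ
    refine ⟨fun G hG => ?_, fun G hG => ?_⟩ <;> obtain ⟨_, rfl, h⟩ := hG.pi_inv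
    · obtain ⟨_, e, h⟩ := (ih _).1 _ h
      exact ⟨_, .pi _ _ e, h.pi _ _⟩
    · obtain ⟨_, e, h⟩ := (ih _).2 _ h
      exact ⟨_, .pi _ _ e, h.pi _ _⟩
  | app _ _ _ ih =>
    intro σ
    refine ⟨fun G hG => ?_, fun G hG => ?_⟩ <;> obtain ⟨_, _, _, rfl, h, hf, ht⟩ := hG.app_inv
    · obtain ⟨_, e, h⟩ := (ih σ).1 _ h
      exact ⟨_, .app _ _ e, h.app hf ht⟩
    · obtain ⟨_, e, h⟩ := (ih σ).2 _ h
      exact ⟨_, .app _ _ e, h.app hf ht⟩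
  | new _ _ ih =>
    intro σ
    refine ⟨fun G hG => ?_, fun G hG => ?_⟩ <;> obtain ⟨_, rfl, h⟩ := hG.new_inv
    · obtain ⟨_, e, h⟩ := (ih _).1 _ h
      exact ⟨_, .new _ e, h.new _⟩
    · obtain ⟨_, e, h⟩ := (ih _).2 _ h
      exact ⟨_, .new _ e, h.new _⟩

/-- A substitution of vertex structures introduces no `mu`, so every redex of the instance comes
from one in `G`. -/
theorem Unr.lift {A B : GTy} (h : Unr A B) : ∀ {σ : ℕ → VS} {G : GTy},
    G.Inst σ A → ∃ G', Unr G G' ∧ G'.Inst σ B := by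
  induction h with
  | seq1 _ _ ih =>
    intro σ G hG
    obtain ⟨_, _, rfl, h₁, h₂⟩ := hG.seq_inv
    obtain ⟨_, e, h⟩ := ih h₁
    exact ⟨_, .seq1 _ e, h.seq h₂⟩
  | seq2 _ _ ih =>
    intro σ G hG
    obtain ⟨_, _, rfl, h₁, h₂⟩ := hG.seq_inv
    obtain ⟨_, e, h⟩ := ih h₂
    exact ⟨_, .seq2 _ e, h₁.seq h⟩
  | or1 _ _ ih =>
    intro σ G hG
    obtain ⟨_, _, rfl, h₁, h₂⟩ := hG.or_inv
    obtain ⟨_, e, h⟩ := ih h₁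
    exact ⟨_, .or1 _ e, h.or h₂⟩
  | or2 _ _ ih =>
    intro σ G hG
    obtain ⟨_, _, rfl, h₁, h₂⟩ := hG.or_inv
    obtain ⟨_, e, h⟩ := ih h₂
    exact ⟨_, .or2 _ e, h₁.or h⟩
  | future _ _ ih =>
    intro σ G hG
    obtain ⟨_, _, rfl, h, hu⟩ := hG.spawn_inv
    obtain ⟨_, e, h⟩ := ih h
    exact ⟨_, .future _ e, h.spawn hu⟩
  | mu _ =>
    intro σ G hG
    obtain ⟨_, rfl, h⟩ := hG.mu_inv
    exact ⟨_, .mu _, h.unfold⟩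
  | pi _ _ _ ih =>
    intro σ G hG
    obtain ⟨_, rfl, h⟩ := hG.pi_inv
    obtain ⟨_, e, h⟩ := ih h
    exact ⟨_, .pi _ _ e, h.pi _ _⟩
  | app _ _ _ ih =>
    intro σ G hG
    obtain ⟨_, _, _, rfl, h, hf, ht⟩ := hG.app_inv
    obtain ⟨_, e, h⟩ := ih h
    exact ⟨_, .app _ _ e, h.app hf ht⟩
  | new _ _ ih =>
    intro σ G hG
    obtain ⟨_, rfl, h⟩ := hG.new_inv
    obtain ⟨_, e, h⟩ := ih h
    exact ⟨_, .new _ e, h.new _⟩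

namespace UnrStar

theorem lift {A B : GTy} (h : UnrStar A B) {σ : ℕ → VS} {G : GTy} (hG : G.Inst σ A) :
    ∃ G', UnrStar G G' ∧ G'.Inst σ B := by
  induction h with
  | refl => exact ⟨G, .refl, hG⟩
  | tail _ h ih =>
    obtain ⟨_, e, hi⟩ := ih
    rcases h with h | h
    · obtain ⟨_, e', hi'⟩ := h.lift hi
      exact ⟨_, e.tail (.inl e'), hi'⟩
    · obtain ⟨_, e', hi'⟩ := (h.lift σ).1 _ hi
      exact ⟨_, e.tail (.inr e'), hi'⟩

theorem map {G G' : GTy} (h : UnrStar G G') (F : GTy → GTy)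
    (hU : ∀ {A B}, Unr A B → Unr (F A) (F B)) (hE : ∀ {A B}, GEq A B → GEq (F A) (F B)) :
    UnrStar (F G) (F G') :=
  by
  induction h with
  | refl => exact .refl
  | tail _ h ih => exact ih.tail (h.imp hU hE)

theorem seq {G₁ G₂ G₁' G₂' : GTy} (h₁ : UnrStar G₁ G₁') (h₂ : UnrStar G₂ G₂') :
    UnrStar (.seq G₁ G₂) (.seq G₁' G₂') :=
  .trans (h₁.map (.seq · G₂) (.seq1 _) fun h => .seq h (.refl _))
    (h₂.map (.seq G₁' ·) (.seq2 _) (.seq (.refl _)))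

end UnrStar

/-! ## Normal forms up to normalization of vertex structures -/

/-- The same generators can be chosen for both. The expansions are equal, and not merely similar,
because the vertex structures that expansion reads have been normalized. -/
theorem NBNF.congr {S T : Finset ℕ} {A H : GTy} (h : NBNF S A H T) :
    ∀ {B : GTy}, A.nf = B.nf →
      ∃ H', NBNF S B H' T ∧ H.nf = H'.nf ∧ H.expand = H'.expand := by
  induction h with
  | emp => intro B hB; cases B <;> cases hB; exact ⟨_, .emp _, rfl, rfl⟩
  | seq _ _ ih₁ ih₂ =>
    intro B hB
    cases B <;> simp only [GTy.nf, reduceCtorEq, GTy.seq.injEq] at hB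
    obtain ⟨_, h₁, e₁, x₁⟩ := ih₁ hB.1
    obtain ⟨_, h₂, e₂, x₂⟩ := ih₂ hB.2
    exact ⟨_, .seq h₁ h₂, by simp only [GTy.nf, e₁, e₂], by simp only [GTy.expand, x₁, x₂]⟩
  | or _ _ ih₁ ih₂ =>
    intro B hB
    cases B <;> simp only [GTy.nf, reduceCtorEq, GTy.or.injEq] at hB
    obtain ⟨_, h₁, e₁, x₁⟩ := ih₁ hB.1
    obtain ⟨_, h₂, e₂, x₂⟩ := ih₂ hB.2
    exact ⟨_, .or h₁ h₂, by simp only [GTy.nf, e₁, e₂], by simp only [GTy.expand, x₁, x₂]⟩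
  | mu =>
    intro B hB
    cases B <;> simp only [GTy.nf, reduceCtorEq, GTy.mu.injEq] at hB
    exact ⟨_, .mu _ _, by simp only [GTy.nf, hB], rfl⟩
  | spawn _ hu ih =>
    intro B hB
    cases B <;> simp only [GTy.nf, reduceCtorEq, GTy.spawn.injEq] at hB
    obtain ⟨_, h, e, x⟩ := ih hB.1
    rw [hu.eq_nf, hB.2]
    exact ⟨_, .spawn h (.nf _), by simp only [GTy.nf, e], by simp only [GTy.expand, x]⟩
  | touch _ hu =>
    intro B hB
    cases B <;> simp only [GTy.nf, reduceCtorEq, GTy.touch.injEq] at hB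
    rw [hu.eq_nf, hB]
    exact ⟨_, .touch _ (.nf _), rfl, rfl⟩
  | new _ hs _ ih =>
    intro B hB
    cases B <;> simp only [GTy.nf, reduceCtorEq, GTy.new.injEq] at hB
    obtain ⟨_, h, e⟩ := ih (GTy.nf_vsubst_congr hB.2 fun _ => rfl)
    exact ⟨_, .new _ hs h, e⟩
  | pi =>
    intro B hB
    cases B <;> simp only [GTy.nf, reduceCtorEq, GTy.pi.injEq] at hB
    exact ⟨_, .pi _ _ _ _, by simp only [GTy.nf, hB], rfl⟩
  | appPi _ _ ih₁ ih₂ =>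
    intro B hB
    cases B <;> simp only [GTy.nf, reduceCtorEq, GTy.app.injEq] at hB
    obtain ⟨H, h, e, _⟩ := ih₁ hB.1
    cases H <;> simp only [GTy.nf, reduceCtorEq, GTy.pi.injEq] at e
    obtain ⟨_, h', e'⟩ := ih₂ (GTy.nf_vsubst_congr e.2.2 (σ' := instV₂ _ _) fun n => by
      match n with
      | 0 => exact hB.2.2
      | 1 => exact hB.2.1
      | n + 2 => rfl)
    exact ⟨_, .appPi h h', e'⟩
  | @appOther _ _ _ H _ _ _ hH ih =>
    intro B hB
    cases B <;> simp only [GTy.nf, reduceCtorEq, GTy.app.injEq] at hB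
    obtain ⟨H', h, e, _⟩ := ih hB.1
    refine ⟨_, .appOther h ?_, by simp only [GTy.nf, hB], rfl⟩
    rintro Uf Ut G' rfl
    cases H <;> simp only [GTy.nf, reduceCtorEq] at e
    exact hH _ _ _ rfl

/-! ## Existence of normal forms of closed graph types -/

namespace GTy

/-- The number of nodes of a graph type. -/
def size : GTy → ℕ
  | gvar _ => 1
  | emp => 1
  | seq G₁ G₂ => G₁.size + G₂.size + 1
  | or G₁ G₂ => G₁.size + G₂.size + 1
  | mu G => G.size + 1
  | spawn G _ => G.size + 1
  | touch _ => 1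
  | pi _ _ G => G.size + 1
  | app G _ _ => G.size + 1
  | new _ G => G.size + 1

@[simp] theorem size_vsubst (G : GTy) : ∀ σ : ℕ → VS, (G.vsubst σ).size = G.size := by
  induction G <;> intro σ <;> simp_all [vsubst, size]

theorem closed_vsubst (G : GTy) : ∀ (σ : ℕ → VS) (n : ℕ), (G.vsubst σ).Closed n ↔ G.Closed n := by
  induction G <;> intro σ n <;> simp_all [vsubst, Closed]

end GTy

/-- Normalization never unrolls recursion, and inserting vertex structures keeps the size. So the
body exposed in an application is smaller than the application, which makes the recursion terminate.
-/
theorem NBNF.size_le {S T : Finset ℕ} {G H : GTy} (h : NBNF S G H T) : H.size ≤ G.size := by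
  induction h <;> simp_all only [GTy.size, GTy.size_vsubst] <;> omega

theorem NBNF.closed {S T : Finset ℕ} {G H : GTy} (h : NBNF S G H T) :
    ∀ n : ℕ, G.Closed n → H.Closed n := by
  induction h with
  | emp | mu | touch | pi | appOther => exact fun _ h => h
  | seq _ _ ih₁ ih₂ | or _ _ ih₁ ih₂ => exact fun n h => ⟨ih₁ n h.1, ih₂ n h.2⟩
  | spawn _ _ ih => exact fun n h => ih n h
  | new _ _ _ ih => exact fun n h => ih n ((GTy.closed_vsubst _ _ _).2 h)
  | appPi _ _ ih₁ ih₂ => exact fun n h => ih₂ n ((GTy.closed_vsubst _ _ _).2 (ih₁ n h))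

/-- The fresh generators of a normal form can be chosen outside of any finite set `A`. -/
theorem GTy.Closed.exists_nbnf {G : GTy} (h : G.Closed 0) (S A : Finset ℕ) :
    ∃ H T, NBNF S G H T ∧ ∀ s ∈ T, s ∈ A → s ∈ S := by
  induction hn : G.size using Nat.strong_induction_on generalizing G S with
  | _ n ih =>
  subst hn
  cases G with
  | gvar m => exact absurd h (Nat.not_lt_zero m)
  | emp => exact ⟨_, _, .emp S, fun _ h _ => h⟩
  | seq G₁ G₂ =>
    obtain ⟨_, T₁, h₁, hT₁⟩ := ih _ (by simp only [GTy.size]; omega) h.1 S rfl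
    obtain ⟨_, T₂, h₂, hT₂⟩ := ih _ (by simp only [GTy.size]; omega) h.2 T₁ rfl
    exact ⟨_, _, .seq h₁ h₂, fun s hs hA => hT₁ s (hT₂ s hs hA) hA⟩
  | or G₁ G₂ =>
    obtain ⟨_, T₁, h₁, hT₁⟩ := ih _ (by simp only [GTy.size]; omega) h.1 S rfl
    obtain ⟨_, T₂, h₂, hT₂⟩ := ih _ (by simp only [GTy.size]; omega) h.2 T₁ rfl
    exact ⟨_, _, .or h₁ h₂, fun s hs hA => hT₁ s (hT₂ s hs hA) hA⟩
  | mu G => exact ⟨_, _, .mu S G, fun _ h _ => h⟩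
  | spawn G u =>
    obtain ⟨_, T, h₁, hT⟩ := ih _ (by simp only [GTy.size]; omega) (G := G) h S rfl
    exact ⟨_, _, .spawn h₁ (.nf u), hT⟩
  | touch u => exact ⟨_, _, .touch S (.nf u), fun _ h _ => h⟩
  | pi Uf Ut G => exact ⟨_, _, .pi S Uf Ut G, fun _ h _ => h⟩
  | app G uf ut =>
    obtain ⟨H, T, h₁, hT⟩ := ih _ (by simp only [GTy.size]; omega) (G := G) h S rfl
    by_cases hH : ∃ Uf Ut G', H = .pi Uf Ut G'
    · obtain ⟨Uf, Ut, G', rfl⟩ := hH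
      have hsize := h₁.size_le
      obtain ⟨_, T₂, h₂, hT₂⟩ := ih (G := G'.vsubst (instV₂ uf ut)) _
        (by simp only [GTy.size, GTy.size_vsubst] at hsize ⊢; omega)
        ((GTy.closed_vsubst _ _ _).2 (h₁.closed 0 h)) T rfl
      exact ⟨_, _, .appPi h₁ h₂, fun s hs hA => hT s (hT₂ s hs hA) hA⟩
    · exact ⟨_, _, .appOther h₁ fun Uf Ut G' e => hH ⟨Uf, Ut, G', e⟩, hT⟩
  | new U G =>
    -- Outside of `S` for freshness, outside of `A` for the additional claim.
    obtain ⟨s, hs⟩ := Infinite.exists_notMem_finset (S ∪ A)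
    simp only [Finset.mem_union, not_or] at hs
    obtain ⟨_, T, h₁, hT⟩ := ih (G := G.vsubst (instV (.gen s))) _
      (by simp only [GTy.size, GTy.size_vsubst]; omega) ((GTy.closed_vsubst _ _ _).2 h)
      (insert s S) rfl
    refine ⟨_, _, .new U hs.1 h₁, fun r hr hA => ?_⟩
    rcases Finset.mem_insert.1 (hT r hr hA) with rfl | hr
    · exact absurd hA hs.2
    · exact hr

/-! ## Graphs of graph types -/

/-- `g` is a graph of some unrolling of `G`; `T` consists of `S` and the generators chosen. -/
def Reach (S : Finset ℕ) (G : GTy) (g : CGraph) (T : Finset ℕ) : Prop :=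
  ∃ G' H, UnrStar G G' ∧ NBNF S G' H T ∧ g ∈ H.expand

namespace Reach

variable {S S₁ T : Finset ℕ} {G G₁ G₂ : GTy} {g g₁ g₂ g₁₂ : CGraph}

theorem emp (S : Finset ℕ) (h : g.IsEmp) : Reach S .emp g S := ⟨_, _, .refl, .emp S, h⟩

theorem seq (h₁ : Reach S G₁ g₁ S₁) (h₂ : Reach S₁ G₂ g₂ T) (hg : CGraph.IsSeq g₁ g₂ g₁₂) :
    Reach S (.seq G₁ G₂) g₁₂ T := by
  obtain ⟨_, _, u₁, n₁, x₁⟩ := h₁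
  obtain ⟨_, _, u₂, n₂, x₂⟩ := h₂
  exact ⟨_, _, u₁.seq u₂, .seq n₁ n₂, _, x₁, _, x₂, hg⟩

theorem orLeft {H₂ : GTy} (h₁ : Reach S G₁ g S₁) (h₂ : NBNF S₁ G₂ H₂ T) :
    Reach S (.or G₁ G₂) g T := by
  obtain ⟨_, _, u₁, n₁, x₁⟩ := h₁
  exact ⟨_, _, u₁.map (.or · G₂) (.or1 _) fun h => .or h (.refl _), .or n₁ h₂, .inl x₁⟩

theorem orRight {H₁ : GTy} (h₁ : NBNF S G₁ H₁ S₁) (h₂ : Reach S₁ G₂ g T) :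
    Reach S (.or G₁ G₂) g T := by
  obtain ⟨_, _, u₂, n₂, x₂⟩ := h₂
  exact ⟨_, _, u₂.map (.or G₁ ·) (.or2 _) (.or (.refl _)), .or h₁ n₂, .inr x₂⟩

theorem spawn {u p : VS} (h : Reach S G g₁ T) (hu : VSEval u p) (hg : CGraph.IsSpawn g₁ p g) :
    Reach S (.spawn G u) g T := by
  obtain ⟨_, _, u', n, x⟩ := h
  exact ⟨_, _, u'.map (.spawn · u) (.future _) (.spawn _), .spawn n hu, _, x, hg⟩

theorem touch {u p : VS} (S : Finset ℕ) (hu : VSEval u p) (hg : CGraph.IsTouch p g) :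
    Reach S (.touch u) g S := ⟨_, _, .refl, .touch S hu, hg⟩

/-- Unrolling and normalization of an instance of a graph type lift to the graph type. -/
theorem lift {σ : ℕ → VS} {A : GTy} (h : Reach S A g T) (hG : G.Inst σ A) :
    ∃ G' H, UnrStar G G' ∧ NBNF S (G'.vsubst σ) H T ∧ g ∈ H.expand := by
  obtain ⟨_, _, u, n, x⟩ := h
  obtain ⟨_, u', hi⟩ := u.lift hG
  obtain ⟨_, n', -, x'⟩ := n.congr (Eq.symm hi)
  exact ⟨_, _, u', n', x' ▸ x⟩

theorem new {s : ℕ} (U : VSTy) (hs : s ∉ S)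
    (h : Reach (insert s S) (G.vsubst (instV (.gen s))) g T) : Reach S (.new U G) g T := by
  obtain ⟨_, _, u, n, x⟩ := h.lift (G := G) rfl
  exact ⟨_, _, u.map (.new U) (.new _) (.new _), .new U hs n, x⟩

/-- One unrolling exposes the `pi`. All later unrolling of the instantiated body is lifted to take
place under that `pi`, so that the arguments are inserted only during normalization. -/
theorem app {Uf Ut : VSTy} {uf ut : VS}
    (h : Reach S ((G.gsubst (GTy.instG ((GTy.mu (.pi Uf Ut G)).vsubst vshift₂))).vsubst
      (instV₂ uf ut)) g T) :
    Reach S (.app (.mu (.pi Uf Ut G)) uf ut) g T := by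
  obtain ⟨_, _, u, n, x⟩ := h.lift rfl
  refine ⟨_, _, .head (.inl (.app _ _ (.mu _))) ?_, .appPi (.pi _ Uf Ut _) n, x⟩
  simp only [GTy.gsubst, GTy.instG_vsubst]
  exact u.map (fun G => .app (.pi Uf Ut G) uf ut) (fun h => .app _ _ (.pi _ _ h))
    fun h => .app _ _ (.pi _ _ h)

/-- Lifting along the identity substitution turns the identification of normalized graph types into
one step from `G` itself, after which only normalization of vertex structures separates the result
from `A`. -/
theorem sim {A : GTy} (h : Reach S A g T) (hG : GSim G A) : Reach S G g T := by
  obtain ⟨G₁, e, hi⟩ := (GEq.lift hG VS.var).1 G (by simp [GTy.Inst])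
  obtain ⟨_, _, u, n, x⟩ := h.lift (hi.trans (GTy.nf_nf A))
  rw [GTy.vsubst_var] at n
  exact ⟨_, _, .head (.inr e) u, n, x⟩

end Reach

/-! ### Choices of fresh generators -/

/-- The graph `g`, which an evaluation has produced while the generators in use grew from `S` to
`S'`, is a graph of `G` under every choice of the generators in use that avoids those the
evaluation has created. -/
def Cost (S S' : Finset ℕ) (G : GTy) (g : CGraph) : Prop :=
  ∀ T A : Finset ℕ, (∀ s ∈ S', s ∉ S → s ∉ T) →
    ∃ T', Reach T G g T' ∧ ∀ s ∈ T', s ∈ A → s ∈ T ∨ s ∈ S' ∧ s ∉ S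

namespace Cost

variable {S S₁ S' : Finset ℕ} {G G₁ G₂ : GTy} {g g₁ g₂ g₁₂ : CGraph}

theorem of_reach (h : ∀ T, Reach T G g T) (S S' : Finset ℕ) : Cost S S' G g :=
  fun T _ _ => ⟨T, h T, fun _ hs _ => .inl hs⟩

theorem map (h : Cost S S' G₁ g₁) (hR : ∀ {T T'}, Reach T G₁ g₁ T' → Reach T G₂ g₂ T') :
    Cost S S' G₂ g₂ := by
  intro T A hT
  obtain ⟨T', h', hT'⟩ := h T A hT
  exact ⟨T', hR h', hT'⟩

theorem sim (h : Cost S S' G₁ g) (hG : GSim G₁ G₂) : Cost S S' G₂ g :=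
  h.map fun h => h.sim hG.symm

theorem seq (h₁ : Cost S S₁ G₁ g₁) (h₂ : Cost S₁ S' G₂ g₂) (hg : CGraph.IsSeq g₁ g₂ g₁₂)
    (hS : S ⊆ S₁) (hS' : S₁ ⊆ S') : Cost S S' (.seq G₁ G₂) g₁₂ := by
  intro T A hT
  -- Besides `A`, the first normal form has to avoid `S'`. Otherwise a generator spent on one of its
  -- branches that was not evaluated might coincide with one that the second evaluation creates.
  obtain ⟨T₁, r₁, hT₁⟩ := h₁ T (A ∪ S') fun s hs => hT s (hS' hs)
  obtain ⟨T₂, r₂, hT₂⟩ := h₂ T₁ A fun s hs hs₁ hsT => by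
    rcases hT₁ s hsT (Finset.mem_union_right _ hs) with h | h
    · exact hT s hs (fun h => hs₁ (hS h)) h
    · exact hs₁ h.1
  refine ⟨T₂, r₁.seq r₂ hg, fun s hs hA => ?_⟩
  rcases hT₂ s hs hA with h | h
  · exact (hT₁ s h (Finset.mem_union_left _ hA)).imp_right fun h => ⟨hS' h.1, h.2⟩
  · exact .inr ⟨h.1, fun h' => h.2 (hS h')⟩

/-- The branch not taken must still be normalized. It comes last here, so avoiding `A` is enough. -/
theorem orLeft (h₁ : Cost S S' G₁ g) (h₂ : G₂.Closed 0) : Cost S S' (.or G₁ G₂) g := by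
  intro T A hT
  obtain ⟨T₁, r₁, hT₁⟩ := h₁ T A hT
  obtain ⟨_, T₂, n₂, hT₂⟩ := h₂.exists_nbnf T₁ A
  exact ⟨T₂, r₁.orLeft n₂, fun s hs hA => hT₁ s (hT₂ s hs hA) hA⟩

theorem orRight (h₁ : G₁.Closed 0) (h₂ : Cost S S' G₂ g) : Cost S S' (.or G₁ G₂) g := by
  intro T A hT
  -- Now the branch not taken is normalized first, and its generators must leave those of the
  -- evaluation free.
  obtain ⟨_, T₁, n₁, hT₁⟩ := h₁.exists_nbnf T (A ∪ S')
  obtain ⟨T₂, r₂, hT₂⟩ := h₂ T₁ A fun s hs hs' hsT =>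
    hT s hs hs' (hT₁ s hsT (Finset.mem_union_right _ hs))
  exact ⟨T₂, r₂.orRight n₁, fun s hs hA =>
    (hT₂ s hs hA).imp_left fun h => hT₁ s h (Finset.mem_union_left _ hA)⟩

/-- The normal form picks the very generator that the evaluation picked. This is allowed because the
generators in use avoid everything the evaluation has created. -/
theorem new {s : ℕ} (U : VSTy) (hs : s ∉ S) (hs' : s ∈ S')
    (h : Cost (insert s S) S' (G.vsubst (instV (.gen s))) g) : Cost S S' (.new U G) g := by
  intro T A hT
  obtain ⟨T', r, hT'⟩ := h (insert s T) A fun r hr hr' hrT => by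
    simp only [Finset.mem_insert, not_or] at hr' hrT
    exact hT r hr hr'.2 (hrT.resolve_left hr'.1)
  refine ⟨T', r.new U (hT s hs' hs), fun r hr hA => ?_⟩
  rcases hT' r hr hA with h | h
  · rcases Finset.mem_insert.1 h with rfl | h
    · exact .inr ⟨hs', hs⟩
    · exact .inl h
  · exact .inr ⟨h.1, fun h' => h.2 (Finset.mem_insert_of_mem h')⟩

end Cost

/-! ## Generation -/

/-- The syntax-directed rules of the typing of closed expressions without affine premises. -/
inductive Gen (Ψ : VCtx) : Exp → Con → GTy → Prop
  | triv : Gen Ψ .triv .unit .emp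
  | fn {Uf Ut : VSTy} {e : Exp} {τ₁ τ₂ : Con} {G : GTy} :
      HasTyB true [.pi Uf Ut .graph] ((VCtx.empty.push (some Uf)).push none)
        ((Ψ.push (some Uf)).push (some Ut))
        [τ₁.grename Nat.succ, (Con.fn Uf Ut (τ₁.grename Nat.succ) (τ₂.grename Nat.succ)
          (arrowAnn (.gvar 0))).vsubst vshift₂]
        e (τ₂.grename Nat.succ) G →
      HasKind [] ((Ψ.push (some Uf)).push (some Ut)) [] τ₁ .ty →
      HasKind [] ((Ψ.push (some Uf)).push (some Ut)) [] τ₂ .ty →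
      Gen Ψ (.fn e) (.fn Uf Ut τ₁ τ₂ (arrowAnn (.mu (.pi Uf Ut G)))) .emp
  | app {Uf Ut : VSTy} {e₁ e₂ : Exp} {uf ut : VS} {τ₁ τ₂ : Con} {G₁ G₂ G₃ : GTy} :
      HasTyB false [] .empty Ψ [] e₁ (.fn Uf Ut τ₁ τ₂ (arrowAnn G₃)) G₁ →
      HasTyB false [] .empty Ψ [] e₂ (τ₁.vsubst (instV₂ uf ut)) G₂ →
      HasVS .empty Ψ uf Uf → HasVS .empty Ψ ut Ut →
      Gen Ψ (.app e₁ uf ut e₂) (τ₂.vsubst (instV₂ uf ut)) (.seq (.seq G₁ G₂) (.app G₃ uf ut))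
  | pair {e₁ e₂ : Exp} {τ₁ τ₂ : Con} {G₁ G₂ : GTy} :
      HasTyB false [] .empty Ψ [] e₁ τ₁ G₁ → HasTyB false [] .empty Ψ [] e₂ τ₂ G₂ →
      Gen Ψ (.pair e₁ e₂) (.prod τ₁ τ₂) (.seq G₁ G₂)
  | fst {e : Exp} {τ₁ τ₂ : Con} {G : GTy} :
      HasTyB false [] .empty Ψ [] e (.prod τ₁ τ₂) G → Gen Ψ (.fst e) τ₁ G
  | snd {e : Exp} {τ₁ τ₂ : Con} {G : GTy} :
      HasTyB false [] .empty Ψ [] e (.prod τ₁ τ₂) G → Gen Ψ (.snd e) τ₂ G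
  | inl {e : Exp} {τ₁ τ₂ : Con} {G : GTy} : HasTyB false [] .empty Ψ [] e τ₁ G →
      HasKind [] Ψ [] τ₂ .ty → Gen Ψ (.inl e) (.sum τ₁ τ₂) G
  | inr {e : Exp} {τ₁ τ₂ : Con} {G : GTy} : HasTyB false [] .empty Ψ [] e τ₂ G →
      HasKind [] Ψ [] τ₁ .ty → Gen Ψ (.inr e) (.sum τ₁ τ₂) G
  | case {e e₁ e₂ : Exp} {τ₁ τ₂ τ : Con} {G₁ G₂ G₃ : GTy} :
      HasTyB false [] .empty Ψ [] e (.sum τ₁ τ₂) G₁ → HasTyB false [] .empty Ψ [τ₁] e₁ τ G₂ →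
      HasTyB false [] .empty Ψ [τ₂] e₂ τ G₃ →
      Gen Ψ (.case e e₁ e₂) τ (.seq G₁ (.or G₂ G₃))
  | roll {e : Exp} {U : VSTy} {τ : Con} {u : VS} {G : GTy} :
      HasTyB false [] .empty Ψ [] e (Con.unroll U τ u) G → HasKind [] Ψ [] (.recty U τ u) .ty →
      Gen Ψ (.roll e) (.recty U τ u) G
  | unroll {e : Exp} {U : VSTy} {τ : Con} {u : VS} {G : GTy} :
      HasTyB false [] .empty Ψ [] e (.recty U τ u) G → Gen Ψ (.unroll e) (Con.unroll U τ u) G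
  | future {e : Exp} {τ : Con} {u : VS} {G : GTy} :
      HasTyB false [] .empty Ψ [] e τ G → HasVS .empty Ψ u .vty →
      Gen Ψ (.future u e) (.fut τ u) (.spawn G u)
  | force {e : Exp} {τ : Con} {u : VS} {G : GTy} :
      HasTyB false [] .empty Ψ [] e (.fut τ u) G → Gen Ψ (.force e) τ (.seq G (.touch u))
  | new {U : VSTy} {e : Exp} {τ : Con} {G : GTy} :
      HasTyB false [] .empty (Ψ.push (some U)) [] e (τ.vsubst vshift) G →
      Gen Ψ (.new U e) τ (.new U G)
  | handle {p : VS} {v : Exp} {τ : Con} : Value v → HasTyB false [] .empty Ψ [] v τ .emp →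
      HasVS .empty Ψ p .vty → IsPath p → Gen Ψ (.handle p v) (.fut τ p) .emp

/-- The two conversion rules are peeled off and composed. Equality of types is kept as a separate
alternative since reflexivity of equivalence presupposes a well-kinded type; `HasTyB.gen` supplies
this by regularity. -/
theorem HasTyB.gen_aux {b : Bool} {Δ : List GKind} {Ω Ψ : VCtx} {Γ : List Con} {e : Exp} {τ : Con}
    {G : GTy} (h : HasTyB b Δ Ω Ψ Γ e τ G) : Δ = [] → Γ = [] →
      ∃ τ' G', Gen Ψ e τ' G' ∧ (τ' = τ ∨ ConEq [] Ψ [] τ' τ .ty) ∧ GEq G' G := by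
  induction h with
  | var h => rintro rfl rfl; cases h
  | triv => rintro rfl rfl; exact ⟨_, _, .triv, .inl rfl, .refl _⟩
  | fn h h₁ h₂ => rintro rfl rfl; exact ⟨_, _, .fn h h₁ h₂, .inl rfl, .refl _⟩
  | app _ _ h₁ h₂ _ hf ht =>
    rintro rfl rfl; exact ⟨_, _, .app (h₁.relax _) (h₂.relax _) hf ht, .inl rfl, .refl _⟩
  | pair _ h₁ h₂ => rintro rfl rfl; exact ⟨_, _, .pair (h₁.relax _) (h₂.relax _), .inl rfl, .refl _⟩
  | fst h => rintro rfl rfl; exact ⟨_, _, .fst (h.relax _), .inl rfl, .refl _⟩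
  | snd h => rintro rfl rfl; exact ⟨_, _, .snd (h.relax _), .inl rfl, .refl _⟩
  | inl h hk => rintro rfl rfl; exact ⟨_, _, .inl (h.relax _) hk, .inl rfl, .refl _⟩
  | inr h hk => rintro rfl rfl; exact ⟨_, _, .inr (h.relax _) hk, .inl rfl, .refl _⟩
  | case _ h h₁ h₂ =>
    rintro rfl rfl
    exact ⟨_, _, .case (h.relax _) (h₁.relax _) (h₂.relax _), .inl rfl, .refl _⟩
  | roll h hk => rintro rfl rfl; exact ⟨_, _, .roll (h.relax _) hk, .inl rfl, .refl _⟩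
  | unroll h => rintro rfl rfl; exact ⟨_, _, .unroll (h.relax _), .inl rfl, .refl _⟩
  | future _ h _ hu => rintro rfl rfl; exact ⟨_, _, .future (h.relax _) hu, .inl rfl, .refl _⟩
  | force h => rintro rfl rfl; exact ⟨_, _, .force (h.relax _), .inl rfl, .refl _⟩
  | new h => rintro rfl rfl; exact ⟨_, _, .new (h.relax _), .inl rfl, .refl _⟩
  | typeEq hc _ ih =>
    rintro rfl rfl
    obtain ⟨_, _, hg, hτ, hG⟩ := ih rfl rfl
    refine ⟨_, _, hg, .inr ?_, hG⟩
    rcases hτ with rfl | hτ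
    · exact hc
    · exact .trans hτ hc
  | handle hp hv h hu => rintro rfl rfl; exact ⟨_, _, .handle hv (h.relax _) hu hp, .inl rfl, .refl _⟩
  | graphEq hG _ ih =>
    rintro rfl rfl
    obtain ⟨_, _, hg, hτ, hG'⟩ := ih rfl rfl
    exact ⟨_, _, hg, hτ, hG'.trans hG⟩

section Inversion

variable {b : Bool} {Ω Ψ : VCtx} {τ τ₁ τ₂ : Con} {G : GTy}

theorem HasTyB.gen {e : Exp} (h : HasTyB b [] Ω Ψ [] e τ G) :
    ∃ τ' G', Gen Ψ e τ' G' ∧ ConEq [] Ψ [] τ' τ .ty ∧ GEq G' G := by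
  obtain ⟨_, _, hg, hτ, hG⟩ := h.gen_aux rfl rfl
  refine ⟨_, _, hg, ?_, hG⟩
  rcases hτ with rfl | hτ
  · exact .refl (h.regular (by simp)).1
  · exact hτ

theorem HasTyB.pair_inv {v₁ v₂ : Exp} (h : HasTyB b [] Ω Ψ [] (.pair v₁ v₂) (.prod τ₁ τ₂) G)
    (hv₁ : Value v₁) (hv₂ : Value v₂) :
    HasTyB true [] .empty Ψ [] v₁ τ₁ .emp ∧ HasTyB true [] .empty Ψ [] v₂ τ₂ .emp := by
  obtain ⟨_, _, hg, hτ, -⟩ := h.gen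
  cases hg with
  | pair h₁ h₂ =>
    exact ⟨.typeEq hτ.prod_inj.1 (h₁.value hv₁).1, .typeEq hτ.prod_inj.2 (h₂.value hv₂).1⟩

theorem HasTyB.inl_inv {v : Exp} (h : HasTyB b [] Ω Ψ [] (.inl v) (.sum τ₁ τ₂) G) (hv : Value v) :
    HasTyB true [] .empty Ψ [] v τ₁ .emp := by
  obtain ⟨_, _, hg, hτ, -⟩ := h.gen
  cases hg with
  | inl h => exact .typeEq hτ.sum_inj.1 (h.value hv).1

theorem HasTyB.inr_inv {v : Exp} (h : HasTyB b [] Ω Ψ [] (.inr v) (.sum τ₁ τ₂) G) (hv : Value v) :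
    HasTyB true [] .empty Ψ [] v τ₂ .emp := by
  obtain ⟨_, _, hg, hτ, -⟩ := h.gen
  cases hg with
  | inr h => exact .typeEq hτ.sum_inj.2 (h.value hv).1

theorem HasTyB.roll_inv {v : Exp} {U : VSTy} {u : VS}
    (h : HasTyB b [] Ω Ψ [] (.roll v) (.recty U τ u) G) (hv : Value v) :
    HasTyB true [] .empty Ψ [] v (Con.unroll U τ u) .emp := by
  obtain ⟨_, _, hg, hτ, -⟩ := h.gen
  cases hg with
  | roll h' =>
    obtain ⟨rfl, hc, hu⟩ := hτ.recty_inj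
    exact .typeEq (hc.unroll hu) (h'.value hv).1

/-- The type of a handle names its path only up to equivalence, that is, up to normal form; a path
is its own normal form. So the touch of `u` in the graph type normalizes to a touch of the actual
path. -/
theorem HasTyB.handle_inv {v : Exp} {p u : VS} (h : HasTyB b [] Ω Ψ [] (.handle p v) (.fut τ u) G) :
    HasTyB true [] .empty Ψ [] v τ .emp ∧ VSEval u p := by
  obtain ⟨_, _, hg, hτ, -⟩ := h.gen
  cases hg with
  | handle hv h _ hp =>
    refine ⟨.typeEq hτ.fut_inj.1 (h.value hv).1, ?_⟩
    rw [← hp.nf_eq, hτ.fut_inj.2.inv.2.2]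
    exact .nf u

/-- The recursive graph type is substituted for its variable in the typing of the body. This makes
the assumption on the recursive occurrence agree with the type of the function itself, and the graph
type of the body becomes its one-step unrolling. -/
theorem HasTyB.app_fn {e v : Exp} {Uf Ut : VSTy} {uf ut : VS} {G₃ : GTy}
    (h : HasTyB b [] Ω Ψ [] (.fn e) (.fn Uf Ut τ₁ τ₂ (arrowAnn G₃)) G)
    (hf : HasVS .empty Ψ uf Uf) (ht : HasVS .empty Ψ ut Ut)
    (hv : HasTyB true [] .empty Ψ [] v (τ₁.vsubst (instV₂ uf ut)) .emp) :
    ∃ G', HasTyB false [] .empty Ψ [] ((e.vsubst (instV₂ uf ut)).esubst (Exp.instE₂ (.fn e) v))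
        (τ₂.vsubst (instV₂ uf ut))
        ((G'.gsubst (GTy.instG ((GTy.mu (.pi Uf Ut G')).vsubst vshift₂))).vsubst
          (instV₂ uf ut)) ∧
      GSim (.mu (.pi Uf Ut G')) G₃ := by
  obtain ⟨_, _, hg, hτ, -⟩ := h.gen
  have hk := hτ.hasKind.1
  have hF := (h.value (.fn e)).1
  cases hg with
  | @fn Uf Ut _ τ₁' τ₂' G' hb h₁ h₂ =>
    obtain ⟨rfl, rfl, hτ₁, hτ₂, hG⟩ := hτ.fn_inj
    refine ⟨G', .typeEq (hτ₂.vsubst (.instV₂ hf ht)) ?_, hG⟩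
    -- The body is relaxed before its parameters are instantiated, because that instantiation does
    -- not fix the affine parameter.
    have hb' := (hb.gsubst (.instG (hk.fn_inv.2.2.vsubst (.vshift₂ _ _ _) (.empty _)))).relax
      .empty |>.vsubst (.instV₂ hf ht) nofun
    have hF' := HasTyB.typeEq (.comm hτ) hF
    have hv' := HasTyB.typeEq (.comm (hτ₁.vsubst (.instV₂ hf ht))) hv
    have hFn : (Con.fn Uf Ut (τ₁'.grename Nat.succ) (τ₂'.grename Nat.succ)
        (arrowAnn (.gvar 0))).gsubst (GTy.instG (.mu (.pi Uf Ut G'))) =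
        .fn Uf Ut τ₁' τ₂' (arrowAnn (.mu (.pi Uf Ut G'))) := by
      simp only [Con.gsubst, arrowAnn_gsubst]
      simp only [GTy.instG_vsubst, Con.grename_succ_instG]
      rfl
    simp only [List.map_cons, List.map_nil, Con.gsubst_vsubst, Con.grename_succ_instG,
      Con.vshift₂_instV₂, GTy.instG_vsubst, GTy.vshift₂_instV₂, hFn] at hb'
    refine hb'.esubst ?_
    rintro (_ | _ | n) c hn <;> cases hn
    · exact hv'
    · exact hF'

end Inversion

/-! ## Evaluation -/

theorem Eval.value_and_subset {S S' : Finset ℕ} {e v : Exp} {g : CGraph} (h : Eval S e v g S') :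
    Value v ∧ S ⊆ S' := by
  induction h with
  | value hv => exact ⟨hv, fun _ h => h⟩
  | app _ _ _ _ _ ih₁ ih₂ ih₃ => exact ⟨ih₃.1, ih₁.2.trans (ih₂.2.trans ih₃.2)⟩
  | pair _ _ _ ih₁ ih₂ => exact ⟨.pair ih₁.1 ih₂.1, ih₁.2.trans ih₂.2⟩
  | fst _ ih => cases ih.1 with | pair h _ => exact ⟨h, ih.2⟩
  | snd _ ih => cases ih.1 with | pair _ h => exact ⟨h, ih.2⟩
  | inl _ ih => exact ⟨.inl ih.1, ih.2⟩
  | inr _ ih => exact ⟨.inr ih.1, ih.2⟩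
  | caseL _ _ _ ih₁ ih₂ | caseR _ _ _ ih₁ ih₂ => exact ⟨ih₂.1, ih₁.2.trans ih₂.2⟩
  | roll _ ih => exact ⟨.roll ih.1, ih.2⟩
  | unroll _ ih => cases ih.1 with | roll h => exact ⟨h, ih.2⟩
  | future _ _ hp _ ih => exact ⟨.handle hp ih.1, ih.2⟩
  | force _ _ _ ih => cases ih.1 with | handle _ h => exact ⟨h, ih.2⟩
  | new _ _ ih => exact ⟨ih.1, (Finset.subset_insert _ _).trans ih.2⟩

/-! ### Contexts that grow with the generators in use -/

namespace VCtx

/-- All generators in the domain of `Ψ` belong to `S`. -/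
def GensIn (Ψ : VCtx) (S : Finset ℕ) : Prop := ∀ s U, Ψ (.gen s) = some U → s ∈ S

/-- `Ψ'` extends `Ψ` by distinct generators in `S'` that are not in `S`. -/
def Grow (S S' : Finset ℕ) (Ψ Ψ' : VCtx) : Prop :=
  ∃ L : List (ℕ × VSTy), (L.map Prod.fst).Nodup ∧ (∀ s ∈ L.map Prod.fst, s ∉ S ∧ s ∈ S') ∧
    Ψ' = Ψ.addGens L

theorem mem_of_lookup {L : List (ℕ × VSTy)} {s : ℕ} {U : VSTy} (h : L.lookup s = some U) :
    s ∈ L.map Prod.fst := by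
  obtain ⟨l₁, l₂, rfl, -⟩ := List.lookup_eq_some_iff.1 h
  simp

variable {S S₁ S' : Finset ℕ} {Ψ Ψ₁ Ψ' : VCtx}

theorem Grow.refl (S S' : Finset ℕ) (Ψ : VCtx) : Grow S S' Ψ Ψ := by
  refine ⟨[], by simp, by simp, ?_⟩
  funext r
  cases r <;> simp [addGens]

theorem Grow.trans (h : Grow S S₁ Ψ Ψ₁) (h' : Grow S₁ S' Ψ₁ Ψ') (hS : S ⊆ S₁) (hS' : S₁ ⊆ S') :
    Grow S S' Ψ Ψ' := by
  obtain ⟨L, hd, hL, rfl⟩ := h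
  obtain ⟨L', hd', hL', rfl⟩ := h'
  refine ⟨L' ++ L, ?_, ?_, ?_⟩
  · rw [List.map_append, List.nodup_append]
    exact ⟨hd', hd, fun s hs r hr e => (hL' s hs).1 (e ▸ (hL r hr).2)⟩
  · intro s hs
    rw [List.map_append, List.mem_append] at hs
    rcases hs with hs | hs
    · exact ⟨fun h => (hL' s hs).1 (hS h), (hL' s hs).2⟩
    · exact ⟨(hL s hs).1, hS' (hL s hs).2⟩
  · funext r
    cases r with
    | var n => rfl
    | gen s => simp only [addGens, List.lookup_append, Option.or_assoc]

theorem Grow.gensIn (h : Grow S S' Ψ Ψ') (hΨ : Ψ.GensIn S) (hS : S ⊆ S') : Ψ'.GensIn S' := by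
  obtain ⟨L, -, hL, rfl⟩ := h
  intro s U hs
  simp only [addGens, Option.or_eq_some_iff] at hs
  rcases hs with hs | ⟨-, hs⟩
  · exact (hL s (mem_of_lookup hs)).2
  · exact hS (hΨ s U hs)

/-- An added generator could shadow an old entry; freshness with respect to `S`, which contains the
old generators, excludes this. -/
theorem Grow.sub (h : Grow S S' Ψ Ψ') (hΨ : Ψ.GensIn S) : Ψ.Sub Ψ' := by
  obtain ⟨L, -, hL, rfl⟩ := h
  rintro (n | s) U hr
  · exact hr
  · rcases hl : L.lookup s with _ | V
    · simp only [addGens, hl, hr, Option.none_or]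
    · exact absurd (hΨ s U hr) (hL s (mem_of_lookup hl)).1

theorem Grow.single {s : ℕ} (hs : s ∉ S) (U : VSTy) :
    Grow S (insert s S) Ψ (Ψ.addGens [(s, U)]) :=
  ⟨[(s, U)], by simp, by simp [hs], rfl⟩

end VCtx

section Weakening

variable {Ψ Ψ' : VCtx}

theorem HasVS.weakenCtx {u : VS} {U : VSTy} (h : HasVS .empty Ψ u U) (hs : Ψ.Sub Ψ') :
    HasVS .empty Ψ' u U := by
  simpa only [VS.subst_var] using h.subst (.of_sub hs) (.empty _)

theorem HasKind.weakenCtx {c : Con} {k : Kind} (h : HasKind [] Ψ [] c k) (hs : Ψ.Sub Ψ') :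
    HasKind [] Ψ' [] c k := by
  simpa only [Con.vsubst_var] using h.vsubst (.of_sub hs)

theorem ConEq.weakenCtx {c c' : Con} {k : Kind} (h : ConEq [] Ψ [] c c' k) (hs : Ψ.Sub Ψ') :
    ConEq [] Ψ' [] c c' k := by
  simpa only [Con.vsubst_var] using h.vsubst (.of_sub hs)

theorem HasTyB.weakenCtx {b : Bool} {Ω : VCtx} {Γ : List Con} {e : Exp} {τ : Con} {G : GTy}
    (h : HasTyB b [] Ω Ψ Γ e τ G) (hs : Ψ.Sub Ψ') : HasTyB b [] Ω Ψ' Γ e τ G := by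
  simpa only [Con.vsubst_var, Exp.vsubst_var, GTy.vsubst_var, List.map_id'] using
    h.vsubst (.of_sub hs) fun _ _ _ => rfl

end Weakening

theorem HasKind.sum_inv {Δ : List GKind} {Ψ : VCtx} {Θ : List Kind} {c₁ c₂ : Con} {k : Kind}
    (h : HasKind Δ Ψ Θ (.sum c₁ c₂) k) : HasKind Δ Ψ Θ c₁ .ty ∧ HasKind Δ Ψ Θ c₂ .ty := by
  cases h with
  | sum h₁ h₂ => exact ⟨h₁, h₂⟩

theorem ESubOK.instE {Δ : List GKind} {Ψ : VCtx} {Γ : List Con} {v : Exp} {τ : Con}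
    (h : HasTyB true Δ .empty Ψ Γ v τ .emp) : ESubOK Δ Ψ (Exp.instE v) (τ :: Γ) Γ := by
  rintro (_ | n) c hn
  · cases hn; exact h
  · exact .var hn

/-! ### Soundness -/

/-- The conclusions of soundness for an evaluation to `v` with graph `g`. -/
def Sound (S S' : Finset ℕ) (Ψ : VCtx) (v : Exp) (τ : Con) (G : GTy) (g : CGraph) : Prop :=
  (∃ Ψ', VCtx.Grow S S' Ψ Ψ' ∧ HasTyB true [] .empty Ψ' [] v τ .emp) ∧ Cost S S' G g

theorem Sound.mono {S S' : Finset ℕ} {Ψ : VCtx} {v : Exp} {τ τ' : Con} {G G' : GTy} {g : CGraph}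
    (h : Sound S S' Ψ v τ G g) (hΨ : Ψ.GensIn S) (hτ : ConEq [] Ψ [] τ τ' .ty) (hG : GEq G G') :
    Sound S S' Ψ v τ' G' g := by
  obtain ⟨⟨Ψ', hg, hv⟩, hc⟩ := h
  exact ⟨⟨Ψ', hg, .typeEq (hτ.weakenCtx (hg.sub hΨ)) hv⟩, hc.sim hG.nf⟩

/-- The hypothesis is lenient typing of a closed expression, but the value obtained is typed
strictly, as is needed when it is substituted into a function body. The context `Ψ` is general since
it grows with the generators created on the way. -/
theorem Eval.sound {S S' : Finset ℕ} {e v : Exp} {g : CGraph} (h : Eval S e v g S') :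
    ∀ {Ψ : VCtx} {τ : Con} {G : GTy}, Ψ.GensIn S → HasTyB false [] .empty Ψ [] e τ G →
      Sound S S' Ψ v τ G g := by
  induction h with
  | value hv hg =>
    intro Ψ τ G _ h
    obtain ⟨hv', hG⟩ := h.value hv
    exact ⟨⟨Ψ, .refl _ _ _, hv'⟩,
      (Cost.of_reach (fun T => .emp T hg) _ _).sim (G₁ := .emp) hG.symm.nf⟩
  | app ev₁ ev₂ ev₃ hg hg' ih₁ ih₂ ih₃ =>
    intro Ψ τ G hΨ h
    obtain ⟨_, _, hgen, hτ, hG⟩ := h.gen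
    refine Sound.mono ?_ hΨ hτ hG
    have hS₁ := ev₁.value_and_subset.2
    have hS₂ := ev₂.value_and_subset.2
    have hS₃ := ev₃.value_and_subset.2
    cases hgen with
    | app h₁ h₂ hf ht =>
      obtain ⟨⟨Ψ₁, gr₁, hF⟩, c₁⟩ := ih₁ hΨ h₁
      have hΨ₁ := gr₁.gensIn hΨ hS₁
      obtain ⟨⟨Ψ₂, gr₂, hv⟩, c₂⟩ := ih₂ hΨ₁ (h₂.weakenCtx (gr₁.sub hΨ))
      have hΨ₂ := gr₂.gensIn hΨ₁ hS₂
      have gr := gr₁.trans gr₂ hS₁ hS₂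
      obtain ⟨G', hb, hs⟩ := (hF.weakenCtx (gr₂.sub hΨ₁)).app_fn (hf.weakenCtx (gr.sub hΨ))
        (ht.weakenCtx (gr.sub hΨ)) hv
      obtain ⟨⟨Ψ₃, gr₃, hv'⟩, c₃⟩ := ih₃ hΨ₂ hb
      refine ⟨⟨Ψ₃, gr.trans gr₃ (hS₁.trans hS₂) hS₃, hv'⟩, ?_⟩
      -- The cost of the unrolled body is folded back into an application of the recursive graph
      -- type, which matches the annotation of the arrow up to `GSim`.
      exact .seq (.seq c₁ c₂ hg hS₁ hS₂) ((c₃.map Reach.app).sim (.app _ _ hs)) hg'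
        (hS₁.trans hS₂) hS₃
  | pair ev₁ ev₂ hg ih₁ ih₂ =>
    intro Ψ τ G hΨ h
    obtain ⟨_, _, hgen, hτ, hG⟩ := h.gen
    refine Sound.mono ?_ hΨ hτ hG
    have hS₁ := ev₁.value_and_subset.2
    have hS₂ := ev₂.value_and_subset.2
    cases hgen with
    | pair h₁ h₂ =>
      obtain ⟨⟨Ψ₁, gr₁, hv₁⟩, c₁⟩ := ih₁ hΨ h₁
      have hΨ₁ := gr₁.gensIn hΨ hS₁
      obtain ⟨⟨Ψ₂, gr₂, hv₂⟩, c₂⟩ := ih₂ hΨ₁ (h₂.weakenCtx (gr₁.sub hΨ))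
      refine ⟨⟨Ψ₂, gr₁.trans gr₂ hS₁ hS₂, .graphEq .unit ?_⟩, c₁.seq c₂ hg hS₁ hS₂⟩
      exact .pair (fun _ => .empty_left _) (hv₁.weakenCtx (gr₂.sub hΨ₁)) hv₂
  | fst ev ih =>
    intro Ψ τ G hΨ h
    obtain ⟨_, _, hgen, hτ, hG⟩ := h.gen
    refine Sound.mono ?_ hΨ hτ hG
    cases hgen with
    | fst h =>
      obtain ⟨⟨Ψ', gr, hv⟩, c⟩ := ih hΨ h
      cases ev.value_and_subset.1 with
      | pair hv₁ hv₂ => exact ⟨⟨Ψ', gr, (hv.pair_inv hv₁ hv₂).1⟩, c⟩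
  | snd ev ih =>
    intro Ψ τ G hΨ h
    obtain ⟨_, _, hgen, hτ, hG⟩ := h.gen
    refine Sound.mono ?_ hΨ hτ hG
    cases hgen with
    | snd h =>
      obtain ⟨⟨Ψ', gr, hv⟩, c⟩ := ih hΨ h
      cases ev.value_and_subset.1 with
      | pair hv₁ hv₂ => exact ⟨⟨Ψ', gr, (hv.pair_inv hv₁ hv₂).2⟩, c⟩
  | inl ev ih =>
    intro Ψ τ G hΨ h
    obtain ⟨_, _, hgen, hτ, hG⟩ := h.gen
    refine Sound.mono ?_ hΨ hτ hG
    cases hgen with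
    | inl h hk =>
      obtain ⟨⟨Ψ', gr, hv⟩, c⟩ := ih hΨ h
      exact ⟨⟨Ψ', gr, .inl hv (hk.weakenCtx (gr.sub hΨ))⟩, c⟩
  | inr ev ih =>
    intro Ψ τ G hΨ h
    obtain ⟨_, _, hgen, hτ, hG⟩ := h.gen
    refine Sound.mono ?_ hΨ hτ hG
    cases hgen with
    | inr h hk =>
      obtain ⟨⟨Ψ', gr, hv⟩, c⟩ := ih hΨ h
      exact ⟨⟨Ψ', gr, .inr hv (hk.weakenCtx (gr.sub hΨ))⟩, c⟩
  | caseL ev₁ ev₂ hg ih₁ ih₂ =>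
    intro Ψ τ G hΨ h
    obtain ⟨_, _, hgen, hτ, hG⟩ := h.gen
    refine Sound.mono ?_ hΨ hτ hG
    have hS₁ := ev₁.value_and_subset.2
    have hS₂ := ev₂.value_and_subset.2
    cases hgen with
    | case h₁ h₂ h₃ =>
      obtain ⟨⟨Ψ₁, gr₁, hv⟩, c₁⟩ := ih₁ hΨ h₁
      cases ev₁.value_and_subset.1 with
      | inl hv₁ =>
        have hv := hv.inl_inv hv₁
        have hΨ₁ := gr₁.gensIn hΨ hS₁
        obtain ⟨⟨Ψ₂, gr₂, hv₂⟩, c₂⟩ := ih₂ hΨ₁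
          ((h₂.weakenCtx (gr₁.sub hΨ)).esubst (.instE hv))
        refine ⟨⟨Ψ₂, gr₁.trans gr₂ hS₁ hS₂, hv₂⟩, c₁.seq (c₂.orLeft ?_) hg hS₁ hS₂⟩
        -- The graph type of the branch not taken is closed, as `Δ` is empty.
        exact (h₃.regular (by simpa using (h₁.regular (by simp)).1.sum_inv.2)).2.2
  | caseR ev₁ ev₂ hg ih₁ ih₂ =>
    intro Ψ τ G hΨ h
    obtain ⟨_, _, hgen, hτ, hG⟩ := h.gen
    refine Sound.mono ?_ hΨ hτ hG
    have hS₁ := ev₁.value_and_subset.2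
    have hS₂ := ev₂.value_and_subset.2
    cases hgen with
    | case h₁ h₂ h₃ =>
      obtain ⟨⟨Ψ₁, gr₁, hv⟩, c₁⟩ := ih₁ hΨ h₁
      cases ev₁.value_and_subset.1 with
      | inr hv₁ =>
        have hv := hv.inr_inv hv₁
        have hΨ₁ := gr₁.gensIn hΨ hS₁
        obtain ⟨⟨Ψ₂, gr₂, hv₂⟩, c₂⟩ := ih₂ hΨ₁
          ((h₃.weakenCtx (gr₁.sub hΨ)).esubst (.instE hv))
        refine ⟨⟨Ψ₂, gr₁.trans gr₂ hS₁ hS₂, hv₂⟩, c₁.seq (.orRight ?_ c₂) hg hS₁ hS₂⟩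
        exact (h₂.regular (by simpa using (h₁.regular (by simp)).1.sum_inv.1)).2.2
  | roll ev ih =>
    intro Ψ τ G hΨ h
    obtain ⟨_, _, hgen, hτ, hG⟩ := h.gen
    refine Sound.mono ?_ hΨ hτ hG
    cases hgen with
    | roll h hk =>
      obtain ⟨⟨Ψ', gr, hv⟩, c⟩ := ih hΨ h
      exact ⟨⟨Ψ', gr, .roll hv (hk.weakenCtx (gr.sub hΨ))⟩, c⟩
  | unroll ev ih =>
    intro Ψ τ G hΨ h
    obtain ⟨_, _, hgen, hτ, hG⟩ := h.gen
    refine Sound.mono ?_ hΨ hτ hG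
    cases hgen with
    | unroll h =>
      obtain ⟨⟨Ψ', gr, hv⟩, c⟩ := ih hΨ h
      cases ev.value_and_subset.1 with
      | roll hv' => exact ⟨⟨Ψ', gr, hv.roll_inv hv'⟩, c⟩
  | future ev hu hp hg ih =>
    intro Ψ τ G hΨ h
    obtain ⟨_, _, hgen, hτ, hG⟩ := h.gen
    refine Sound.mono ?_ hΨ hτ hG
    cases hgen with
    | future h hu' =>
      obtain ⟨⟨Ψ', gr, hv⟩, c⟩ := ih hΨ h
      have hu' := hu'.weakenCtx (gr.sub hΨ)
      have he := hu'.eq_nf rfl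
      rw [← hu.eq_nf] at he
      -- The handle stores the normalized path `p`, whereas the type mentions the original vertex
      -- structure; `he` relates the two.
      refine ⟨⟨Ψ', gr, .typeEq (.fut (.refl (hv.regular (by simp)).1) (.comm he)) ?_⟩,
        c.map fun r => r.spawn hu hg⟩
      exact .handle hp ev.value_and_subset.1 hv he.inv.2.1
  | force ev ht hg ih =>
    intro Ψ τ G hΨ h
    obtain ⟨_, _, hgen, hτ, hG⟩ := h.gen
    refine Sound.mono ?_ hΨ hτ hG
    cases hgen with
    | force h =>
      obtain ⟨⟨Ψ', gr, hv⟩, c⟩ := ih hΨ h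
      obtain ⟨hv, hu⟩ := hv.handle_inv
      exact ⟨⟨Ψ', gr, hv⟩, c.seq (.of_reach (fun T => .touch T hu ht) _ _) hg
        ev.value_and_subset.2 (Finset.Subset.refl _)⟩
  | @new S _ s U _ _ _ hs ev ih =>
    intro Ψ τ G hΨ h
    obtain ⟨_, _, hgen, hτ, hG⟩ := h.gen
    refine Sound.mono ?_ hΨ hτ hG
    have hS := ev.value_and_subset.2
    cases hgen with
    | new h =>
      have gr₁ : VCtx.Grow S (insert s S) Ψ _ := .single hs U
      -- The context is first enlarged by the new generator, below the binder; then the bound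
      -- variable is instantiated by it.
      have hσ : SubOK (instV (.gen s)) (Ψ.push (some U)) (Ψ.addGens [(s, U)]) := by
        have hsub := gr₁.sub hΨ
        exact (SubOK.of_sub (hsub.push (some U))).comp
          (.instV (.psiGen (by simp [VCtx.addGens])))
      have h' := h.vsubst hσ nofun
      simp only [List.map_nil, Con.vshift_instV] at h'
      obtain ⟨⟨Ψ', gr, hv⟩, c⟩ := ih (gr₁.gensIn hΨ (Finset.subset_insert _ _)) h'
      exact ⟨⟨Ψ', gr₁.trans gr (Finset.subset_insert _ _) hS, hv⟩,
        .new U hs (hS (Finset.mem_insert_self _ _)) c⟩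

end GraphTypes

/-- Soundness of the graph type system. `S` is a finite set of generators in use that contains all
generators of the contexts; the generators of `Ψ₀` are fresh and created by the evaluation. -/
theorem theorem2 (Ω Ψ : VCtx) (e v : Exp) (τ : Con) (G : GTy) (g : CGraph) (S S' : Finset ℕ)
    (hΩ : ∀ s U, Ω (VRoot.gen s) = some U → s ∈ S)
    (hΨ : ∀ s U, Ψ (VRoot.gen s) = some U → s ∈ S)
    (hty : HasTy [] Ω Ψ [] e τ G)
    (hev : Eval S e v g S') :
    (∃ Ψ₀ : List (ℕ × VSTy),
      (Ψ₀.map Prod.fst).Nodup ∧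
      (∀ s ∈ Ψ₀.map Prod.fst, s ∉ S ∧ s ∈ S') ∧
      HasTy [] VCtx.empty (Ψ.addGens Ψ₀) [] v τ GTy.emp) ∧
    ∃ (G' H : GTy) (T : Finset ℕ), UnrStar G G' ∧ NBNF S G' H T ∧ g ∈ H.expand := by
  have h := HasTyB.of_hasTy hty
  obtain ⟨⟨_, ⟨L, hd, hL, rfl⟩, hv⟩, hc⟩ := hev.sound hΨ (h.relax _)
  -- At the top level the generators in use are just `S`, and no later evaluation remains whose
  -- generators would have to be avoided.
  obtain ⟨T, ⟨G', H, hu, hn, hg⟩, -⟩ := hc S ∅ fun _ _ hs => hs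
  exact ⟨⟨L, hd, hL, hv.hasTy rfl⟩, G', H, T, hu, hn, hg⟩
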